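/- **Virtual links.** A virtual link diagram is a generic unoriented diagram in the plane (closed curves with finitely many transverse double points; the empty diagram and circles without crossings are allowed) in which every double point is decorated either as a classical crossing (over/under) or as a virtual crossing. The virtual Reidemeister moves are the classical moves R1, R2, R3; their purely virtual analogues V1, V2, V3 (all crossings virtual); and VM, which moves a strand with two consecutive virtual crossings past a classical crossing. A *virtual link* is a class of virtual link diagrams up to virtual Reidemeister moves and planar isotopy. **Graphenes.** A matched diagram is a generic drawing in the plane of a trivalent graph (edges may intersect; closed unmatched edges without vertices are allowed) in which each vertex is decorated as solid or hollow, together with a perfect matching each of whose edges joins two distinct vertices and carries a sign $\pm$ and a direction (one of its two ends is dotted). The *ribbon moves* are: removal of a kink of an edge (M1); removal of two consecutive intersections of two edges (M2); moving an edge past an intersection of two edges (M3); moving an edge past a vertex (M4); replacing a hollow vertex by a solid one whose two unmatched legs cross (M5). The *non-ribbon moves* are, with all vertices solid where nothing else is said: - G1 (bigon): if a matched edge is parallel to an unmatched edge with the same two ends, so that the two bound a bigon, then the matched edge is deleted, and the two remaining unmatched legs and the unmatched edge become one arc; - G2 (square): two matched edges joining two parallel strands like consecutive rungs of a ladder, with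 opposite signs and with dots on opposite strands, where the dot of the positive one is on the left strand (the strands running vertically), are deleted; - G3 (hexagon): for three vertical strands, let $e_{ij}$ be a horizontal matched edge from strand $i$ to strand $j$, where $e_{13}$ intersects strand $2$ once, all three edges have the same sign and all are dotted at the left end, or all at the right end; then the configuration with $e_{12},e_{13},e_{23}$ from bottom to top is exchanged with the one with $e_{23},e_{13},e_{12}$ from bottom to top; - G4: both ends of a matched edge are switched between solid and hollow; - G5: a positive matched edge with one hollow and one solid end is exchanged with a negative matched edge with two solid ends and the opposite direction. A *graphene* is a class of matched diagrams up to graphene moves (ribbon and non-ribbon moves) and planar isotopy. **The replacements.** Call a matched diagram *simple* if all its vertices are solid and no matched edge intersects itself or another edge. For a simple diagram $D$, the virtual link diagram $\mathbb K(D)$ is obtained by replacing every intersection of (unmatched) edges by a virtual crossing and every matched edge by a clasp: the two unmatched legs at its dotted end are joined to one strand, those at its other end to another strand, and these strands cross twice, once classically and once virtually. For a positive matched edge drawn vertically with its dot on top, the classical crossing is the left one and the strand coming from the dotted end passes over there; for a negative edge it passes under. For a general matched diagram, hollow vertices are first made solid by M5; then $\mathbb K$ replaces each matched edge by two parallel strands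 with the clasp at its dotted end, and all intersections with these become virtual crossings. Conversely, for a virtual link diagram $L$, the matched diagram $\mathbb K^{-1}(L)$ is obtained by turning virtual crossings into intersections of unmatched edges and by replacing each classical crossing, rotated so that its over-strand runs from the lower right to the upper left, by a positive vertical matched edge with solid vertices, dotted on top, whose upper vertex is joined to the two ends of the over-strand and whose lower vertex is joined to the two ends of the under-strand (the right-hand legs of the two vertices intersect once). Let $\mathbb G$ be the category whose objects are graphenes and $\mathbb L$ the category whose objects are virtual links, both with identity morphisms only. **Theorem.** 1. Every matched diagram is related to a simple one by ribbon moves and planar isotopy. 2. If matched diagrams $D_1,D_2$ are related by graphene moves and planar isotopies, then $\mathbb K(D_1),\mathbb K(D_2)$ are related by virtual Reidemeister moves and planar isotopies. 3. If virtual link diagrams $L_1,L_2$ are related by virtual Reidemeister moves and planar isotopies, then $\mathbb K^{-1}(L_1),\mathbb K^{-1}(L_2)$ are related by graphene moves and planar isotopies. 4. For every matched diagram $D$, $\mathbb K^{-1}(\mathbb K(D))$ represents the same graphene as $D$; for every virtual link diagram $L$, $\mathbb K(\mathbb K^{-1}(L))$ represents the same virtual link as $L$. 5. Hence $\mathbb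 K$ and $\mathbb K^{-1}$ induce functors $\mathbb K:\mathbb G\to\mathbb L$ and $\mathbb K^{-1}:\mathbb L\to\mathbb G$ with $\mathbb K^{-1}\circ\mathbb K=\mathrm{id}_{\mathbb G}$ and $\mathbb K\circ\mathbb K^{-1}=\mathrm{id}_{\mathbb L}$; that is, $\mathbb K$ is an isomorphism of categories. Here planar diagrams up to planar isotopy are understood combinatorially: a generic diagram is a finite word of elementary pieces (minima, maxima, crossings, vertices), ordered by height, and planar isotopy is generated by exchanging the heights of distant pieces, cancelling neighbouring minima and maxima, and rotating crossings and vertices. -/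

import Mathlib

/-!
Plane pictures (link diagrams, graphs drawn in the plane) are recorded by cutting them along
horizontal lines, from bottom to top, into slices that contain exactly one elementary piece each:
a minimum, a maximum, a crossing of two strands, or a vertex. All other strands of a slice run
vertically. A picture is then a finite word of pairs `(i, g)`, where `g` is the elementary piece
and `i` is the number of strands to its left. Every generic plane picture is of this form up to
planar isotopy. Planar isotopies are generated by the exchange of the heights of two distant
pieces, the cancellation of a minimum against a neighbouring maximum, and the rotation of
crossings and vertices; these are listed explicitly below for the two kinds of pictures.
-/

namespace GrapheneLink

/-- A plane picture with elementary pieces in `G`, read from bottom to top. -/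
abbrev Word (G : Type) : Type := List (ℕ × G)

namespace Word

/-- Put `n` vertical strands to the left of the picture. -/
def shift {G : Type} (n : ℕ) (w : Word G) : Word G := w.map fun s => (n + s.1, s.2)

/-- `Reads T a w b`: the strands of the picture `w` can be marked by elements of `A` in such a way
that the strands at the bottom carry the marks `a`, those at the top carry the marks `b`, every
piece satisfies the rule `T` (marks below, marks above), and the mark of a strand does not change
along a slice in which the strand just runs vertically. -/
def Reads {G A : Type} (T : G → List A → List A → Prop) : List A → Word G → List A → Prop
  | a, [], b => a = b
  | a, (i, g) :: w, b => ∃ l x y r : List A,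
      l.length = i ∧ T g x y ∧ a = l ++ x ++ r ∧ Reads T (l ++ y ++ r) w b

/-- `w'` arises from `w` by one local replacement `v → v'` with `R v v'`, anywhere in `w`. -/
inductive Step {G : Type} (R : Word G → Word G → Prop) : Word G → Word G → Prop
  | mk (p q : Word G) (n : ℕ) (v v' : Word G) (h : R v v') :
      Step R (p ++ shift n v ++ q) (p ++ shift n v' ++ q)

theorem Reads.append {G A : Type} {T : G → List A → List A → Prop} {w w' : Word G} :
    ∀ {a b c : List A}, Reads T a w b → Reads T b w' c → Reads T a (w ++ w') c := by
  induction w with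
  | nil => intro a b c h h'; cases h; exact h'
  | cons s w ih =>
    obtain ⟨i, g⟩ := s
    rintro a b c ⟨l, x, y, r, h1, h2, h3, h4⟩ h'
    exact ⟨l, x, y, r, h1, h2, h3, ih h4 h'⟩

theorem Reads.whisker {G A : Type} {T : G → List A → List A → Prop} (p q : List A) {w : Word G} :
    ∀ {a b : List A}, Reads T a w b → Reads T (p ++ a ++ q) (w.shift p.length) (p ++ b ++ q) := by
  induction w with
  | nil => intro a b h; cases h; rfl
  | cons s w ih =>
    obtain ⟨i, g⟩ := s
    rintro a b ⟨l, x, y, r, h1, h2, h3, h4⟩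
    refine ⟨p ++ l, x, y, r ++ q, by simp [h1], h2, by simp [h3], ?_⟩
    simpa only [shift, List.append_assoc] using ih h4

end Word

/-! ### Virtual link diagrams -/

/-- The decorations of the 4-valent vertices of a virtual link diagram. At `classical true` the
strand from the lower left to the upper right passes over the other one, at `classical false`
it passes under. -/
inductive Crossing : Type
  | classical (rightOver : Bool)
  | virtual

/-- The same crossing seen after rotating the plane by a quarter turn (in either sense). -/
def Crossing.turn : Crossing → Crossing
  | classical b => classical (!b)
  | virtual => virtual

/-- Elementary pieces of virtual link diagrams: a minimum (`cup`), a maximum (`cap`), a crossing. -/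
inductive VGen : Type
  | cup
  | cap
  | cross (c : Crossing)

namespace VGen

/-- Number of strands below a piece. -/
def src : VGen → ℕ
  | cup => 0
  | cap => 2
  | cross _ => 2

/-- Number of strands above a piece. -/
def tgt : VGen → ℕ
  | cup => 2
  | cap => 0
  | cross _ => 2

/-- The strands carry no decoration. -/
def Rule (g : VGen) (x y : List Unit) : Prop :=
  x = List.replicate g.src () ∧ y = List.replicate g.tgt ()

end VGen

/-- A virtual link diagram (unoriented, closed; components without crossings and the empty diagram
are allowed). -/
structure VirtualDiagram : Type where
  word : Word VGen
  closed : Word.Reads VGen.Rule [] word []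

open VGen in
/-- Planar isotopy of virtual link diagrams. -/
inductive VirtualIsotopy : Word VGen → Word VGen → Prop
  /-- Two distant pieces exchange their heights. -/
  | interchange (g h : VGen) (k : ℕ) :
      VirtualIsotopy [(0, g), (g.tgt + k, h)] [(g.src + k, h), (0, g)]
  | zigzagLeft : VirtualIsotopy [(0, cup), (1, cap)] []
  | zigzagRight : VirtualIsotopy [(1, cup), (0, cap)] []
  /-- A crossing is rotated through a maximum of one of its strands. -/
  | capSlide (c : Crossing) :
      VirtualIsotopy [(0, cross c), (1, cap)] [(1, cross c.turn), (0, cap)]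
  /-- A crossing is rotated through a minimum of one of its strands. -/
  | cupSlide (c : Crossing) :
      VirtualIsotopy [(0, cup), (1, cross c)] [(1, cup), (0, cross c.turn)]

open VGen Crossing in
/-- The virtual Reidemeister moves: the three classical ones and the four virtual ones. -/
inductive VirtualReidemeister : Word VGen → Word VGen → Prop
  | R1 (b : Bool) :
      VirtualReidemeister [(1, cup), (0, cross (classical b)), (1, cap)] []
  | R2 (b : Bool) :
      VirtualReidemeister [(0, cross (classical b)), (0, cross (classical (!b)))] []
  | R3 (b : Bool) :
      VirtualReidemeister
        [(0, cross (classical b)), (1, cross (classical b)), (0, cross (classical b))]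
        [(1, cross (classical b)), (0, cross (classical b)), (1, cross (classical b))]
  | V1 : VirtualReidemeister [(1, cup), (0, cross virtual), (1, cap)] []
  | V2 : VirtualReidemeister [(0, cross virtual), (0, cross virtual)] []
  | V3 :
      VirtualReidemeister
        [(0, cross virtual), (1, cross virtual), (0, cross virtual)]
        [(1, cross virtual), (0, cross virtual), (1, cross virtual)]
  /-- A strand with two consecutive virtual crossings moves past a classical crossing. -/
  | VM (b : Bool) :
      VirtualReidemeister
        [(0, cross virtual), (1, cross virtual), (0, cross (classical b))]
        [(1, cross (classical b)), (0, cross virtual), (1, cross virtual)]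

/-- One planar isotopy step or one virtual Reidemeister move. -/
def VirtualDiagram.Move (L L' : VirtualDiagram) : Prop :=
  Word.Step (fun v v' => VirtualIsotopy v v' ∨ VirtualReidemeister v v') L.word L'.word

/-- Equivalence of virtual link diagrams: related by a finite sequence of virtual Reidemeister
moves (in either direction) and planar isotopies. -/
def VirtualDiagram.Equivalent : VirtualDiagram → VirtualDiagram → Prop :=
  Relation.EqvGen VirtualDiagram.Move

/-- Virtual links: equivalence classes of virtual link diagrams. -/
def VirtualLink : Type := Quot VirtualDiagram.Move

/-- The virtual link represented by a diagram. -/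
def VirtualDiagram.toLink (L : VirtualDiagram) : VirtualLink := Quot.mk _ L

/-! ### Matched diagrams -/

/-- A strand of a matched diagram is part of an unmatched edge or of a matched edge. A matched edge
has a sign (`true` is positive) and a direction: one of its two ends carries a dot. The second flag
of `matched` is `true` if one runs upwards when following the strand towards the dotted end. -/
inductive Strand : Type
  | unmatched
  | matched (sign dotUp : Bool)

/-- The other leg of a minimum or maximum with a given leg. -/
def Strand.dual : Strand → Strand
  | unmatched => unmatched
  | matched s d => matched s (!d)

/-- Elementary pieces of matched diagrams: minima, maxima, intersections of two edges, and trivalent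
vertices, solid or hollow, at which one matched and two unmatched edges meet. At `split` the matched
edge ends from below, so that this vertex is its dotted end iff `d = true`; at `merge` it ends from
above, so that this vertex is its dotted end iff `d = false`. The argument `s` is the sign of the
matched edge. -/
inductive MGen : Type
  | cup (a : Strand)
  | cap (a : Strand)
  | cross (a b : Strand)
  | merge (solid s d : Bool)
  | split (solid s d : Bool)

namespace MGen
open Strand

/-- The strands below a piece, from left to right. -/
def src : MGen → List Strand
  | cup _ => []
  | cap a => [a, a.dual]
  | cross a b => [a, b]
  | merge _ _ _ => [unmatched, unmatched]
  | split _ s d => [matched s d]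

/-- The strands above a piece, from left to right. -/
def tgt : MGen → List Strand
  | cup a => [a, a.dual]
  | cap _ => []
  | cross a b => [b, a]
  | merge _ s d => [matched s d]
  | split _ _ _ => [unmatched, unmatched]

/-- The kinds of the strands at a piece. -/
def Rule (g : MGen) (x y : List Strand) : Prop := x = g.src ∧ y = g.tgt

/-- Numberings of the strands that strictly increase at every minimum and maximum of a matched
edge, when this edge is followed towards its dot; numbers on unmatched strands are irrelevant. -/
inductive NumberingRule : MGen → List ℕ → List ℕ → Prop
  | cupUnmatched (x y : ℕ) : NumberingRule (cup unmatched) [] [x, y]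
  | capUnmatched (x y : ℕ) : NumberingRule (cap unmatched) [x, y] []
  | cupTrue (s : Bool) (x y : ℕ) (h : y < x) : NumberingRule (cup (matched s true)) [] [x, y]
  | cupFalse (s : Bool) (x y : ℕ) (h : x < y) : NumberingRule (cup (matched s false)) [] [x, y]
  | capTrue (s : Bool) (x y : ℕ) (h : x < y) : NumberingRule (cap (matched s true)) [x, y] []
  | capFalse (s : Bool) (x y : ℕ) (h : y < x) : NumberingRule (cap (matched s false)) [x, y] []
  | cross (a b : Strand) (x y : ℕ) : NumberingRule (cross a b) [x, y] [y, x]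
  | merge (c s d : Bool) (x y z : ℕ) : NumberingRule (merge c s d) [x, y] [z]
  | split (c s d : Bool) (x y z : ℕ) : NumberingRule (split c s d) [z] [x, y]

end MGen

/-- A matched diagram: a trivalent graph drawn in the plane, possibly with intersections between its
edges, with solid or hollow vertices and a directed, signed perfect matching. Unmatched edges may be
closed curves without vertices. Matched edges have two ends: by `noMatchedLoop` no
matched curve closes up, because the numbers in `NumberingRule` would increase at each of its minima
and maxima; a matched arc can always be numbered like this. -/
structure MatchedDiagram : Type where
  word : Word MGen
  closed : Word.Reads MGen.Rule [] word []
  noMatchedLoop : Word.Reads MGen.NumberingRule [] word []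

open MGen Strand in
/-- Planar isotopy of matched diagrams. -/
inductive MatchedIsotopy : Word MGen → Word MGen → Prop
  /-- Two distant pieces exchange their heights. -/
  | interchange (g h : MGen) (k : ℕ) :
      MatchedIsotopy [(0, g), (g.tgt.length + k, h)] [(g.src.length + k, h), (0, g)]
  | zigzagLeft (a : Strand) : MatchedIsotopy [(0, cup a), (1, cap a.dual)] []
  | zigzagRight (a : Strand) : MatchedIsotopy [(1, cup a.dual), (0, cap a)] []
  /-- An intersection is rotated through a maximum of one of its strands. -/
  | capSlide (a x : Strand) :
      MatchedIsotopy [(0, cross a x), (1, cap a)] [(1, cross x a.dual), (0, cap a)]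
  /-- An intersection is rotated through a minimum of one of its strands. -/
  | cupSlide (a x : Strand) :
      MatchedIsotopy [(0, cup a), (1, cross a.dual x)] [(1, cup a), (0, cross x a)]
  /-- A vertex is rotated by a half turn. -/
  | turnLeft (c s d : Bool) :
      MatchedIsotopy [(0, merge c s d)]
        [(0, cup (matched s d)), (1, split c s (!d)), (2, cap unmatched), (1, cap unmatched)]
  /-- A vertex is rotated by a half turn in the opposite sense. -/
  | turnRight (c s d : Bool) :
      MatchedIsotopy [(0, merge c s d)]
        [(2, cup (matched s (!d))), (2, split c s (!d)), (1, cap unmatched), (0, cap unmatched)]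

open MGen Strand in
/-- The ribbon moves. -/
inductive RibbonMove : Word MGen → Word MGen → Prop
  /-- An edge loses a kink. -/
  | M1 (a : Strand) : RibbonMove [(1, cup a), (0, cross a a), (1, cap a)] []
  /-- Two edges lose two consecutive intersections. -/
  | M2 (a b : Strand) : RibbonMove [(0, cross a b), (0, cross b a)] []
  /-- An edge moves past an intersection of two edges. -/
  | M3 (a b c : Strand) :
      RibbonMove [(0, cross a b), (1, cross a c), (0, cross b c)]
        [(1, cross b c), (0, cross a c), (1, cross a b)]
  /-- An edge moves past a vertex. -/
  | M4 (a : Strand) (c s d : Bool) :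
      RibbonMove [(0, split c s d), (1, cross unmatched a), (0, cross unmatched a)]
        [(0, cross (matched s d) a), (1, split c s d)]
  /-- A hollow vertex is a solid vertex with a twist. -/
  | M5 (s d : Bool) :
      RibbonMove [(0, split false s d)] [(0, split true s d), (0, cross unmatched unmatched)]

open MGen Strand in
/-- A vertical matched edge of sign `s` with lower vertex `c` and upper vertex `c'` (`true` for
solid). The dot is at the upper vertex iff `d = true`. -/
def bar (c c' s d : Bool) : Word MGen := [(0, merge c s d), (0, split c' s d)]

open MGen Strand in
/-- Two vertical unmatched strands, joined by a horizontal matched edge of sign `s` with solid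
vertices. The dot is at the right vertex iff `d = true`. -/
def rung (s d : Bool) : Word MGen :=
  [(0, cup unmatched), (1, merge true s d), (1, split true s d), (2, cap unmatched)]

open MGen Strand in
/-- Three vertical unmatched strands, the outer two of which are joined by a horizontal matched edge
of sign `s` with solid vertices, which intersects the middle strand. The dot is at the right vertex
iff `d = true`. -/
def longRung (s d : Bool) : Word MGen :=
  [(0, cup unmatched), (1, merge true s d), (1, cross (matched s d) unmatched),
    (2, split true s d), (3, cap unmatched)]

open MGen Strand in
/-- The non-ribbon moves. -/
inductive NonRibbonMove : Word MGen → Word MGen → Prop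
  /-- The bigon move: a matched edge parallel to an unmatched edge is removed. -/
  | G1 (s d : Bool) : NonRibbonMove (rung s d ++ [(0, cap unmatched)]) [(0, cap unmatched)]
  /-- The square move: two consecutive matched edges with opposite signs and opposite directions
  between two strands are removed. -/
  | G2 (s : Bool) : NonRibbonMove (rung s (!s) ++ rung (!s) s) []
  /-- The hexagon move. -/
  | G3 (s d : Bool) :
      NonRibbonMove (rung s d ++ longRung s d ++ (rung s d).shift 1)
        ((rung s d).shift 1 ++ longRung s d ++ rung s d)
  /-- Both vertices of a matched edge change between solid and hollow. -/
  | G4 (c c' s d : Bool) : NonRibbonMove (bar c c' s d) (bar (!c) (!c') s d)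
  /-- A positive matched edge with one hollow vertex is a negative matched edge with the opposite
  direction and solid vertices. -/
  | G5 (d : Bool) : NonRibbonMove (bar false true true d) (bar true true false (!d))

/-- One planar isotopy step or one graphene move, that is, a ribbon or a non-ribbon move. -/
def MatchedDiagram.Move (D D' : MatchedDiagram) : Prop :=
  Word.Step (fun v v' => MatchedIsotopy v v' ∨ RibbonMove v v' ∨ NonRibbonMove v v') D.word D'.word

/-- Equivalence of matched diagrams: related by a finite sequence of graphene moves (in either
direction) and planar isotopies. -/
def MatchedDiagram.Equivalent : MatchedDiagram → MatchedDiagram → Prop :=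
  Relation.EqvGen MatchedDiagram.Move

/-- Two matched diagrams are related by a finite sequence of ribbon moves and planar isotopies. -/
def MatchedDiagram.RibbonEquivalent : MatchedDiagram → MatchedDiagram → Prop :=
  Relation.EqvGen fun D D' =>
    Word.Step (fun v v' => MatchedIsotopy v v' ∨ RibbonMove v v') D.word D'.word

/-- Graphenes: equivalence classes of matched diagrams. -/
def Graphene : Type := Quot MatchedDiagram.Move

/-- The graphene represented by a matched diagram. -/
def MatchedDiagram.toGraphene (D : MatchedDiagram) : Graphene := Quot.mk _ D

/-- Pieces of diagrams all of whose vertices are solid and whose matched edges have no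
intersections. -/
def MGen.IsSimple : MGen → Prop
  | .cross a b => a = .unmatched ∧ b = .unmatched
  | .merge c _ _ => c = true
  | .split c _ _ => c = true
  | _ => True

/-- All vertices are solid, and no matched edge intersects itself or another edge. -/
def MatchedDiagram.IsSimple (D : MatchedDiagram) : Prop := ∀ p ∈ D.word, p.2.IsSimple

/-! ### From matched diagrams to virtual link diagrams -/

open VGen Crossing in
/-- The replacement of the pieces. A matched edge with solid vertices is replaced by a clasp: the two
unmatched edges at its dotted end become one strand, the two unmatched edges at its other end become
a second strand, and these two strands cross twice, once classically and once virtually. For a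
positive vertical matched edge whose dot is on top, the classical crossing is the left one and the
strand from the top passes over; for a negative one it passes under. The clasp is put at the dotted
end, so that the matched edge itself is replaced by two parallel strands. A hollow vertex is a solid
one with a twist, and all intersections are replaced by virtual crossings. -/
def linkPiece : MGen → Word VGen
  | .cup .unmatched => [(0, cup)]
  | .cup (.matched _ _) => [(0, cup), (1, cup)]
  | .cap .unmatched => [(0, cap)]
  | .cap (.matched _ _) => [(1, cap), (0, cap)]
  | .cross .unmatched .unmatched => [(0, cross virtual)]
  | .cross .unmatched (.matched _ _) => [(0, cross virtual), (1, cross virtual)]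
  | .cross (.matched _ _) .unmatched => [(1, cross virtual), (0, cross virtual)]
  | .cross (.matched _ _) (.matched _ _) =>
      [(1, cross virtual), (0, cross virtual), (2, cross virtual), (1, cross virtual)]
  | .split c s d =>
      (if d then [(1, cup), (0, cross (classical (!s))), (2, cross virtual), (1, cap)] else []) ++
        (if c then [] else [(0, cross virtual)])
  | .merge c s d =>
      (if c then [] else [(0, cross virtual)]) ++
        (if d then [] else
          [(1, cup), (0, cross virtual), (2, cross (classical (!s))), (1, cap)])

/-- The strands that replace one strand: matched strands are doubled. -/
def linkStrand : Strand → List Unit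
  | .unmatched => [()]
  | .matched _ _ => [(), ()]

/-- Replace every piece of a picture; the first argument lists the strands at the bottom. -/
def linkWord : List Strand → Word MGen → Word VGen
  | _, [] => []
  | a, (i, g) :: w =>
      (linkPiece g).shift ((a.take i).flatMap linkStrand).length ++
        linkWord (a.take i ++ g.tgt ++ a.drop (i + g.src.length)) w

theorem reads_linkPiece (g : MGen) :
    Word.Reads VGen.Rule (g.src.flatMap linkStrand) (linkPiece g)
      (g.tgt.flatMap linkStrand) := by
  have key : ∀ (i r : ℕ) (g : VGen) (w : Word VGen) (a b : List Unit),
      a = List.replicate i () ++ List.replicate g.src () ++ List.replicate r () →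
      Word.Reads VGen.Rule
        (List.replicate i () ++ List.replicate g.tgt () ++ List.replicate r ()) w b →
      Word.Reads VGen.Rule a ((i, g) :: w) b := by
    intro i r g w a b h1 h2
    exact ⟨_, _, _, _, by simp, ⟨rfl, rfl⟩, h1, h2⟩
  rcases g with (_ | ⟨s, d⟩) | (_ | ⟨s, d⟩) | ⟨_ | ⟨s, d⟩, _ | ⟨s', d'⟩⟩ | ⟨c, s, d⟩ | ⟨c, s, d⟩
  · exact key 0 0 _ _ _ _ rfl rfl
  · exact key 0 0 _ _ _ _ rfl (key 1 1 _ _ _ _ rfl rfl)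
  · exact key 0 0 _ _ _ _ rfl rfl
  · exact key 1 1 _ _ _ _ rfl (key 0 0 _ _ _ _ rfl rfl)
  · exact key 0 0 _ _ _ _ rfl rfl
  · exact key 0 1 _ _ _ _ rfl (key 1 0 _ _ _ _ rfl rfl)
  · exact key 1 0 _ _ _ _ rfl (key 0 1 _ _ _ _ rfl rfl)
  · exact key 1 1 _ _ _ _ rfl (key 0 2 _ _ _ _ rfl (key 2 0 _ _ _ _ rfl
      (key 1 1 _ _ _ _ rfl rfl)))
  · refine Word.Reads.append (b := [(), ()]) ?_ ?_
    · cases c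
      · exact key 0 0 _ _ _ _ rfl rfl
      · rfl
    · cases d
      · exact key 1 1 _ _ _ _ rfl (key 0 2 _ _ _ _ rfl (key 2 0 _ _ _ _ rfl
          (key 1 1 _ _ _ _ rfl rfl)))
      · rfl
  · refine Word.Reads.append (b := [(), ()]) ?_ ?_
    · cases d
      · rfl
      · exact key 1 1 _ _ _ _ rfl (key 0 2 _ _ _ _ rfl (key 2 0 _ _ _ _ rfl
          (key 1 1 _ _ _ _ rfl rfl)))
    · cases c
      · exact key 0 0 _ _ _ _ rfl rfl
      · rfl

theorem reads_linkWord {w : Word MGen} : ∀ {a b : List Strand}, Word.Reads MGen.Rule a w b →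
    Word.Reads VGen.Rule (a.flatMap linkStrand) (linkWord a w)
      (b.flatMap linkStrand) := by
  induction w with
  | nil => intro a b h; cases h; rfl
  | cons p w ih =>
    obtain ⟨i, g⟩ := p
    rintro a b ⟨l, x, y, r, rfl, ⟨rfl, rfl⟩, rfl, h⟩
    have h1 := (reads_linkPiece g).whisker (l.flatMap linkStrand) (r.flatMap linkStrand)
    have h2 := ih h
    simp only [linkWord]
    refine Word.Reads.append (b := (l ++ g.tgt ++ r).flatMap linkStrand) ?_ ?_
    · simpa [List.flatMap_append] using h1
    · simpa using h2

/-- The diagrammatic replacement from matched diagrams to virtual link diagrams. -/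
def MatchedDiagram.toVirtual (D : MatchedDiagram) : VirtualDiagram where
  word := linkWord [] D.word
  closed := reads_linkWord D.closed

/-! ### From virtual link diagrams to matched diagrams -/

open MGen Strand in
/-- The matched edge that replaces a classical crossing whose strand from the lower right to the
upper left passes over: a positive vertical matched edge with solid vertices whose upper vertex
is dotted. The upper vertex is joined to the two ends of the overcrossing strand and the lower one
to the two ends of the undercrossing strand, which produces one intersection of unmatched edges, to
the right of the matched edge. -/
def crossingReplacement : Word MGen :=
  [(1, cup unmatched), (0, merge true true true), (0, split true true true),
    (2, cross unmatched unmatched), (1, cap unmatched)]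

open MGen Strand in
/-- The replacement of the pieces of a virtual link diagram. The classical crossing whose strand from
the lower left to the upper right passes over is the other one rotated by a quarter turn, and is
replaced accordingly. Virtual crossings become intersections of unmatched edges. -/
def matchedPiece : VGen → Word MGen
  | .cup => [(0, cup unmatched)]
  | .cap => [(0, cap unmatched)]
  | .cross .virtual => [(0, cross unmatched unmatched)]
  | .cross (.classical false) => crossingReplacement
  | .cross (.classical true) =>
      [(2, cup unmatched)] ++ crossingReplacement.shift 1 ++ [(0, cap unmatched)]

/-- Replace every piece of a virtual link diagram. -/
def matchedWord (w : Word VGen) : Word MGen := w.flatMap fun p => (matchedPiece p.2).shift p.1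

theorem reads_matchedWord {A : Type} {T : MGen → List A → List A → Prop} (u : A)
    (hT : ∀ g : VGen, Word.Reads T (List.replicate g.src u) (matchedPiece g) (List.replicate g.tgt u))
    {w : Word VGen} : ∀ {a b : List Unit}, Word.Reads VGen.Rule a w b →
      Word.Reads T (a.map fun _ => u) (matchedWord w) (b.map fun _ => u) := by
  induction w with
  | nil => intro a b h; cases h; rfl
  | cons p w ih =>
    obtain ⟨i, g⟩ := p
    rintro a b ⟨l, x, y, r, rfl, ⟨rfl, rfl⟩, rfl, h⟩
    have h1 := (hT g).whisker (l.map fun _ => u) (r.map fun _ => u)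
    have h2 := ih h
    simp only [matchedWord, List.flatMap_cons] at h2 ⊢
    refine Word.Reads.append (b := (l ++ List.replicate g.tgt () ++ r).map fun _ => u) ?_ h2
    simpa [Nat.add_assoc] using h1

theorem reads_crossingReplacement {A : Type} {T : MGen → List A → List A → Prop} (u m : A)
    (h1 : T (.cup .unmatched) [] [u, u]) (h2 : T (.cap .unmatched) [u, u] [])
    (h3 : T (.cross .unmatched .unmatched) [u, u] [u, u])
    (h4 : T (.merge true true true) [u, u] [m]) (h5 : T (.split true true true) [m] [u, u])
    (g : VGen) : Word.Reads T (List.replicate g.src u) (matchedPiece g) (List.replicate g.tgt u) := by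
  have h : Word.Reads T [u, u] crossingReplacement [u, u] :=
    ⟨[u], _, _, [u], rfl, h1, rfl, [], _, _, [u, u], rfl, h4, rfl, [], _, _, [u, u], rfl, h5, rfl,
      [u, u], _, _, [], rfl, h3, rfl, [u], _, _, [u], rfl, h2, rfl, rfl⟩
  rcases g with _ | _ | (_ | _) | _
  · exact ⟨[], _, _, [], rfl, h1, rfl, rfl⟩
  · exact ⟨[], _, _, [], rfl, h2, rfl, rfl⟩
  · exact h
  · refine Word.Reads.append (b := [u, u, u, u]) (Word.Reads.append (b := [u, u, u, u]) ?_ ?_) ?_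
    · exact ⟨[u, u], _, _, [], rfl, h1, rfl, rfl⟩
    · exact h.whisker [u] [u]
    · exact ⟨[], _, _, [u, u], rfl, h2, rfl, rfl⟩
  · exact ⟨[], _, _, [], rfl, h3, rfl, rfl⟩

/-- The diagrammatic replacement from virtual link diagrams to matched diagrams. -/
def VirtualDiagram.toMatched (L : VirtualDiagram) : MatchedDiagram where
  word := matchedWord L.word
  closed := reads_matchedWord Strand.unmatched
    (reads_crossingReplacement Strand.unmatched (.matched true true) ⟨rfl, rfl⟩ ⟨rfl, rfl⟩
      ⟨rfl, rfl⟩ ⟨rfl, rfl⟩ ⟨rfl, rfl⟩) L.closed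
  noMatchedLoop := reads_matchedWord 0
    (reads_crossingReplacement 0 0 (.cupUnmatched 0 0) (.capUnmatched 0 0) (.cross _ _ 0 0)
      (.merge _ _ _ 0 0 0) (.split _ _ _ 0 0 0)) L.closed

end GrapheneLink

/-!
Plane pictures are words of elementary pieces, so all assertions are about words up to local moves.
The proof works with words with open ends: `Theory.Eqv` relates two words if they are connected by
local moves through words that can all be read between the same marks at the bottom and at the top.
This relation is compatible with composition and with additional strands. Hence every assertion comes
down to equivalences between a few short words. Each of these is given as an explicit list of moves,
which is verified by computation (`Checker.eqv`).

*From matched diagrams to virtual links.* Planar isotopies, ribbon moves, G4 and G5 become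
compositions of isotopies and virtual moves (the lemmas `linkEqv_`), while the bigon, square and
hexagon moves become the Reidemeister moves R1, R2, R3, up to virtual moves (`linkWord_G1`,
`linkWord_G2`, `linkWord_G3`). It is essential for the converse that R1, R2, R3 can be recovered from
the images of these three moves (`R1_of_image`, `R2_of_image`, `R3_of_image`).

*From virtual links to matched diagrams.* The intermediate step is `boxTheory`, where a matched edge
only occurs as a vertical box with two strands below and two above. A strand can be moved past a box,
a half turn reverses the direction of a box, a box may be twisted at both ends (G4), and one twist
reverses sign and direction (G5). These rules imply that the replacement of a classical crossing by a
box can be rotated, that strands can be moved past it, and that a box is equivalent to the replacement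
of its clasp (`BoxLemma.clasp`). By the last statement the images of G1, G2, G3 under both
replacements become G1, G2, G3 again, so that R1, R2, R3 are respected (`Theory.Eqv.matchedWord`).

*The replacements are inverse to each other.* For a virtual link diagram this is a computation for each
piece (`linkWord_matchedWord`). For a matched diagram, the matched edges are first contracted to boxes
by ribbon moves: a vertex is moved along its matched edge, past crossings and through maxima and
minima, until it meets the other end. A weight drops in each step (`exists_noVertex`). In the end no
vertices remain outside of the boxes, and there cannot be other matched strands, because their numbers
would grow at each maximum and minimum of a closed curve (`Word.Reads.freeRule`). The resulting
diagram is simple, and it consists of pieces for which the assertion is known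
(`boxWord_linkWord`).
-/

/-! ### Words, contexts and typed equivalence -/

namespace GrapheneLink

namespace Word

variable {G A : Type} {T : G → List A → List A → Prop}

@[simp] theorem shift_nil (n : ℕ) : shift n ([] : Word G) = [] := rfl

@[simp] theorem shift_cons (n i : ℕ) (g : G) (w : Word G) :
    shift n ((i, g) :: w) = (n + i, g) :: shift n w := rfl

@[simp] theorem shift_append (n : ℕ) (v w : Word G) :
    shift n (v ++ w) = shift n v ++ shift n w := List.map_append

@[simp] theorem shift_shift (m n : ℕ) (w : Word G) : shift m (shift n w) = shift (m + n) w := by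
  simp [shift, Function.comp_def, Nat.add_assoc]

@[simp] theorem shift_zero (w : Word G) : shift 0 w = w := by
  simp [shift]

theorem reads_append {w w' : Word G} {a c : List A} :
    Reads T a (w ++ w') c ↔ ∃ b, Reads T a w b ∧ Reads T b w' c := by
  refine ⟨?_, fun ⟨b, h, h'⟩ => h.append h'⟩
  induction w generalizing a with
  | nil => exact fun h => ⟨a, rfl, h⟩
  | cons s w ih =>
    rintro ⟨l, x, y, r, h1, h2, h3, h4⟩
    obtain ⟨b, hb, hb'⟩ := ih h4
    exact ⟨b, ⟨l, x, y, r, h1, h2, h3, hb⟩, hb'⟩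

theorem Reads.piece {g : G} {x y : List A} (h : T g x y) (l r : List A) :
    Reads T (l ++ x ++ r) [(l.length, g)] (l ++ y ++ r) :=
  ⟨l, x, y, r, rfl, h, rfl, rfl⟩

theorem reads_piece {i : ℕ} {g : G} {a b : List A} :
    Reads T a [(i, g)] b ↔
      ∃ l x y r : List A, l.length = i ∧ T g x y ∧ a = l ++ x ++ r ∧ b = l ++ y ++ r := by
  constructor
  · rintro ⟨l, x, y, r, h1, h2, h3, h4⟩
    exact ⟨l, x, y, r, h1, h2, h3, h4.symm⟩
  · rintro ⟨l, x, y, r, h1, h2, h3, h4⟩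
    exact ⟨l, x, y, r, h1, h2, h3, h4.symm⟩

/-- Readings are transported along maps of the marks that respect the rules. -/
theorem Reads.map {B : Type} {T' : G → List B → List B → Prop} (f : A → B)
    (hf : ∀ g x y, T g x y → T' g (x.map f) (y.map f)) {w : Word G} :
    ∀ {a b : List A}, Reads T a w b → Reads T' (a.map f) w (b.map f) := by
  induction w with
  | nil => rintro a b rfl; rfl
  | cons s w ih =>
    rintro a b ⟨l, x, y, r, h1, h2, h3, h4⟩
    exact ⟨l.map f, x.map f, y.map f, r.map f, by simpa using h1, hf _ _ _ h2, by simp [h3],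
      by simpa using ih h4⟩

theorem Reads.mono {T' : G → List A → List A → Prop} (hf : ∀ g x y, T g x y → T' g x y)
    {w : Word G} {a b : List A} (h : Reads T a w b) : Reads T' a w b := by
  simpa using h.map (T' := T') id (by simpa using hf)

/-- If every rule determines the strands above from those below, so does every word. -/
theorem Reads.unique (hT : ∀ g x x' y y', T g x y → T g x' y' → x = x' ∧ y = y') {w : Word G} :
    ∀ {a b b' : List A}, Reads T a w b → Reads T a w b' → b = b' := by
  induction w with
  | nil => rintro a b b' rfl rfl; rfl
  | cons s w ih =>
    rintro a b b' ⟨l, x, y, r, h1, h2, rfl, h4⟩ ⟨l', x', y', r', h1', h2', h3', h4'⟩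
    obtain ⟨rfl, rfl⟩ := hT _ _ _ _ _ h2 h2'
    rw [List.append_assoc, List.append_assoc] at h3'
    obtain ⟨rfl, h⟩ := List.append_inj h3' (h1.trans h1'.symm)
    obtain rfl := List.append_cancel_left h
    exact ih h4 h4'

end Word

open Word

/-- A theory of plane pictures: the numbers of strands below and above a piece, the typing rule of
the pieces and the local moves, among which are the exchanges of heights of two pieces. -/
structure Theory (G A : Type) where
  /-- number of strands below -/
  src : G → ℕ
  /-- number of strands above -/
  tgt : G → ℕ
  /-- marks below and above a piece -/
  T : G → List A → List A → Prop
  /-- local moves -/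
  R : Word G → Word G → Prop
  length_of_T : ∀ {g x y}, T g x y → x.length = src g ∧ y.length = tgt g
  interchange : ∀ g h k, R [(0, g), (tgt g + k, h)] [(src g + k, h), (0, g)]

namespace Theory

variable {G A : Type} {Θ Θ' : Theory G A}

/-- Two pictures are related by local moves between pictures that all have a reading from `a` to
`b`. -/
def Eqv (Θ : Theory G A) (a b : List A) : Word G → Word G → Prop :=
  Relation.EqvGen fun w w' => Step Θ.R w w' ∧ Reads Θ.T a w b ∧ Reads Θ.T a w' b

namespace Eqv

theorem refl {a b : List A} (w : Word G) : Θ.Eqv a b w w := Relation.EqvGen.refl w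

theorem symm {a b : List A} {w w' : Word G} (h : Θ.Eqv a b w w') : Θ.Eqv a b w' w :=
  Relation.EqvGen.symm _ _ h

theorem trans {a b : List A} {w w' w'' : Word G} (h : Θ.Eqv a b w w') (h' : Θ.Eqv a b w' w'') :
    Θ.Eqv a b w w'' :=
  Relation.EqvGen.trans _ _ _ h h'

theorem of_eq {a b : List A} {w w' : Word G} (h : w = w') : Θ.Eqv a b w w' := h ▸ refl w

theorem of_step {a b : List A} {w w' : Word G} (h : Step Θ.R w w') (h1 : Reads Θ.T a w b)
    (h2 : Reads Θ.T a w' b) : Θ.Eqv a b w w' :=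
  Relation.EqvGen.rel _ _ ⟨h, h1, h2⟩

theorem of_rule {a b : List A} {w w' : Word G} (h : Θ.R w w') (h1 : Reads Θ.T a w b)
    (h2 : Reads Θ.T a w' b) : Θ.Eqv a b w w' :=
  of_step (by simpa using Step.mk [] [] 0 w w' h) h1 h2

theorem reads_iff {a b : List A} {w w' : Word G} (h : Θ.Eqv a b w w') :
    Reads Θ.T a w b ↔ Reads Θ.T a w' b := by
  induction h with
  | rel w w' h => exact ⟨fun _ => h.2.2, fun _ => h.2.1⟩
  | refl => rfl
  | symm _ _ _ ih => exact ih.symm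
  | trans _ _ _ _ _ ih ih' => exact ih.trans ih'

theorem reads {a b : List A} {w w' : Word G} (h : Θ.Eqv a b w w') (h1 : Reads Θ.T a w b) :
    Reads Θ.T a w' b := h.reads_iff.1 h1

/-- Every map of words that carries typed steps to equivalences carries equivalences to
equivalences. -/
theorem lift {H B : Type} {Φ : Theory H B} {a b : List A} {a' b' : List B} (F : Word G → Word H)
    (hF : ∀ w w', Step Θ.R w w' → Reads Θ.T a w b → Reads Θ.T a w' b → Φ.Eqv a' b' (F w) (F w'))
    {w w' : Word G} (h : Θ.Eqv a b w w') : Φ.Eqv a' b' (F w) (F w') := by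
  induction h with
  | rel w w' h => exact hF w w' h.1 h.2.1 h.2.2
  | refl => exact refl _
  | symm _ _ _ ih => exact ih.symm
  | trans _ _ _ _ _ ih ih' => exact ih.trans ih'

theorem context {a b a' b' : List A} {p q : Word G} (hp : Reads Θ.T a' p a)
    (hq : Reads Θ.T b q b') {w w' : Word G} (h : Θ.Eqv a b w w') :
    Θ.Eqv a' b' (p ++ w ++ q) (p ++ w' ++ q) := by
  refine lift (fun w => p ++ w ++ q) (fun w w' hs h1 h2 => ?_) h
  refine of_step ?_ ((hp.append h1).append hq) ((hp.append h2).append hq)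
  obtain ⟨p', q', n, v, v', h⟩ := hs
  simpa using Step.mk (p ++ p') (q' ++ q) n v v' h

theorem append_left {a b a' : List A} {p : Word G} (hp : Reads Θ.T a' p a) {w w' : Word G}
    (h : Θ.Eqv a b w w') : Θ.Eqv a' b (p ++ w) (p ++ w') := by
  simpa using h.context hp (q := []) rfl

theorem append_right {a b b' : List A} {q : Word G} (hq : Reads Θ.T b q b') {w w' : Word G}
    (h : Θ.Eqv a b w w') : Θ.Eqv a b' (w ++ q) (w' ++ q) := by
  simpa using h.context (p := []) rfl hq

theorem append {a b c : List A} {w w' v v' : Word G} (h : Θ.Eqv a b w w') (h' : Θ.Eqv b c v v')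
    (h1 : Reads Θ.T a w b) (h2 : Reads Θ.T b v c) : Θ.Eqv a c (w ++ v) (w' ++ v') :=
  (h.append_right h2).trans (h'.append_left (h.reads h1))

theorem whisker {a b : List A} (l r : List A) {w w' : Word G} (h : Θ.Eqv a b w w') :
    Θ.Eqv (l ++ a ++ r) (l ++ b ++ r) (shift l.length w) (shift l.length w') := by
  refine lift (shift l.length) (fun w w' hs h1 h2 => ?_) h
  refine of_step ?_ (h1.whisker l r) (h2.whisker l r)
  obtain ⟨p', q', n, v, v', h⟩ := hs
  simpa using Step.mk (shift l.length p') (shift l.length q') (l.length + n) v v' h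

theorem mono (hT : Θ.T = Θ'.T) (hR : ∀ v v', Θ.R v v' → Θ'.R v v') {a b : List A} {w w' : Word G}
    (h : Θ.Eqv a b w w') : Θ'.Eqv a b w w' := by
  refine lift id (fun w w' hs h1 h2 => ?_) h
  refine of_step ?_ (hT ▸ h1) (hT ▸ h2)
  obtain ⟨p', q', n, v, v', h⟩ := hs
  exact ⟨p', q', n, v, v', hR _ _ h⟩

/-- Two pieces next to each other exchange their heights. -/
theorem swap {g h : G} {x y x' y' : List A} (hg : Θ.T g x y) (hh : Θ.T h x' y')
    (l m r : List A) :
    Θ.Eqv (l ++ x ++ m ++ x' ++ r) (l ++ y ++ m ++ y' ++ r)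
      [(l.length, g), (l.length + y.length + m.length, h)]
      [(l.length + x.length + m.length, h), (l.length, g)] := by
  have h1 := Reads.piece hg l (m ++ x' ++ r)
  have h2 := Reads.piece hh (l ++ y ++ m) r
  have h3 := Reads.piece hh (l ++ x ++ m) r
  have h4 := Reads.piece hg l (m ++ y' ++ r)
  have e1 := Θ.length_of_T hg
  simp only [List.append_assoc, List.length_append, ← Nat.add_assoc] at h1 h2 h3 h4 ⊢
  refine of_step ?_ (h1.append h2) (h3.append h4)
  have := Step.mk (R := Θ.R) [] [] l.length _ _ (Θ.interchange g h m.length)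
  simpa [← e1.1, ← e1.2, Nat.add_assoc] using this

/-- A piece exchanges its height with a picture to its right. -/
theorem swap_piece_word {g : G} {x y : List A} (hg : Θ.T g x y) (l m r : List A) {w : Word G} :
    ∀ {a b : List A}, Reads Θ.T a w b →
    Θ.Eqv (l ++ x ++ m ++ a ++ r) (l ++ y ++ m ++ b ++ r)
      ((l.length, g) :: shift (l.length + y.length + m.length) w)
      (shift (l.length + x.length + m.length) w ++ [(l.length, g)]) := by
  induction w with
  | nil => rintro a b rfl; exact refl _
  | cons s w ih =>
    obtain ⟨i, h⟩ := s
    rintro a b ⟨l', x', y', r', rfl, h2, rfl, h4⟩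
    have e1 := swap (Θ := Θ) hg h2 l (m ++ l') (r' ++ r)
    have e2 := ih h4
    have r2 := h4.whisker (l ++ y ++ m) r
    have r1 := Reads.piece h2 (l ++ x ++ (m ++ l')) (r' ++ r)
    simp only [List.append_assoc, List.length_append, ← Nat.add_assoc] at e1 e2 r1 r2
    have e3 := (e1.append_right r2).trans (by simpa [Nat.add_assoc] using e2.append_left r1)
    simpa [Nat.add_assoc] using e3

/-- Two pictures next to each other exchange their heights. -/
theorem swap_word_word {w : Word G} (m r : List A) {v : Word G} {a b : List A}
    (hv : Reads Θ.T a v b) : ∀ {c d : List A}, Reads Θ.T c w d →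
    Θ.Eqv (c ++ m ++ a ++ r) (d ++ m ++ b ++ r)
      (w ++ shift (d.length + m.length) v) (shift (c.length + m.length) v ++ w) := by
  induction w with
  | nil => rintro c d rfl; simpa using refl _
  | cons s w ih =>
    obtain ⟨i, h⟩ := s
    rintro c d ⟨l', x', y', r', rfl, h2, rfl, h4⟩
    have e1 := ih h4
    have e2 := swap_piece_word (Θ := Θ) h2 l' (r' ++ m) r hv
    have r1 := Reads.piece h2 l' (r' ++ (m ++ (a ++ r)))
    have r2 := h4.whisker [] (m ++ (b ++ r))
    simp only [List.append_assoc, List.length_append, List.length_nil, List.nil_append,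
      shift_zero] at e1 e2 r1 r2
    have e3 := (e1.append_left r1).trans (by simpa [Nat.add_assoc] using e2.append_right r2)
    simpa [Nat.add_assoc] using e3

end Eqv

end Theory

namespace Word

variable {G A : Type}

/-- The strands that a word needs at its bottom, starting from the left; `none` stands for a strand
of arbitrary kind. -/
def demand (src tgt : G → List A) : Word G → List (Option A)
  | [] => []
  | (i, g) :: w => (demand src tgt w).take i ++
      List.replicate (i - (demand src tgt w).length) none ++ (src g).map some ++
        (demand src tgt w).drop (i + (tgt g).length)

theorem Reads.demand_forall₂ {src tgt : G → List A} {T : G → List A → List A → Prop}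
    (hT : ∀ g x y, T g x y → x = src g ∧ y = tgt g) {w : Word G} :
    ∀ {a b : List A}, Reads T a w b →
      ∃ a' r, a = a' ++ r ∧ List.Forall₂ (fun o x => ∀ y ∈ o, x = y) (demand src tgt w) a' := by
  have key : ∀ (n : ℕ) (l : List A), l.length = n →
      List.Forall₂ (fun (o : Option A) x => ∀ y ∈ o, x = y) (List.replicate n none) l := by
    rintro _ l rfl
    induction l with
    | nil => exact .nil
    | cons x l ih => exact .cons (by simp) ih
  induction w with
  | nil => exact fun {a} _ _ => ⟨[], a, rfl, .nil⟩
  | cons s w ih =>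
    obtain ⟨i, g⟩ := s
    rintro a b ⟨l, x, y, r, rfl, h2, rfl, h4⟩
    obtain ⟨rfl, rfl⟩ := hT _ _ _ h2
    obtain ⟨d, r', h5, h6⟩ := ih h4
    have e1 : l = d.take l.length ++ r'.take (l.length - d.length) := by
      have := congrArg (List.take l.length) h5
      rw [List.append_assoc, List.take_append_of_le_length le_rfl, List.take_length,
        List.take_append] at this
      exact this
    have e2 : r = d.drop (l.length + (tgt g).length) ++
        r'.drop (l.length + (tgt g).length - d.length) := by
      have := congrArg (List.drop (l.length + (tgt g).length)) h5
      rw [List.drop_append, List.drop_append (l₁ := d),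
        List.drop_eq_nil_of_le (by simp)] at this
      simpa using this
    have hl : (r'.take (l.length - d.length)).length = l.length - d.length := by
      have := congrArg List.length e1
      simp only [List.length_append, List.length_take] at this ⊢
      omega
    refine ⟨l ++ src g ++ d.drop (l.length + (tgt g).length),
      r'.drop (l.length + (tgt g).length - d.length), ?_, ?_⟩
    · conv_lhs => rw [e2]
      simp
    · have h7 := h6.length_eq
      conv => arg 3; rw [e1]
      simp only [demand]
      refine List.rel_append (List.rel_append (List.rel_append ?_ ?_) ?_) ?_
      · simpa [← h7] using List.forall₂_take _ h6
      · rw [h7]; exact key _ _ hl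
      · simp [List.forall₂_map_left_iff, List.forall₂_same]
      · rw [← e1]; exact List.forall₂_drop _ h6

theorem Reads.of_demand {src tgt : G → List A} {T : G → List A → List A → Prop}
    (hT : ∀ g x y, T g x y → x = src g ∧ y = tgt g) {w : Word G} {a b d : List A}
    (h : Reads T a w b) (hd : demand src tgt w = d.map some) : ∃ r, a = d ++ r := by
  obtain ⟨a', r, rfl, h'⟩ := h.demand_forall₂ hT
  refine ⟨r, ?_⟩
  rw [hd, List.forall₂_map_left_iff] at h'
  have : List.Forall₂ (· = ·) d a' := h'.imp fun x y h => (h x rfl).symm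
  rw [List.forall₂_eq_eq_eq] at this
  rw [this]

/-- A reading of a shifted nonempty word leaves the strands to its left alone. -/
theorem Reads.of_shift {T : G → List A → List A → Prop} {n : ℕ} {w : Word G} :
    ∀ {a b : List A}, n ≤ a.length → Reads T a (shift n w) b →
      ∃ l a' b', l.length = n ∧ a = l ++ a' ∧ b = l ++ b' ∧ Reads T a' w b' := by
  induction w with
  | nil =>
    rintro a b hn rfl
    exact ⟨a.take n, a.drop n, a.drop n, by simpa using hn, by simp, by simp, rfl⟩
  | cons s w ih =>
    obtain ⟨i, g⟩ := s
    rintro a b - ⟨l, x, y, r, h1, h2, rfl, h4⟩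
    obtain ⟨l', a', b', h5, h6, rfl, h8⟩ := ih (by simp; omega) h4
    have e : l' = l.take n := by
      have := congrArg (List.take n) h6
      rw [List.append_assoc, List.take_append_of_le_length (by omega),
        List.take_append_of_le_length h5.ge, List.take_of_length_le h5.le] at this
      exact this.symm
    have e' : a' = l.drop n ++ y ++ r := by
      rw [← List.take_append_drop n l, ← e, List.append_assoc, List.append_assoc] at h6
      have := List.append_cancel_left h6
      simpa [h5] using this.symm
    refine ⟨l', l.drop n ++ x ++ r, b', h5, ?_, rfl, l.drop n, x, y, r, by simp [h1], h2, rfl,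
      e' ▸ h8⟩
    rw [e, ← List.append_assoc, ← List.append_assoc, List.take_append_drop]

theorem Reads.le_length {T : G → List A → List A → Prop} {n : ℕ} {w : Word G} (hw : w ≠ [])
    {a b : List A} (h : Reads T a (shift n w) b) : n ≤ a.length := by
  obtain _ | ⟨⟨i, g⟩, w⟩ := w
  · exact absurd rfl hw
  · obtain ⟨l, x, y, r, h1, h2, rfl, h4⟩ := h
    simp; omega

end Word

end GrapheneLink

/-! ### Checking sequences of moves by computation -/

namespace GrapheneLink

open Word

/-- One instruction of a sequence of moves. Numbers `k` are positions in the word; `n` is the number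
of strands to the left of the place of the move. -/
inductive Op (C X : Type) : Type
  /-- exchange the pieces `k` and `k + 1`, the second of which lies to the right of the first -/
  | swapR (k : ℕ)
  /-- exchange the pieces `k` and `k + 1`, the second of which lies to the left of the first -/
  | swapL (k : ℕ)
  /-- apply a local move from left to right -/
  | fwd (c : C) (k n : ℕ)
  /-- apply a local move from right to left -/
  | bwd (c : C) (k n : ℕ)
  /-- apply a known equivalence from left to right -/
  | use (x : X) (k n : ℕ)
  /-- apply a known equivalence from right to left -/
  | unuse (x : X) (k n : ℕ)

/-- Data for a checker of sequences of moves in the theory `Θ`. The checker works with tags in `B`,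
which stand for the marks in `A` via `mark`. `ty g` computes the tags above the piece `g` from the tags
below, where further tags may follow on the right. `prim` are the local moves that may be used,
`known` are equivalences with given tags at the bottom and at the top. -/
structure Checker {G A : Type} (Θ : Theory G A) (B C X : Type) where
  /-- the mark for which a tag stands -/
  mark : B → A
  /-- the tags above a piece -/
  ty : G → List B → Option (List B)
  /-- the two sides of a local move -/
  prim : C → Word G × Word G
  /-- bottom, top and the two sides of a known equivalence -/
  known : X → (List B × List B) × Word G × Word G
  ty_sound : ∀ {g c c'}, ty g c = some c' →
    ∃ x y r, c = x ++ r ∧ c' = y ++ r ∧ Θ.T g (x.map mark) (y.map mark)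
  prim_sound : ∀ c, Θ.R (prim c).1 (prim c).2
  known_sound : ∀ x, Θ.Eqv ((known x).1.1.map mark) ((known x).1.2.map mark)
    (known x).2.1 (known x).2.2

namespace Checker

variable {G A B C X : Type} {Θ : Theory G A} {K : Checker Θ B C X}

/-- The tags at the top of a word. -/
def out (K : Checker Θ B C X) : List B → Word G → Option (List B)
  | a, [] => some a
  | a, (i, g) :: w => if i ≤ a.length then
      (K.ty g (a.drop i)).bind fun c => K.out (a.take i ++ c) w else none

theorem out_append {w w' : Word G} : ∀ {a : List B},
    K.out a (w ++ w') = (K.out a w).bind fun b => K.out b w' := by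
  induction w with
  | nil => intro a; rfl
  | cons s w ih =>
    intro a
    obtain ⟨i, g⟩ := s
    simp only [List.cons_append, out]
    split_ifs
    · rw [Option.bind_assoc]
      exact Option.bind_congr fun c _ => ih
    · rfl

theorem reads_of_out {w : Word G} : ∀ {a b : List B}, K.out a w = some b →
    Reads Θ.T (a.map K.mark) w (b.map K.mark) := by
  induction w with
  | nil => intro a b h; cases h; rfl
  | cons s w ih =>
    obtain ⟨i, g⟩ := s
    intro a b h
    simp only [out, Option.ite_none_right_eq_some, Option.bind_eq_some_iff] at h
    obtain ⟨h0, c, h1, h2⟩ := h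
    obtain ⟨x, y, r, h3, rfl, h5⟩ := K.ty_sound h1
    refine ⟨(a.take i).map K.mark, _, _, r.map K.mark, by simpa using h0, h5, ?_, ?_⟩
    · conv_lhs => rw [← List.take_append_drop i a, h3]
      simp
    · simpa using ih h2

variable [DecidableEq G] [DecidableEq B]

/-- Replace `v`, shifted by `n`, by `v'` at position `k`. -/
def replace (v v' : Word G) (k n : ℕ) (w : Word G) : Option (Word G) :=
  if (w.drop k).take v.length = shift n v then
    some (w.take k ++ shift n v' ++ w.drop (k + v.length)) else none

/-- Is there room for a known equivalence with bottom `a` and top `b` at position `k`? -/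
def room (K : Checker Θ B C X) (a b c : List B) (v : Word G) (k n : ℕ) (w : Word G) : Bool :=
  match K.out c (w.take k) with
  | none => false
  | some m => (m.drop n).take a.length = a ∧ n ≤ m.length ∧
      K.out m (shift n v) = some (m.take n ++ b ++ m.drop (n + a.length))

/-- Execute one instruction. -/
def step (K : Checker Θ B C X) (a : List B) : Op C X → Word G → Option (Word G)
  | .swapR k, w => match w.drop k with
    | (i, g) :: (j, h) :: q => if i + Θ.tgt g ≤ j then
        some (w.take k ++ (j - Θ.tgt g + Θ.src g, h) :: (i, g) :: q) else none
    | _ => none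
  | .swapL k, w => match w.drop k with
    | (i, g) :: (j, h) :: q => if j + Θ.src h ≤ i then
        some (w.take k ++ (j, h) :: (i - Θ.src h + Θ.tgt h, g) :: q) else none
    | _ => none
  | .fwd c k n, w => replace (K.prim c).1 (K.prim c).2 k n w
  | .bwd c k n, w => replace (K.prim c).2 (K.prim c).1 k n w
  | .use x k n, w => match K.known x with
    | ((c, d), v, v') => if K.room c d a v k n w then replace v v' k n w else none
  | .unuse x k n, w => match K.known x with
    | ((c, d), v, v') => if K.room c d a v' k n w then replace v' v k n w else none

/-- Do the instructions lead from `w` to `w'` through words from `a` to `b`? -/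
def run (K : Checker Θ B C X) (a b : List B) : List (Op C X) → Word G → Word G → Bool
  | [], w, w' => w = w'
  | o :: os, w, w' => match K.step a o w with
    | none => false
    | some w₁ => K.out a w₁ = some b && K.run a b os w₁ w'

/-- The word `w` leads from `a` to `b`, and the instructions lead from `w` to `w'`. -/
def check (K : Checker Θ B C X) (a b : List B) (os : List (Op C X)) (w w' : Word G) : Bool :=
  K.out a w = some b && K.run a b os w w'

theorem replace_eq {v v' w w' : Word G} {k n : ℕ} (h : replace v v' k n w = some w') :
    w = w.take k ++ shift n v ++ w.drop (k + v.length) ∧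
      w' = w.take k ++ shift n v' ++ w.drop (k + v.length) := by
  rw [replace, Option.ite_none_right_eq_some] at h
  refine ⟨?_, (Option.some_inj.1 h.2).symm⟩
  rw [← h.1, List.append_assoc, ← List.drop_drop, List.take_append_drop, List.take_append_drop]

theorem eqv_of_room {a b c d : List B} {v v' w w' : Word G} {k n : ℕ}
    (hv : Θ.Eqv (c.map K.mark) (d.map K.mark) v v') (h : K.room c d a v k n w = true)
    (h1 : replace v v' k n w = some w') (h2 : K.out a w = some b) :
    Θ.Eqv (a.map K.mark) (b.map K.mark) w w' := by
  obtain ⟨e1, e2⟩ := replace_eq h1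
  unfold room at h
  split at h
  · simp at h
  · rename_i m hm
    simp only [Bool.decide_and, Bool.and_eq_true, decide_eq_true_eq] at h
    obtain ⟨h3, h4, h5⟩ := h
    rw [e1, out_append, out_append, hm] at h2
    simp only [Option.bind_some, h5] at h2
    rw [e1, e2]
    have e3 : m = m.take n ++ c ++ m.drop (n + c.length) := by
      have := List.take_append_drop c.length (m.drop n)
      rw [h3, List.drop_drop] at this
      rw [List.append_assoc, this, List.take_append_drop]
    have r1 := reads_of_out hm
    rw [e3] at r1
    have := hv.whisker ((m.take n).map K.mark) ((m.drop (n + c.length)).map K.mark)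
    simp only [List.length_map, List.length_take, min_eq_left h4] at this
    exact this.context (by simpa using r1) (by simpa using reads_of_out h2)

theorem eqv_of_step {a b : List B} {o : Op C X} {w w' : Word G} (h : K.step a o w = some w')
    (h1 : K.out a w = some b) (h2 : K.out a w' = some b) :
    Θ.Eqv (a.map K.mark) (b.map K.mark) w w' := by
  have r1 := reads_of_out h1
  have r2 := reads_of_out h2
  cases o with
  | swapR k =>
    simp only [step] at h
    split at h
    · rename_i i g j h' q e
      rw [Option.ite_none_right_eq_some] at h
      obtain ⟨d, rfl⟩ := Nat.exists_eq_add_of_le h.1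
      have e1 := List.take_append_drop k w
      rw [e] at e1
      have e2 : i + Θ.tgt g + d - Θ.tgt g + Θ.src g = i + (Θ.src g + d) := by omega
      rw [← Option.some_inj.1 h.2, e2] at r2 ⊢
      rw [← e1] at r1
      conv => arg 4; rw [← e1]
      refine .of_step ?_ r1 r2
      simpa [Nat.add_assoc] using Step.mk (R := Θ.R) (w.take k) q i _ _ (Θ.interchange g h' d)
    · simp at h
  | swapL k =>
    simp only [step] at h
    split at h
    · rename_i i g j h' q e
      rw [Option.ite_none_right_eq_some] at h
      obtain ⟨d, rfl⟩ := Nat.exists_eq_add_of_le h.1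
      have e1 := List.take_append_drop k w
      rw [e] at e1
      have e2 : j + Θ.src h' + d - Θ.src h' + Θ.tgt h' = j + (Θ.tgt h' + d) := by omega
      rw [← Option.some_inj.1 h.2, e2] at r2 ⊢
      rw [← e1] at r1
      conv => arg 4; rw [← e1]
      refine Theory.Eqv.symm (.of_step ?_ r2 r1)
      simpa [Nat.add_assoc] using Step.mk (R := Θ.R) (w.take k) q j _ _ (Θ.interchange h' g d)
    · simp at h
  | fwd c k n =>
    obtain ⟨e1, e2⟩ := replace_eq h
    refine .of_step ?_ r1 r2
    rw [e1, e2]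
    simpa using Step.mk (w.take k) _ n _ _ (K.prim_sound c)
  | bwd c k n =>
    obtain ⟨e1, e2⟩ := replace_eq h
    refine Theory.Eqv.symm (.of_step ?_ r2 r1)
    rw [e1, e2]
    simpa using Step.mk (w.take k) _ n _ _ (K.prim_sound c)
  | use x k n =>
    simp only [step] at h
    have := K.known_sound x
    rw [Option.ite_none_right_eq_some] at h
    exact eqv_of_room this h.1 h.2 h1
  | unuse x k n =>
    simp only [step] at h
    have := K.known_sound x
    rw [Option.ite_none_right_eq_some] at h
    exact eqv_of_room this.symm h.1 h.2 h1

theorem eqv_of_run {a b : List B} {os : List (Op C X)} : ∀ {w w' : Word G},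
    K.out a w = some b → K.run a b os w w' = true →
      Θ.Eqv (a.map K.mark) (b.map K.mark) w w' := by
  induction os with
  | nil => intro w w' _ h; exact .of_eq (by simpa [run] using h)
  | cons o os ih =>
    intro w w' h1 h
    unfold run at h
    split at h
    · simp at h
    · rename_i w₁ hw
      simp only [Bool.and_eq_true, decide_eq_true_eq] at h
      exact (eqv_of_step hw h1 h.1).trans (ih h.1 h.2)

theorem eqv {a b : List B} {os : List (Op C X)} {w w' : Word G}
    (h : K.check a b os w w' = true) :
    Θ.Eqv (a.map K.mark) (b.map K.mark) w w' := by
  rw [check, Bool.and_eq_true, decide_eq_true_eq] at h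
  exact eqv_of_run h.1 h.2

end Checker

end GrapheneLink

/-! ### Virtual link diagrams: typed equivalence -/

namespace GrapheneLink

open Word VGen Crossing

/-- A numerical code of the pieces of virtual link diagrams. -/
def VGen.code : VGen → ℕ
  | cup => 0
  | cap => 1
  | cross virtual => 2
  | cross (classical false) => 3
  | cross (classical true) => 4

theorem VGen.code_injective : Function.Injective VGen.code := by
  rintro (_ | _ | (_ | _) | _) (_ | _ | (_ | _) | _) h <;> first | rfl | simp [VGen.code] at h

instance : DecidableEq VGen := fun a b => decidable_of_iff (a.code = b.code)
  VGen.code_injective.eq_iff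

/-- A local move of virtual link diagrams that is not a classical Reidemeister move. -/
inductive LinkRule : Type
  | zigzagLeft
  | zigzagRight
  | capSlide (c : Crossing)
  | cupSlide (c : Crossing)
  | V1
  | V2
  | V3
  | VM (b : Bool)

/-- The two sides of a move. -/
def LinkRule.sides : LinkRule → Word VGen × Word VGen
  | zigzagLeft => ([(0, cup), (1, cap)], [])
  | zigzagRight => ([(1, cup), (0, cap)], [])
  | capSlide c => ([(0, cross c), (1, cap)], [(1, cross c.turn), (0, cap)])
  | cupSlide c => ([(0, cup), (1, cross c)], [(1, cup), (0, cross c.turn)])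
  | V1 => ([(1, cup), (0, cross virtual), (1, cap)], [])
  | V2 => ([(0, cross virtual), (0, cross virtual)], [])
  | V3 => ([(0, cross virtual), (1, cross virtual), (0, cross virtual)],
      [(1, cross virtual), (0, cross virtual), (1, cross virtual)])
  | VM b => ([(0, cross virtual), (1, cross virtual), (0, cross (classical b))],
      [(1, cross (classical b)), (0, cross virtual), (1, cross virtual)])

/-- Virtual link diagrams with the planar isotopies, the virtual moves and further moves `E`. -/
def linkTheory (E : Word VGen → Word VGen → Prop) : Theory VGen Unit where
  src := src
  tgt := tgt
  T := Rule
  R v v' := VirtualIsotopy v v' ∨ (∃ c : LinkRule, c.sides = (v, v')) ∨ E v v'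
  length_of_T := by rintro g x y ⟨rfl, rfl⟩; simp
  interchange g h k := .inl (.interchange g h k)

/-- Virtual link diagrams up to all moves but the classical Reidemeister moves. -/
def detourTheory : Theory VGen Unit := linkTheory fun _ _ => False

theorem Theory.Eqv.of_detour {E : Word VGen → Word VGen → Prop} {a b : List Unit}
    {w w' : Word VGen} (h : detourTheory.Eqv a b w w') : (linkTheory E).Eqv a b w w' :=
  Theory.Eqv.mono (Θ := detourTheory) (Θ' := linkTheory E) rfl
    (fun _ _ => Or.imp_right (Or.imp_right False.elim)) h

/-- The number of strands at the top of a piece. -/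
def linkTy : VGen → List Unit → Option (List Unit)
  | cup, c => some (() :: () :: c)
  | cap, _ :: _ :: c => some c
  | cross _, _ :: _ :: c => some (() :: () :: c)
  | _, _ => none

/-- The checker for virtual link diagrams. -/
def linkChecker (E : Word VGen → Word VGen → Prop) {X : Type}
    (known : X → (List Unit × List Unit) × Word VGen × Word VGen)
    (h : ∀ x, (linkTheory E).Eqv (known x).1.1 (known x).1.2 (known x).2.1 (known x).2.2) :
    Checker (linkTheory E) Unit LinkRule X where
  mark := id
  ty := linkTy
  prim := LinkRule.sides
  known := known
  ty_sound := by
    rintro (_ | _ | c) (_ | ⟨x, _ | ⟨y, l⟩⟩) c' h <;> cases h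
    · exact ⟨[], [(), ()], [], rfl, rfl, rfl, rfl⟩
    · exact ⟨[], [(), ()], [x], rfl, rfl, rfl, rfl⟩
    · exact ⟨[], [(), ()], x :: y :: l, rfl, rfl, rfl, rfl⟩
    · exact ⟨[(), ()], [], l, rfl, rfl, rfl, rfl⟩
    · exact ⟨[(), ()], [(), ()], l, rfl, rfl, rfl, rfl⟩
  prim_sound c := .inr (.inl ⟨c, rfl⟩)
  known_sound := by simpa using h

/-- The checker that uses only isotopies and virtual moves. -/
def detourChecker : Checker detourTheory Unit LinkRule Empty :=
  linkChecker _ Empty.elim (by simp)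

/-- The bottom or top of a word with `n` strands. -/
abbrev units (n : ℕ) : List Unit := List.replicate n ()

theorem linkChecker_eqv {E : Word VGen → Word VGen → Prop} {X : Type}
    {known : X → (List Unit × List Unit) × Word VGen × Word VGen}
    {h : ∀ x, (linkTheory E).Eqv (known x).1.1 (known x).1.2 (known x).2.1 (known x).2.2}
    (m n : ℕ) (os : List (Op LinkRule X)) {w w' : Word VGen}
    (h : (linkChecker E known h).check (units m) (units n) os w w' = true) :
    (linkTheory E).Eqv (units m) (units n) w w' := by
  simpa [linkChecker] using Checker.eqv h

theorem detour_eqv (m n : ℕ) (os : List (Op LinkRule Empty)) {w w' : Word VGen}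
    (h : detourChecker.check (units m) (units n) os w w' = true) :
    detourTheory.Eqv (units m) (units n) w w' :=
  linkChecker_eqv m n os h

end GrapheneLink

/-! ### The moves of matched diagrams become moves of virtual link diagrams -/

namespace GrapheneLink

open Word VGen Crossing MGen Strand

/-- The replaced sides of a pair of matched words from `a` to `b` are related by isotopies and
virtual moves. -/
def LinkEqv (a b : List Strand) (v v' : Word MGen) : Prop :=
  detourTheory.Eqv (a.flatMap linkStrand) (b.flatMap linkStrand) (linkWord a v) (linkWord a v')

theorem linkEqv_zigzagLeft (a : Strand) : LinkEqv [a] [a]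
    [(0, .cup a), (1, .cap a.dual)]
    [] := by
  rcases a with _ | ⟨s1, d1⟩
  · exact detour_eqv 1 1
      [.fwd .zigzagLeft 0 0]
      (by decide +kernel)
  · exact detour_eqv 2 2
      [.swapR 1, .fwd .zigzagLeft 2 1, .fwd .zigzagLeft 0 0]
      (by revert s1 d1; decide +kernel)

theorem linkEqv_zigzagRight (a : Strand) : LinkEqv [a] [a]
    [(1, .cup a.dual), (0, .cap a)]
    [] := by
  rcases a with _ | ⟨s1, d1⟩
  · exact detour_eqv 1 1
      [.fwd .zigzagRight 0 0]
      (by decide +kernel)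
  · exact detour_eqv 2 2
      [.swapL 1, .fwd .zigzagRight 0 1, .fwd .zigzagRight 0 0]
      (by revert s1 d1; decide +kernel)

theorem linkEqv_capSlide (a x : Strand) : LinkEqv [a, x, a.dual] [x]
    [(0, .cross a x), (1, .cap a)]
    [(1, .cross x a.dual), (0, .cap a)] := by
  rcases a with _ | ⟨s1, d1⟩ <;> rcases x with _ | ⟨s2, d2⟩
  · exact detour_eqv 3 1
      [.fwd (.capSlide .virtual) 0 0]
      (by decide +kernel)
  · exact detour_eqv 4 2
      [.fwd (.capSlide .virtual) 1 1, .swapR 0, .fwd (.capSlide .virtual) 1 0]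
      (by revert s2 d2; decide +kernel)
  · exact detour_eqv 5 1
      [.swapR 1, .fwd (.capSlide .virtual) 2 0, .fwd (.capSlide .virtual) 0 1, .swapR 1]
      (by revert s1 d1; decide +kernel)
  · exact detour_eqv 6 2
      [.swapR 1, .swapR 3, .swapR 2, .fwd (.capSlide .virtual) 1 2, .swapR 0,
       .fwd (.capSlide .virtual) 1 1, .fwd (.capSlide .virtual) 4 1, .swapR 3,
       .fwd (.capSlide .virtual) 4 0, .swapR 2, .swapR 3]
      (by revert s1 d1 s2 d2; decide +kernel)

theorem linkEqv_cupSlide (a x : Strand) : LinkEqv [x] [a, x, a.dual]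
    [(0, .cup a), (1, .cross a.dual x)]
    [(1, .cup a), (0, .cross x a)] := by
  rcases a with _ | ⟨s1, d1⟩ <;> rcases x with _ | ⟨s2, d2⟩
  · exact detour_eqv 1 3
      [.fwd (.cupSlide .virtual) 0 0]
      (by decide +kernel)
  · exact detour_eqv 2 4
      [.fwd (.cupSlide .virtual) 0 0, .swapR 1, .fwd (.cupSlide .virtual) 0 1]
      (by revert s2 d2; decide +kernel)
  · exact detour_eqv 1 5
      [.swapR 1, .fwd (.cupSlide .virtual) 2 1, .fwd (.cupSlide .virtual) 0 0, .swapR 1]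
      (by revert s1 d1; decide +kernel)
  · exact detour_eqv 2 6
      [.swapR 1, .swapR 3, .swapR 2, .fwd (.cupSlide .virtual) 0 0, .swapR 1,
       .fwd (.cupSlide .virtual) 0 1, .fwd (.cupSlide .virtual) 3 1, .swapR 4,
       .fwd (.cupSlide .virtual) 3 2, .swapR 2, .swapR 1]
      (by revert s1 d1 s2 d2; decide +kernel)

theorem linkEqv_M1 (a : Strand) : LinkEqv [a] [a]
    [(1, .cup a), (0, .cross a a), (1, .cap a)]
    [] := by
  rcases a with _ | ⟨s1, d1⟩
  · exact detour_eqv 1 1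
      [.fwd .V1 0 0]
      (by decide +kernel)
  · exact detour_eqv 2 2
      [.swapL 1, .swapL 2, .swapR 5, .fwd .V1 3 2, .fwd (.capSlide .virtual) 3 1, .swapR 2,
       .bwd (.cupSlide .virtual) 0 1, .fwd .V2 1 2, .fwd .V1 0 0]
      (by revert s1 d1; decide +kernel)

theorem linkEqv_M2 (a b : Strand) : LinkEqv [a, b] [a, b]
    [(0, .cross a b), (0, .cross b a)]
    [] := by
  rcases a with _ | ⟨s1, d1⟩ <;> rcases b with _ | ⟨s2, d2⟩
  · exact detour_eqv 2 2
      [.fwd .V2 0 0]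
      (by decide +kernel)
  · exact detour_eqv 3 3
      [.fwd .V2 1 1, .fwd .V2 0 0]
      (by revert s2 d2; decide +kernel)
  · exact detour_eqv 3 3
      [.fwd .V2 1 0, .fwd .V2 0 1]
      (by revert s1 d1; decide +kernel)
  · exact detour_eqv 4 4
      [.fwd .V2 3 1, .swapR 1, .fwd .V2 2 0, .fwd .V2 1 2, .fwd .V2 0 1]
      (by revert s1 d1 s2 d2; decide +kernel)

theorem linkEqv_M3 (a b c : Strand) : LinkEqv [a, b, c] [c, b, a]
    [(0, .cross a b), (1, .cross a c), (0, .cross b c)]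
    [(1, .cross b c), (0, .cross a c), (1, .cross a b)] := by
  rcases a with _ | ⟨s1, d1⟩ <;> rcases b with _ | ⟨s2, d2⟩ <;> rcases c with _ | ⟨s3, d3⟩
  · exact detour_eqv 3 3
      [.fwd .V3 0 0]
      (by decide +kernel)
  · exact detour_eqv 4 4
      [.swapL 2, .fwd .V3 0 0, .fwd .V3 2 1, .swapR 1]
      (by revert s3 d3; decide +kernel)
  · exact detour_eqv 4 4
      [.fwd .V3 1 1, .swapL 3, .swapR 0, .fwd .V3 1 0]
      (by revert s2 d2; decide +kernel)
  · exact detour_eqv 5 5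
      [.swapL 3, .swapL 4, .fwd .V3 1 1, .swapR 0, .swapL 3, .fwd .V3 4 2, .fwd .V3 1 0, .swapL 6,
       .swapR 3, .fwd .V3 4 1, .swapR 2, .swapR 3]
      (by revert s2 d2 s3 d3; decide +kernel)
  · exact detour_eqv 4 4
      [.swapR 1, .fwd .V3 2 0, .fwd .V3 0 1, .swapL 2]
      (by revert s1 d1; decide +kernel)
  · exact detour_eqv 5 5
      [.swapR 1, .swapL 5, .swapL 4, .fwd .V3 2 0, .swapR 4, .fwd .V3 5 1, .fwd .V3 0 1, .swapL 2,
       .fwd .V3 3 2, .swapL 5, .swapR 2, .swapR 1]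
      (by revert s1 d1 s3 d3; decide +kernel)
  · exact detour_eqv 5 5
      [.swapR 3, .fwd .V3 4 1, .swapL 6, .fwd .V3 2 2, .swapR 1, .swapL 4, .swapL 5, .swapR 2,
       .fwd .V3 3 0, .swapR 0, .fwd .V3 1 1, .swapL 3]
      (by revert s1 d1 s2 d2; decide +kernel)
  · exact detour_eqv 6 6
      [.swapR 3, .swapL 7, .swapL 6, .swapL 8, .swapL 7, .fwd .V3 4 1, .swapL 6, .swapR 7,
       .fwd .V3 2 2, .swapR 1, .swapR 0, .swapR 2, .swapL 4, .swapL 5, .fwd .V3 3 0, .fwd .V3 8 2,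
       .fwd .V3 6 3, .fwd .V3 1 1, .swapL 10, .swapL 8, .swapL 9, .swapR 5, .swapR 6, .fwd .V3 7 1,
       .swapL 3, .swapR 4, .fwd .V3 5 2, .swapL 7, .swapR 3, .swapR 4, .swapR 2, .swapR 3]
      (by revert s1 d1 s2 d2 s3 d3; decide +kernel)

theorem linkEqv_turnLeft (c s d : Bool) :
    LinkEqv [unmatched, unmatched] [matched s d] [(0, merge c s d)]
    [(0, .cup (matched s d)), (1, split c s (!d)), (2, .cap unmatched), (1, .cap unmatched)] := by
  cases c <;> cases d
  · exact detour_eqv 2 2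
      [.bwd (.cupSlide .virtual) 1 0, .swapL 0, .bwd .zigzagLeft 1 3, .swapL 2, .swapL 3, .swapL 4,
       .bwd (.cupSlide .virtual) 1 2, .swapL 5, .bwd (.capSlide (.classical s)) 4 1, .swapL 2,
       .bwd (.cupSlide .virtual) 1 1, .swapL 3, .bwd (.capSlide .virtual) 4 2,
       .bwd .zigzagLeft 4 1, .swapL 3, .bwd (.capSlide (.classical (!s))) 4 2, .swapL 2, .swapL 3,
       .swapL 1]
      (by revert s; decide +kernel)
  · exact detour_eqv 2 2
      [.bwd .zigzagLeft 1 0, .swapL 0, .bwd (.capSlide .virtual) 1 1, .bwd .zigzagLeft 2 1,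
       .swapL 1, .bwd (.capSlide .virtual) 2 2]
      (by revert s; decide +kernel)
  · exact detour_eqv 2 2
      [.bwd (.cupSlide .virtual) 0 0, .bwd (.capSlide (.classical s)) 2 1, .bwd .zigzagLeft 2 1,
       .swapL 1, .bwd (.capSlide .virtual) 2 2, .swapL 3, .bwd .zigzagLeft 4 1, .swapL 3,
       .bwd (.capSlide (.classical (!s))) 4 2, .swapL 2, .swapL 3, .swapL 1]
      (by revert s; decide +kernel)
  · exact detour_eqv 2 2
      [.bwd .zigzagLeft 0 0, .bwd .zigzagLeft 2 1, .swapL 1]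
      (by revert s; decide +kernel)

theorem linkEqv_turnRight (c s d : Bool) :
    LinkEqv [unmatched, unmatched] [matched s d] [(0, merge c s d)]
    [(2, .cup (matched s (!d))), (2, split c s (!d)), (1, .cap unmatched), (0, .cap unmatched)] := by
  cases c <;> cases d
  · exact detour_eqv 2 2
      [.swapR 2, .fwd (.cupSlide (.classical (!s))) 1 1, .swapR 0, .bwd .zigzagRight 1 0, .swapR 2,
       .fwd (.capSlide .virtual) 5 0, .fwd (.cupSlide .virtual) 1 1, .swapR 3, .swapR 2,
       .fwd (.cupSlide (.classical s)) 1 2, .swapR 4, .swapR 5, .swapR 3,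
       .fwd (.capSlide .virtual) 4 1, .bwd .zigzagRight 4 4, .swapR 3,
       .fwd (.capSlide .virtual) 4 3, .swapR 2, .swapR 1]
      (by revert s; decide +kernel)
  · exact detour_eqv 2 2
      [.bwd .zigzagRight 1 1, .swapR 0, .fwd (.capSlide .virtual) 1 0, .bwd .zigzagRight 2 2,
       .swapR 1, .fwd (.capSlide .virtual) 2 1]
      (by revert s; decide +kernel)
  · exact detour_eqv 2 2
      [.swapR 1, .fwd (.capSlide .virtual) 2 0, .fwd (.cupSlide (.classical (!s))) 0 1,
       .bwd .zigzagRight 2 2, .swapR 1, .fwd (.capSlide (.classical s)) 2 1, .swapR 3,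
       .bwd .zigzagRight 4 4, .swapR 3, .fwd (.capSlide .virtual) 4 3, .swapR 2, .swapR 1]
      (by revert s; decide +kernel)
  · exact detour_eqv 2 2
      [.bwd .zigzagRight 0 0, .bwd .zigzagRight 0 1, .swapR 1]
      (by revert s; decide +kernel)

theorem linkEqv_M4 (a : Strand) (c s d : Bool) : LinkEqv [matched s d, a] [a, unmatched, unmatched]
    [(0, split c s d), (1, .cross unmatched a), (0, .cross unmatched a)]
    [(0, .cross (matched s d) a), (1, split c s d)] := by
  rcases a with _ | ⟨s1, d1⟩ <;> cases c <;> cases d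
  · exact detour_eqv 3 3
      [.fwd .V3 0 0]
      (by revert s; decide +kernel)
  · exact detour_eqv 3 3
      [.swapR 1, .fwd .V3 4 0, .swapR 3, .swapR 2, .fwd (.capSlide (.classical (!s))) 3 0,
       .swapR 4, .bwd .V2 0 1, .swapL 1, .bwd .V3 2 2, .fwd (.cupSlide .virtual) 1 1, .swapR 2,
       .fwd (.VM s) 3 1, .fwd .V2 5 2, .bwd (.capSlide .virtual) 4 0, .swapL 3,
       .bwd (.capSlide (.classical (!s))) 4 1, .swapL 2, .swapL 3, .swapL 1]
      (by revert s; decide +kernel)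
  · exact detour_eqv 3 3
      []
      (by revert s; decide +kernel)
  · exact detour_eqv 3 3
      [.swapR 1, .swapR 3, .swapR 2, .bwd .V2 0 1, .swapL 1, .bwd .V3 2 2,
       .fwd (.cupSlide .virtual) 1 1, .swapR 2, .fwd (.capSlide (.classical (!s))) 5 0,
       .fwd (.VM s) 3 1, .swapR 6, .fwd .V2 5 2, .bwd (.capSlide .virtual) 4 0, .swapL 3,
       .bwd (.capSlide (.classical (!s))) 4 1, .swapL 2, .swapL 3, .swapL 1]
      (by revert s; decide +kernel)
  · exact detour_eqv 4 4
      [.swapL 2, .fwd .V3 0 0, .fwd .V3 2 1]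
      (by revert s s1 d1; decide +kernel)
  · exact detour_eqv 4 4
      [.swapL 6, .fwd .V3 4 0, .fwd .V3 6 1, .swapR 5, .swapR 1, .swapR 3, .swapR 2, .swapL 5,
       .fwd (.capSlide (.classical (!s))) 3 0, .swapR 4, .bwd .V2 0 1, .swapL 1, .bwd .V3 2 2,
       .fwd (.cupSlide .virtual) 1 1, .swapR 2, .fwd (.VM s) 3 1, .fwd .V2 5 2,
       .bwd (.capSlide .virtual) 4 0, .swapL 3, .swapL 2, .swapL 1, .swapR 5, .swapR 6, .swapR 4,
       .bwd .V2 3 4, .bwd .V3 4 3, .swapR 2, .fwd (.cupSlide .virtual) 3 2, .swapR 4,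
       .fwd (.VM s) 5 2, .fwd .V2 7 3, .bwd (.capSlide .virtual) 6 1, .swapL 5,
       .bwd (.capSlide (.classical (!s))) 6 2, .swapL 4, .swapL 5, .swapL 3]
      (by revert s s1 d1; decide +kernel)
  · exact detour_eqv 4 4
      [.swapL 1]
      (by revert s s1 d1; decide +kernel)
  · exact detour_eqv 4 4
      [.swapR 1, .swapR 3, .swapR 2, .swapL 5, .fwd (.capSlide (.classical (!s))) 3 0, .swapR 4,
       .bwd .V2 0 1, .swapL 1, .bwd .V3 2 2, .fwd (.cupSlide .virtual) 1 1, .swapR 2,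
       .fwd (.VM s) 3 1, .fwd .V2 5 2, .bwd (.capSlide .virtual) 4 0, .swapL 3, .swapL 2, .swapL 1,
       .swapR 5, .swapR 6, .swapR 4, .bwd .V2 3 4, .bwd .V3 4 3, .swapR 2,
       .fwd (.cupSlide .virtual) 3 2, .swapR 4, .fwd (.VM s) 5 2, .fwd .V2 7 3,
       .bwd (.capSlide .virtual) 6 1, .swapL 5, .bwd (.capSlide (.classical (!s))) 6 2, .swapL 4,
       .swapL 5, .swapL 3]
      (by revert s s1 d1; decide +kernel)

theorem linkEqv_G4 (c c' s d : Bool) : LinkEqv [unmatched, unmatched] [unmatched, unmatched]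
    (bar c c' s d) (bar (!c) (!c') s d) := by
  have h1 : LinkEqv [unmatched, unmatched] [unmatched, unmatched] (bar false false s d)
      (bar true true s d) := by
    cases d
    · exact detour_eqv 2 2
        [.swapR 2, .fwd (.capSlide .virtual) 3 0, .swapR 4, .bwd (.VM (!s)) 2 1,
         .bwd .zigzagLeft 3 1, .swapL 2, .swapL 1, .bwd (.capSlide .virtual) 3 2, .fwd .V1 2 2,
         .fwd (.cupSlide .virtual) 1 1, .swapR 0, .bwd (.capSlide (.classical s)) 3 0,
         .fwd (.VM s) 1 0, .bwd (.cupSlide (.classical (!s))) 0 1, .bwd .zigzagRight 4 2, .swapR 3,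
         .fwd (.capSlide .virtual) 4 1, .swapR 5, .fwd .V1 3 2, .swapL 1]
        (by cases s <;> decide +kernel)
    · exact detour_eqv 2 2
        [.swapR 2, .fwd (.cupSlide .virtual) 1 1, .swapR 0, .fwd (.VM (!s)) 1 0,
         .bwd .zigzagRight 3 1, .swapR 4, .swapR 5, .fwd (.cupSlide .virtual) 3 2, .fwd .V1 3 2,
         .fwd (.capSlide .virtual) 2 0, .swapR 3, .bwd (.cupSlide (.classical s)) 0 1,
         .bwd (.VM s) 1 1, .bwd (.capSlide (.classical (!s))) 3 0, .bwd .zigzagLeft 2 1, .swapL 1,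
         .bwd (.capSlide .virtual) 2 2, .swapL 0, .fwd .V1 1 2, .swapL 1]
        (by cases s <;> decide +kernel)
  have h2 : LinkEqv [unmatched, unmatched] [unmatched, unmatched] (bar false true s d)
      (bar true false s d) := by
    cases d
    · exact detour_eqv 2 2
        [.bwd .V1 4 2, .swapL 6, .bwd (.capSlide .virtual) 5 1, .swapL 4, .fwd .zigzagRight 5 2,
         .swapR 2, .fwd (.cupSlide (.classical (!s))) 1 1, .swapR 0, .bwd (.VM s) 2 0,
         .fwd .V2 1 0, .fwd (.capSlide (.classical s)) 2 0, .bwd (.cupSlide .virtual) 0 1,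
         .bwd .V1 1 2, .fwd (.capSlide .virtual) 2 2, .swapR 0, .swapR 1, .fwd .zigzagLeft 2 1,
         .fwd (.VM (!s)) 1 1, .swapL 3, .bwd (.capSlide .virtual) 2 0, .swapL 1]
        (by cases s <;> decide +kernel)
    · exact detour_eqv 2 2
        [.swapR 2, .fwd (.cupSlide .virtual) 1 1, .swapR 0, .fwd (.VM (!s)) 1 0,
         .bwd .zigzagRight 3 1, .swapR 4, .swapR 5, .fwd (.cupSlide .virtual) 3 2, .fwd .V1 3 2,
         .fwd (.capSlide .virtual) 2 0, .bwd (.cupSlide (.classical s)) 0 1, .bwd .V2 3 2,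
         .bwd (.VM s) 1 1, .swapL 4, .bwd (.capSlide (.classical (!s))) 3 0, .swapL 2,
         .bwd .zigzagLeft 2 1, .swapL 1, .bwd (.capSlide .virtual) 2 2, .swapL 0, .fwd .V1 1 2]
        (by cases s <;> decide +kernel)
  cases c <;> cases c'
  · exact h1
  · exact h2
  · exact h2.symm
  · exact h1.symm

theorem linkEqv_G5 (d : Bool) : LinkEqv [unmatched, unmatched] [unmatched, unmatched]
    (bar false true true d) (bar true true false (!d)) := by
  cases d
  · exact detour_eqv 2 2
      [.bwd .V1 4 2, .swapL 6, .bwd (.capSlide .virtual) 5 1, .swapL 4, .fwd .zigzagRight 5 2,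
       .swapR 2, .fwd (.cupSlide (.classical false)) 1 1, .swapR 0, .bwd (.VM true) 2 0,
       .fwd .V2 1 0, .bwd (.cupSlide .virtual) 0 1, .swapL 1]
      (by decide +kernel)
  · exact detour_eqv 2 2
      [.swapR 2, .fwd (.cupSlide .virtual) 1 1, .swapR 0, .fwd (.VM false) 1 0,
       .bwd .zigzagRight 3 1, .swapR 4, .swapR 5, .fwd (.cupSlide .virtual) 3 2, .fwd .V1 3 2,
       .bwd (.cupSlide (.classical true)) 0 1, .swapL 1]
      (by decide +kernel)

/-- Two strands that cross once classically and once virtually. This is what becomes of two vertical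
strands that are joined by a horizontal matched edge. -/
def linkRung (s d : Bool) : Word VGen :=
  if d then [(0, .cross virtual), (0, .cross (classical s))]
  else [(0, .cross (classical s)), (0, .cross virtual)]

/-- The replaced long rung: the middle strand makes a detour to the left of the crossings. -/
def linkLongRung (s d : Bool) : Word VGen :=
  [(0, .cross virtual)] ++ (linkRung s d).shift 1 ++ [(0, .cross virtual)]

/-- The strands of the clasp that replaces a rung are pulled straight. -/
theorem linkWord_rung (s d : Bool) : detourTheory.Eqv (units 2) (units 2)
    (linkWord [unmatched, unmatched] (rung s d)) (linkRung s d) := by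
  cases d
  · exact detour_eqv 2 2
      [.swapR 0, .swapR 2, .swapR 1, .fwd (.capSlide .virtual) 3 1, .swapR 2, .fwd .zigzagLeft 3 0,
       .fwd (.cupSlide (.classical (!s))) 0 0, .swapR 2, .swapR 1, .fwd .zigzagLeft 0 1]
      (by revert s; decide +kernel)
  · exact detour_eqv 2 2
      [.swapR 0, .swapR 2, .swapR 1, .fwd (.capSlide (.classical (!s))) 3 1, .swapR 2,
       .fwd .zigzagLeft 3 0, .fwd (.cupSlide .virtual) 0 0, .swapR 2, .swapR 1,
       .fwd .zigzagLeft 0 1]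
      (by revert s; decide +kernel)

/-- The strands of the clasp that replaces a long rung are pulled straight. If the clasp lies to the
left of the middle strand, this strand moves to the other side of the crossings by VM. -/
theorem linkWord_longRung (s d : Bool) : detourTheory.Eqv (units 3) (units 3)
    (linkWord [unmatched, unmatched, unmatched] (longRung s d)) (linkLongRung s d) := by
  cases d
  · exact detour_eqv 3 3
      [.swapR 0, .swapR 2, .swapR 1, .fwd (.capSlide .virtual) 3 1, .swapR 2, .fwd .zigzagLeft 3 0,
       .swapR 2, .swapR 4, .swapR 3, .fwd (.capSlide .virtual) 2 2, .swapR 1, .swapR 0,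
       .fwd (.capSlide (.classical (!s))) 2 1, .swapR 1, .fwd .zigzagLeft 2 0, .bwd .V2 0 0,
       .fwd (.VM s) 1 0, .bwd .V3 3 0, .fwd .V2 2 0]
      (by revert s; decide +kernel)
  · exact detour_eqv 3 3
      [.swapR 4, .swapR 6, .swapR 5, .fwd (.capSlide .virtual) 4 4, .swapR 3, .fwd .zigzagLeft 4 3,
       .swapR 0, .swapR 2, .swapR 1, .fwd (.capSlide (.classical (!s))) 4 2,
       .fwd (.cupSlide .virtual) 2 0, .swapR 3, .swapR 4, .swapR 2, .fwd .zigzagLeft 3 1]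
      (by revert s; decide +kernel)

/-- Replacing a crossing by a matched edge and this edge by a clasp gives back the crossing. -/
theorem linkWord_matchedPiece (c : Crossing) : detourTheory.Eqv (units 2) (units 2)
    (linkWord [unmatched, unmatched] (matchedPiece (.cross c))) [(0, .cross c)] := by
  rcases c with (_ | _) | _
  · exact detour_eqv 2 2
      [.swapL 0, .swapL 1, .bwd (.capSlide .virtual) 3 1, .swapL 2, .fwd .zigzagRight 3 2,
       .bwd (.capSlide .virtual) 3 1, .fwd .V2 2 1, .swapR 1, .fwd .zigzagLeft 0 1]
      (by decide +kernel)
  · exact detour_eqv 2 2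
      [.swapL 1, .swapL 2, .bwd (.capSlide .virtual) 4 2, .swapL 3, .fwd .zigzagRight 4 3,
       .bwd (.capSlide .virtual) 4 2, .fwd .V2 3 2, .swapR 2, .fwd .zigzagLeft 1 2,
       .bwd (.cupSlide (.classical true)) 0 1, .swapL 1, .fwd .zigzagRight 0 0]
      (by decide +kernel)
  · exact .refl _

end GrapheneLink

/-! ### Non-ribbon moves and classical Reidemeister moves -/

namespace GrapheneLink

open Word VGen Crossing MGen Strand

/-- Equivalences that are used to derive the images of the non-ribbon moves. -/
inductive ReidemeisterLemma : Type
  | straighten (s d : Bool)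
  | straightenLong (s d : Bool)
  | R1 (b : Bool)
  | R2 (b : Bool)
  | R3 (b : Bool)

/-- The two sides of an equivalence, with the numbers of strands below and above. -/
def ReidemeisterLemma.sides : ReidemeisterLemma → (List Unit × List Unit) × Word VGen × Word VGen
  | straighten s d => ((units 2, units 2), linkWord [unmatched, unmatched] (rung s d), linkRung s d)
  | straightenLong s d => ((units 3, units 3), linkWord [unmatched, unmatched, unmatched] (longRung s d),
      linkLongRung s d)
  | R1 b => ((units 1, units 1), [(1, .cup), (0, .cross (classical b)), (1, .cap)], [])
  | R2 b => ((units 2, units 2), [(0, .cross (classical b)), (0, .cross (classical (!b)))], [])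
  | R3 b => ((units 3, units 3),
      [(0, .cross (classical b)), (1, .cross (classical b)), (0, .cross (classical b))],
      [(1, .cross (classical b)), (0, .cross (classical b)), (1, .cross (classical b))])

/-- Virtual link diagrams up to virtual Reidemeister moves. -/
def reidemeisterTheory : Theory VGen Unit := linkTheory VirtualReidemeister

theorem reads_of_detourChecker {a b : List Unit} {w : Word VGen}
    (h : detourChecker.out a w = some b) : Reads VGen.Rule a w b := by
  have := Checker.reads_of_out h
  simp only [detourChecker, linkChecker, List.map_id_fun, id] at this
  exact this

theorem ReidemeisterLemma.sound (x : ReidemeisterLemma) :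
    reidemeisterTheory.Eqv x.sides.1.1 x.sides.1.2 x.sides.2.1 x.sides.2.2 := by
  rcases x with ⟨s, d⟩ | ⟨s, d⟩ | b | b | b
  · exact (linkWord_rung s d).of_detour
  · exact (linkWord_longRung s d).of_detour
  · exact .of_rule (.inr (.inr (.R1 b))) (reads_of_detourChecker rfl) (reads_of_detourChecker rfl)
  · exact .of_rule (.inr (.inr (.R2 b))) (reads_of_detourChecker rfl) (reads_of_detourChecker rfl)
  · exact .of_rule (.inr (.inr (.R3 b))) (reads_of_detourChecker rfl) (reads_of_detourChecker rfl)

/-- The checker that also uses classical Reidemeister moves. -/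
def reidemeisterChecker : Checker reidemeisterTheory Unit LinkRule ReidemeisterLemma :=
  linkChecker _ ReidemeisterLemma.sides ReidemeisterLemma.sound

theorem reidemeister_eqv (m n : ℕ) (os : List (Op LinkRule ReidemeisterLemma)) {w w' : Word VGen}
    (h : reidemeisterChecker.check (units m) (units n) os w w' = true) :
    reidemeisterTheory.Eqv (units m) (units n) w w' :=
  linkChecker_eqv m n os h

/-- The bigon move comes from the first Reidemeister move. -/
theorem linkWord_G1 (s d : Bool) : reidemeisterTheory.Eqv (units 2) (units 0)
    (linkWord [unmatched, unmatched] (rung s d ++ [(0, .cap unmatched)]))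
    (linkWord [unmatched, unmatched] [(0, .cap unmatched)]) := by
  cases d
  · exact reidemeister_eqv 2 0
      [.use (.straighten s false) 0 0, .bwd .V1 2 1, .swapR 1, .swapL 4,
       .bwd (.capSlide .virtual) 3 0, .fwd .V2 2 0, .swapR 0, .fwd (.capSlide (.classical s)) 1 0,
       .swapR 2, .use (.R1 (!s)) 0 1]
      (by revert s; decide +kernel)
  · exact reidemeister_eqv 2 0
      [.use (.straighten s true) 0 0, .bwd .zigzagRight 1 0, .swapR 2, .swapR 3,
       .fwd (.cupSlide (.classical s)) 1 1, .use (.R1 (!s)) 1 1, .bwd .zigzagRight 1 1, .swapR 0,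
       .fwd (.capSlide .virtual) 1 0, .swapR 2, .fwd .V1 0 1]
      (by revert s; decide +kernel)

/-- The square move comes from the second Reidemeister move. -/
theorem linkWord_G2 (s : Bool) : reidemeisterTheory.Eqv (units 2) (units 2)
    (linkWord [unmatched, unmatched] (rung s (!s) ++ rung (!s) s)) [] := by
  cases s
  · exact reidemeister_eqv 2 2
      [.use (.straighten false true) 0 0, .use (.straighten true false) 2 0, .use (.R2 false) 1 0,
       .fwd .V2 0 0]
      (by decide +kernel)
  · exact reidemeister_eqv 2 2
      [.use (.straighten true false) 0 0, .use (.straighten false true) 2 0, .fwd .V2 1 0,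
       .use (.R2 true) 0 0]
      (by decide +kernel)

/-- The hexagon move comes from the third Reidemeister move. -/
theorem linkWord_G3 (s d : Bool) : reidemeisterTheory.Eqv (units 3) (units 3)
    (linkWord [unmatched, unmatched, unmatched] (rung s d ++ longRung s d ++ (rung s d).shift 1))
    (linkWord [unmatched, unmatched, unmatched]
      ((rung s d).shift 1 ++ longRung s d ++ rung s d)) := by
  cases d
  · exact reidemeister_eqv 3 3
      [.use (.straighten s false) 0 0, .use (.straightenLong s false) 2 0,
       .use (.straighten s false) 6 1, .fwd .V2 1 0, .bwd .V2 5 0, .bwd .V2 6 1, .bwd (.VM s) 4 0,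
       .fwd .V2 3 0, .fwd .V2 2 1, .use (.R3 s) 0 0, .bwd .V3 3 0, .bwd (.VM s) 2 0, .bwd .V2 1 1,
       .bwd .V2 2 0, .fwd (.VM s) 3 0, .bwd .V3 5 0, .fwd .V2 4 0,
       .unuse (.straighten s false) 6 0, .unuse (.straightenLong s false) 2 0,
       .unuse (.straighten s false) 0 1]
      (by revert s; decide +kernel)
  · exact reidemeister_eqv 3 3
      [.use (.straighten s true) 0 0, .use (.straightenLong s true) 2 0,
       .use (.straighten s true) 6 1, .bwd (.VM s) 4 0, .fwd .V3 2 0, .fwd .V2 4 1, .bwd .V2 0 1,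
       .bwd .V2 1 0, .fwd .V3 2 0, .fwd (.VM s) 3 0, .fwd .V2 5 1, .fwd .V2 4 0,
       .unuse (.R3 s) 3 0, .fwd (.VM s) 1 0, .bwd .V2 5 0, .unuse (.straighten s true) 6 0,
       .unuse (.straightenLong s true) 2 0, .unuse (.straighten s true) 0 1]
      (by revert s; decide +kernel)

/-- The images of the first three non-ribbon moves. -/
inductive ImageMove : Word VGen → Word VGen → Prop
  | G1 (s d : Bool) : ImageMove
      (linkWord [unmatched, unmatched] (rung s d ++ [(0, .cap unmatched)]))
      (linkWord [unmatched, unmatched] [(0, .cap unmatched)])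
  | G2 (s : Bool) : ImageMove
      (linkWord [unmatched, unmatched] (rung s (!s) ++ rung (!s) s)) []
  | G3 (s d : Bool) : ImageMove
      (linkWord [unmatched, unmatched, unmatched]
        (rung s d ++ longRung s d ++ (rung s d).shift 1))
      (linkWord [unmatched, unmatched, unmatched]
        ((rung s d).shift 1 ++ longRung s d ++ rung s d))

/-- Equivalences that are used to derive the classical Reidemeister moves. -/
inductive ImageLemma : Type
  | straighten (s d : Bool)
  | straightenLong (s d : Bool)
  | G1 (s d : Bool)
  | G2 (s : Bool)
  | G3 (s d : Bool)

/-- The two sides of an equivalence, with the numbers of strands below and above. -/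
def ImageLemma.sides : ImageLemma → (List Unit × List Unit) × Word VGen × Word VGen
  | straighten s d => ((units 2, units 2), linkWord [unmatched, unmatched] (rung s d), linkRung s d)
  | straightenLong s d => ((units 3, units 3), linkWord [unmatched, unmatched, unmatched] (longRung s d),
      linkLongRung s d)
  | G1 s d => ((units 2, units 0),
      linkWord [unmatched, unmatched] (rung s d ++ [(0, .cap unmatched)]),
      linkWord [unmatched, unmatched] [(0, .cap unmatched)])
  | G2 s => ((units 2, units 2),
      linkWord [unmatched, unmatched] (rung s (!s) ++ rung (!s) s), [])
  | G3 s d => ((units 3, units 3),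
      linkWord [unmatched, unmatched, unmatched]
        (rung s d ++ longRung s d ++ (rung s d).shift 1),
      linkWord [unmatched, unmatched, unmatched]
        ((rung s d).shift 1 ++ longRung s d ++ rung s d))

/-- Virtual link diagrams up to isotopies, virtual moves and the images of the non-ribbon moves. -/
def imageTheory : Theory VGen Unit := linkTheory ImageMove

theorem ImageLemma.sound (x : ImageLemma) :
    imageTheory.Eqv x.sides.1.1 x.sides.1.2 x.sides.2.1 x.sides.2.2 := by
  rcases x with ⟨s, d⟩ | ⟨s, d⟩ | ⟨s, d⟩ | s | ⟨s, d⟩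
  · exact (linkWord_rung s d).of_detour
  · exact (linkWord_longRung s d).of_detour
  · refine .of_rule (.inr (.inr (.G1 s d))) (reads_of_detourChecker ?_) (reads_of_detourChecker ?_)
    · cases s <;> cases d <;> rfl
    · rfl
  · refine .of_rule (.inr (.inr (.G2 s))) (reads_of_detourChecker ?_) (reads_of_detourChecker ?_)
    · cases s <;> rfl
    · rfl
  · refine .of_rule (.inr (.inr (.G3 s d))) (reads_of_detourChecker ?_) (reads_of_detourChecker ?_)
    · cases s <;> cases d <;> rfl
    · cases s <;> cases d <;> rfl

/-- The checker that also uses the images of the non-ribbon moves. -/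
def imageChecker : Checker imageTheory Unit LinkRule ImageLemma :=
  linkChecker _ ImageLemma.sides ImageLemma.sound

theorem image_eqv (m n : ℕ) (os : List (Op LinkRule ImageLemma)) {w w' : Word VGen}
    (h : imageChecker.check (units m) (units n) os w w' = true) :
    imageTheory.Eqv (units m) (units n) w w' :=
  linkChecker_eqv m n os h

/-- The first Reidemeister move is recovered from the bigon move. The kink is turned into one with an
additional virtual crossing, which is a straightened rung closed by a maximum. -/
theorem R1_of_image (b : Bool) : imageTheory.Eqv (units 1) (units 1)
    [(1, .cup), (0, .cross (classical b)), (1, .cap)] [] :=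
  image_eqv 1 1
    [.bwd (.cupSlide (.classical (!b))) 0 0, .bwd .V2 1 1, .unuse (.straighten (!b) true) 2 1,
     .use (.G1 (!b) true) 2 1, .fwd (.cupSlide .virtual) 0 0, .fwd .V1 0 0]
    (by revert b; decide +kernel)

/-- The second Reidemeister move is recovered from the square move: virtual crossings are inserted in
pairs, so that each of the classical crossings becomes a straightened rung. -/
theorem R2_of_image (b : Bool) : imageTheory.Eqv (units 2) (units 2)
    [(0, .cross (classical b)), (0, .cross (classical (!b)))] [] := by
  cases b
  · exact image_eqv 2 2
      [.bwd .V2 0 0, .bwd .V2 4 0, .unuse (.straighten true false) 3 0,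
       .unuse (.straighten false true) 1 0, .use (.G2 false) 1 0, .fwd .V2 0 0]
      (by decide +kernel)
  · exact image_eqv 2 2
      [.bwd .V2 1 0, .unuse (.straighten false true) 2 0, .unuse (.straighten true false) 0 0,
       .use (.G2 true) 0 0]
      (by decide +kernel)

/-- The third Reidemeister move is recovered from the hexagon move. Virtual crossings are inserted in
pairs and moved by VM and V3, until each classical crossing becomes a straightened rung. -/
theorem R3_of_image (b : Bool) : imageTheory.Eqv (units 3) (units 3)
    [(0, .cross (classical b)), (1, .cross (classical b)), (0, .cross (classical b))]
    [(1, .cross (classical b)), (0, .cross (classical b)), (1, .cross (classical b))] :=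
  image_eqv 3 3
    [.bwd .V2 0 1, .bwd .V2 1 0, .fwd (.VM b) 2 0, .bwd .V2 0 0, .fwd .V3 1 0, .bwd .V2 8 0,
     .unuse (.straighten b true) 9 0, .unuse (.straightenLong b true) 5 0,
     .unuse (.straighten b true) 3 1, .unuse (.G3 b true) 3 0, .use (.straighten b true) 3 0,
     .use (.straightenLong b true) 5 0, .use (.straighten b true) 9 1, .fwd .V2 2 0,
     .bwd (.VM b) 5 0, .bwd .V3 4 0, .fwd .V2 3 0, .fwd (.VM b) 0 0, .fwd .V2 2 1, .fwd .V2 1 0]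
    (by revert b; decide +kernel)

end GrapheneLink

/-! ### Replacing matched edges by clasps respects equivalence -/

namespace GrapheneLink

open Word

@[simp] theorem Strand.dual_dual (a : Strand) : a.dual.dual = a := by
  rcases a with _ | ⟨s, d⟩ <;> simp [Strand.dual]

/-- A reading that is found by replacing, piece by piece, the strands below by the strands above. -/
def Traces : List Strand → Word MGen → List Strand → Prop
  | a, [], b => a = b
  | a, (i, g) :: w, b => i ≤ a.length ∧ (a.drop i).take g.src.length = g.src ∧
      Traces (a.take i ++ g.tgt ++ a.drop (i + g.src.length)) w b

theorem Traces.reads {w : Word MGen} : ∀ {a b : List Strand}, Traces a w b →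
    Reads MGen.Rule a w b := by
  induction w with
  | nil => exact fun h => h
  | cons s w ih =>
    obtain ⟨i, g⟩ := s
    rintro a b ⟨h1, h2, h3⟩
    refine ⟨a.take i, _, _, a.drop (i + g.src.length), by simpa using h1, ⟨rfl, rfl⟩, ?_, ih h3⟩
    conv_lhs => rw [← List.take_append_drop i a, ← List.take_append_drop g.src.length (a.drop i),
      h2, List.drop_drop]
    simp

theorem rule_unique (g : MGen) (x x' y y' : List Strand) (h : MGen.Rule g x y)
    (h' : MGen.Rule g x' y') : x = x' ∧ y = y' :=
  ⟨h.1.trans h'.1.symm, h.2.trans h'.2.symm⟩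

theorem linkWord_cons (l r : List Strand) (g : MGen) (w : Word MGen) :
    linkWord (l ++ g.src ++ r) ((l.length, g) :: w) =
      shift (l.flatMap linkStrand).length (linkPiece g) ++ linkWord (l ++ g.tgt ++ r) w := by
  simp [linkWord]

theorem linkWord_append {v w : Word MGen} : ∀ {a b : List Strand}, Reads MGen.Rule a v b →
    linkWord a (v ++ w) = linkWord a v ++ linkWord b w := by
  induction v with
  | nil => rintro a b rfl; rfl
  | cons s v ih =>
    obtain ⟨i, g⟩ := s
    rintro a b ⟨l, x, y, r, rfl, ⟨rfl, rfl⟩, rfl, h4⟩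
    rw [List.cons_append, linkWord_cons, linkWord_cons, ih h4, ← List.append_assoc]

theorem linkWord_shift (l r : List Strand) {v : Word MGen} : ∀ {a b : List Strand},
    Reads MGen.Rule a v b → linkWord (l ++ a ++ r) (shift l.length v) =
      shift (l.flatMap linkStrand).length (linkWord a v) := by
  induction v with
  | nil => rintro a b rfl; rfl
  | cons s v ih =>
    obtain ⟨i, g⟩ := s
    rintro a b ⟨l', x, y, r', rfl, ⟨rfl, rfl⟩, rfl, h4⟩
    have h1 := linkWord_cons (l ++ l') (r' ++ r) g (shift l.length v)
    have h2 := ih h4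
    simp only [List.append_assoc, List.length_append] at h1 h2
    rw [linkWord_cons, shift_append, shift_shift, shift_cons, List.append_assoc l' g.tgt r', ← h2]
    simpa using h1

/-- The sides of a local move of matched diagrams, in every context, are replaced by equivalent
virtual words. -/
def LinkInvariant (v v' : Word MGen) : Prop :=
  ∀ (n : ℕ) (a b b' : List Strand), Reads MGen.Rule a (shift n v) b →
    Reads MGen.Rule a (shift n v') b' → b = b' ∧
      reidemeisterTheory.Eqv (a.flatMap linkStrand) (b.flatMap linkStrand)
        (linkWord a (shift n v)) (linkWord a (shift n v'))

theorem LinkInvariant.of_eqv {v v' : Word MGen} {a b : List Strand} (h1 : Traces a v b)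
    (h2 : Traces a v' b) (hv : v ≠ [])
    (hd : demand MGen.src MGen.tgt v = a.map some)
    (h : reidemeisterTheory.Eqv (a.flatMap linkStrand) (b.flatMap linkStrand)
      (linkWord a v) (linkWord a v')) : LinkInvariant v v' := by
  intro n m c c' r1 r2
  obtain ⟨l, m', c₁, rfl, rfl, rfl, r3⟩ := r1.of_shift (r1.le_length hv)
  obtain ⟨l', m'', c₁', e, e', rfl, r4⟩ := r2.of_shift (n := l.length) (by simp)
  obtain ⟨rfl, rfl⟩ := List.append_inj e' e.symm
  obtain ⟨r, rfl⟩ := r3.of_demand (fun g x y h => h) hd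
  have r5 := h1.reads.whisker [] r
  have r6 := h2.reads.whisker [] r
  simp only [List.length_nil, shift_zero, List.nil_append] at r5 r6
  obtain rfl := r3.unique rule_unique r5
  obtain rfl := r4.unique rule_unique r6
  refine ⟨rfl, ?_⟩
  rw [← List.append_assoc, ← List.append_assoc, linkWord_shift l r h1.reads,
    linkWord_shift l r h2.reads]
  simpa using h.whisker (l.flatMap linkStrand) (r.flatMap linkStrand)

theorem LinkInvariant.of_linkEqv {v v' : Word MGen} {a b : List Strand} (h : LinkEqv a b v v')
    (h1 : Traces a v b) (h2 : Traces a v' b) (hv : v ≠ [])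
    (hd : demand MGen.src MGen.tgt v = a.map some) : LinkInvariant v v' :=
  .of_eqv h1 h2 hv hd h.of_detour

theorem linkInvariant_interchange (g h : MGen) (k : ℕ) :
    LinkInvariant [(0, g), (g.tgt.length + k, h)] [(g.src.length + k, h), (0, g)] := by
  rintro n a b b' ⟨l, x, y, r, h1, ⟨rfl, rfl⟩, rfl, l', x', y', r', h1', ⟨rfl, rfl⟩, e, e'⟩
  intro r2
  simp only [Nat.add_zero] at h1
  subst h1
  obtain ⟨m, rfl⟩ : ∃ m, l' = l ++ g.tgt ++ m := by
    refine ⟨l'.drop (l ++ g.tgt).length, ?_⟩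
    have := congrArg (List.take (l ++ g.tgt).length) e
    rw [List.append_assoc l', List.take_append_of_le_length le_rfl, List.take_length,
      List.take_append_of_le_length (by simp at h1' ⊢; omega)] at this
    conv_lhs => rw [← List.take_append_drop (l ++ g.tgt).length l', ← this]
  obtain rfl : k = m.length := by simp at h1'; omega
  obtain rfl : r = m ++ h.src ++ r' := by simpa [List.append_assoc] using e
  obtain rfl : b = l ++ g.tgt ++ m ++ h.tgt ++ r' := e'.symm
  have r3 := (Reads.piece (T := MGen.Rule) ⟨rfl, rfl⟩ (l ++ g.src ++ m) r' (g := h)).append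
    (by simpa using Reads.piece (T := MGen.Rule) ⟨rfl, rfl⟩ l (m ++ h.tgt ++ r') (g := g))
  refine ⟨by simpa using r3.unique rule_unique (by simpa [Nat.add_assoc] using r2), ?_⟩
  have p1 := linkWord_cons l (m ++ h.src ++ r') g [(l.length + (g.tgt.length + m.length), h)]
  have p2 := linkWord_cons (l ++ g.src ++ m) r' h [(l.length, g)]
  have q1 := linkWord_cons (l ++ g.tgt ++ m) r' h []
  have q2 := linkWord_cons l (m ++ h.tgt ++ r') g []
  simp only [List.append_assoc, List.length_append] at p1 p2 q1 q2
  rw [q1] at p1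
  rw [q2] at p2
  have := Theory.Eqv.swap_word_word (Θ := reidemeisterTheory) (m.flatMap linkStrand)
    (r'.flatMap linkStrand) (reads_linkPiece h) (reads_linkPiece g)
  have := this.whisker (l.flatMap linkStrand) []
  simp only [shift_cons, shift_nil, Nat.add_zero, List.append_assoc]
  rw [p1, p2]
  simpa [List.flatMap_append, Nat.add_assoc, linkWord] using this

/-- Planar isotopies of matched diagrams become equivalences of virtual link diagrams. -/
theorem MatchedIsotopy.linkInvariant {v v' : Word MGen} (h : MatchedIsotopy v v') :
    LinkInvariant v v' := by
  cases h with
  | interchange g h k => exact linkInvariant_interchange g h k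
  | zigzagLeft a =>
    refine .of_linkEqv (linkEqv_zigzagLeft a) ?_ ?_ ?_ ?_ <;>
      simp [Traces, demand, MGen.src, MGen.tgt]
  | zigzagRight a =>
    refine .of_linkEqv (linkEqv_zigzagRight a) ?_ ?_ ?_ ?_ <;>
      simp [Traces, demand, MGen.src, MGen.tgt]
  | capSlide a x =>
    refine .of_linkEqv (linkEqv_capSlide a x) ?_ ?_ ?_ ?_ <;>
      simp [Traces, demand, MGen.src, MGen.tgt]
  | cupSlide a x =>
    refine .of_linkEqv (linkEqv_cupSlide a x) ?_ ?_ ?_ ?_ <;>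
      simp [Traces, demand, MGen.src, MGen.tgt]
  | turnLeft c s d =>
    refine .of_linkEqv (linkEqv_turnLeft c s d) ?_ ?_ ?_ ?_ <;>
      simp [Traces, demand, MGen.src, MGen.tgt, Strand.dual]
  | turnRight c s d =>
    refine .of_linkEqv (linkEqv_turnRight c s d) ?_ ?_ ?_ ?_ <;>
      simp [Traces, demand, MGen.src, MGen.tgt, Strand.dual]

theorem RibbonMove.linkInvariant {v v' : Word MGen} (h : RibbonMove v v') :
    LinkInvariant v v' := by
  cases h with
  | M1 a =>
    refine .of_linkEqv (linkEqv_M1 a) ?_ ?_ ?_ ?_ <;>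
      simp [Traces, demand, MGen.src, MGen.tgt]
  | M2 a b =>
    refine .of_linkEqv (linkEqv_M2 a b) ?_ ?_ ?_ ?_ <;>
      simp [Traces, demand, MGen.src, MGen.tgt]
  | M3 a b c =>
    refine .of_linkEqv (linkEqv_M3 a b c) ?_ ?_ ?_ ?_ <;>
      simp [Traces, demand, MGen.src, MGen.tgt]
  | M4 a c s d =>
    refine .of_linkEqv (linkEqv_M4 a c s d) ?_ ?_ ?_ ?_ <;>
      simp [Traces, demand, MGen.src, MGen.tgt]
  | M5 s d =>
    refine .of_linkEqv (a := [.matched s d]) (b := [.unmatched, .unmatched])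
      (Theory.Eqv.of_eq ?_) ?_ ?_ ?_ ?_ <;>
      simp [Traces, demand, MGen.src, MGen.tgt, linkWord, linkPiece]

theorem NonRibbonMove.linkInvariant {v v' : Word MGen} (h : NonRibbonMove v v') :
    LinkInvariant v v' := by
  cases h with
  | G1 s d =>
    refine .of_eqv (a := [.unmatched, .unmatched]) (b := []) ?_ ?_ ?_ ?_ (linkWord_G1 s d) <;>
      simp [Traces, demand, MGen.src, MGen.tgt, rung, Strand.dual]
  | G2 s =>
    refine .of_eqv (a := [.unmatched, .unmatched]) (b := [.unmatched, .unmatched])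
      ?_ ?_ ?_ ?_ (linkWord_G2 s) <;>
      simp [Traces, demand, MGen.src, MGen.tgt, rung, Strand.dual]
  | G3 s d =>
    refine .of_eqv (a := [.unmatched, .unmatched, .unmatched])
      (b := [.unmatched, .unmatched, .unmatched]) ?_ ?_ ?_ ?_ (linkWord_G3 s d) <;>
      simp [Traces, demand, MGen.src, MGen.tgt, rung, longRung, Strand.dual]
  | G4 c c' s d =>
    refine .of_linkEqv (linkEqv_G4 c c' s d) ?_ ?_ ?_ ?_ <;>
      simp [Traces, demand, MGen.src, MGen.tgt, bar]
  | G5 d =>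
    refine .of_linkEqv (linkEqv_G5 d) ?_ ?_ ?_ ?_ <;>
      simp [Traces, demand, MGen.src, MGen.tgt, bar]

/-- A step between two closed readable words becomes an equivalence. -/
theorem eqv_linkWord_of_step {R : Word MGen → Word MGen → Prop}
    (hR : ∀ v v', R v v' → LinkInvariant v v') {w w' : Word MGen} {a b : List Strand}
    (h : Step R w w') (h1 : Reads MGen.Rule a w b) (h2 : Reads MGen.Rule a w' b) :
    reidemeisterTheory.Eqv (a.flatMap linkStrand) (b.flatMap linkStrand)
      (linkWord a w) (linkWord a w') := by
  obtain ⟨p, q, n, v, v', h⟩ := h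
  simp only [reads_append] at h1 h2
  obtain ⟨m2, ⟨m1, hp, hv⟩, hq⟩ := h1
  obtain ⟨m2', ⟨m1', hp', hv'⟩, hq'⟩ := h2
  obtain rfl := hp.unique rule_unique hp'
  obtain ⟨rfl, e⟩ := hR _ _ h _ _ _ _ hv hv'
  rw [linkWord_append (hp.append hv), linkWord_append hp, linkWord_append (hp.append hv'),
    linkWord_append hp]
  exact e.context (reads_linkWord hp) (reads_linkWord hq)

theorem Word.Step.mono {G : Type} {R R' : Word G → Word G → Prop}
    (hR : ∀ v v', R v v' → R' v v') {w w' : Word G} (h : Step R w w') : Step R' w w' := by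
  obtain ⟨p, q, n, v, v', h⟩ := h
  exact ⟨p, q, n, v, v', hR _ _ h⟩

theorem moves_of_reidemeisterTheory {v v' : Word VGen} (h : reidemeisterTheory.R v v') :
    VirtualIsotopy v v' ∨ VirtualReidemeister v v' := by
  obtain h | ⟨c, h⟩ | h := h
  · exact .inl h
  · cases c <;> cases h
    exacts [.inl .zigzagLeft, .inl .zigzagRight, .inl (.capSlide _), .inl (.cupSlide _), .inr .V1,
      .inr .V2, .inr .V3, .inr (.VM _)]
  · exact .inr h

theorem VirtualDiagram.equivalent_of_eqv {w w' : Word VGen}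
    (h : reidemeisterTheory.Eqv [] [] w w') :
    ∀ L L' : VirtualDiagram, L.word = w → L'.word = w' → L.Equivalent L' := by
  induction h with
  | rel w w' h =>
    rintro L L' rfl rfl
    exact Relation.EqvGen.rel _ _ (h.1.mono fun _ _ => moves_of_reidemeisterTheory)
  | refl w =>
    rintro ⟨w, h⟩ ⟨w', h'⟩ rfl rfl
    exact Relation.EqvGen.refl _
  | symm w w' _ ih => exact fun L L' h h' => Relation.EqvGen.symm _ _ (ih L' L h' h)
  | trans w w' w'' h h' ih ih' =>
    rintro L L' rfl rfl
    let M : VirtualDiagram := ⟨w', Theory.Eqv.reads (Θ := reidemeisterTheory) h L.closed⟩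
    exact Relation.EqvGen.trans _ _ _ (ih L M rfl rfl) (ih' M L' rfl rfl)

/-- Equivalent matched diagrams have equivalent virtual link diagrams. -/
theorem MatchedDiagram.Equivalent.toVirtual {D D' : MatchedDiagram} (h : D.Equivalent D') :
    D.toVirtual.Equivalent D'.toVirtual := by
  induction h with
  | rel D D' h =>
    refine VirtualDiagram.equivalent_of_eqv ?_ _ _ rfl rfl
    refine eqv_linkWord_of_step ?_ h D.closed D'.closed
    rintro v v' (h | h | h)
    · exact h.linkInvariant
    · exact h.linkInvariant
    · exact h.linkInvariant
  | refl => exact Relation.EqvGen.refl _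
  | symm _ _ _ ih => exact Relation.EqvGen.symm _ _ ih
  | trans _ _ _ _ _ ih ih' => exact Relation.EqvGen.trans _ _ _ ih ih'

end GrapheneLink

/-! ### Replacing classical crossings by matched edges and back -/

namespace GrapheneLink

open Word

theorem reads_matchedPiece (g : VGen) : Reads MGen.Rule (List.replicate g.src .unmatched)
    (matchedPiece g) (List.replicate g.tgt .unmatched) :=
  reads_crossingReplacement Strand.unmatched (.matched true true) ⟨rfl, rfl⟩ ⟨rfl, rfl⟩
    ⟨rfl, rfl⟩ ⟨rfl, rfl⟩ ⟨rfl, rfl⟩ g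

theorem linkWord_matchedPiece' (g : VGen) : detourTheory.Eqv (units g.src) (units g.tgt)
    (linkWord (List.replicate g.src .unmatched) (matchedPiece g)) [(0, g)] := by
  rcases g with _ | _ | c
  · exact .refl _
  · exact .refl _
  · exact linkWord_matchedPiece c

theorem flatMap_linkStrand_unmatched (a : List Unit) :
    (a.map fun _ => Strand.unmatched).flatMap linkStrand = a := by
  induction a with
  | nil => rfl
  | cons x a ih => simp_all [linkStrand]

/-- Replacing the classical crossings by matched edges and these by clasps yields an equivalent
virtual word. -/
theorem linkWord_matchedWord {w : Word VGen} : ∀ {a b : List Unit}, Reads VGen.Rule a w b →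
    detourTheory.Eqv a b (linkWord (a.map fun _ => .unmatched) (matchedWord w)) w := by
  induction w with
  | nil => exact fun _ => .refl _
  | cons s w ih =>
    obtain ⟨i, g⟩ := s
    rintro a b ⟨l, x, y, r, rfl, ⟨rfl, rfl⟩, rfl, h4⟩
    have h1 := reads_matchedPiece g
    have h2 := h1.whisker (l.map fun _ => Strand.unmatched) (r.map fun _ => Strand.unmatched)
    have h3 := linkWord_append (w := matchedWord w) h2
    rw [linkWord_shift _ _ h1, flatMap_linkStrand_unmatched] at h3
    have h5 := (linkWord_matchedPiece' g).whisker l r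
    have h6 := h5.append (ih h4) ?_ ?_
    · simp only [shift_cons, Nat.add_zero, shift_nil, List.singleton_append] at h6
      convert h6 using 1
      simp only [List.length_map, List.map_append, List.map_replicate] at h3 ⊢
      exact h3
    · change Reads VGen.Rule _ _ _
      have := (reads_linkWord h1).whisker l r
      simpa [linkStrand, List.flatMap_replicate] using this
    · change Reads VGen.Rule _ _ _
      have := reads_linkWord (reads_matchedWord Strand.unmatched reads_matchedPiece h4)
      simpa only [flatMap_linkStrand_unmatched] using this

theorem VirtualDiagram.toVirtual_toMatched (L : VirtualDiagram) :
    L.toMatched.toVirtual.Equivalent L :=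
  VirtualDiagram.equivalent_of_eqv (linkWord_matchedWord L.closed).of_detour _ _ rfl rfl

end GrapheneLink

/-! ### Replacing the pieces of pictures by words -/

namespace GrapheneLink

open Word

namespace Word

variable {G H A B : Type}

/-- Replace every piece of a picture by a picture with the same numbers of strands. -/
def expand (f : G → Word H) (w : Word G) : Word H := w.flatMap fun p => shift p.1 (f p.2)

@[simp] theorem expand_nil (f : G → Word H) : expand f [] = [] := rfl

@[simp] theorem expand_cons (f : G → Word H) (s : ℕ × G) (w : Word G) :
    expand f (s :: w) = shift s.1 (f s.2) ++ expand f w := by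
  simp [expand]

@[simp] theorem expand_append (f : G → Word H) (v w : Word G) :
    expand f (v ++ w) = expand f v ++ expand f w := by
  simp [expand]

@[simp] theorem expand_shift (f : G → Word H) (n : ℕ) (w : Word G) :
    expand f (shift n w) = shift n (expand f w) := by
  induction w with
  | nil => rfl
  | cons s w ih => obtain ⟨i, g⟩ := s; simp [ih]

theorem Reads.expand {f : G → Word H} {φ : A → B} {T : G → List A → List A → Prop}
    {T' : H → List B → List B → Prop}
    (hf : ∀ g x y, T g x y → Reads T' (x.map φ) (f g) (y.map φ)) {w : Word G} :
    ∀ {a b : List A}, Reads T a w b → Reads T' (a.map φ) (expand f w) (b.map φ) := by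
  induction w with
  | nil => rintro a b rfl; rfl
  | cons s w ih =>
    obtain ⟨i, g⟩ := s
    rintro a b ⟨l, x, y, r, rfl, h2, rfl, h4⟩
    rw [expand_cons]
    refine Reads.append (b := (l ++ y ++ r).map φ) ?_ (ih h4)
    simpa using (hf g x y h2).whisker (l.map φ) (r.map φ)

end Word

namespace Theory

variable {G H A B : Type} {Θ : Theory G A} {Φ : Theory H B}

/-- The two sides of a local move are replaced by equivalent words. Here `a` and `b` are the strands
at the bottom and the top of the move; no other strands are involved in it. -/
def Preserved (Θ : Theory G A) (Φ : Theory H B) (src tgt : G → List A) (f : G → Word H) (φ : A → B)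
    (v v' : Word G) : Prop :=
  ∃ a b, v ≠ [] ∧ demand src tgt v = a.map some ∧ Reads Θ.T a v b ∧ Reads Θ.T a v' b ∧
    Φ.Eqv (a.map φ) (b.map φ) (expand f v) (expand f v')

/-- Replacing pieces by words carries equivalent words to equivalent words, if this is true of the two
sides of every local move. -/
theorem Eqv.expand {src tgt : G → List A} {f : G → Word H} {φ : A → B}
    (hT : ∀ g x y, Θ.T g x y → x = src g ∧ y = tgt g)
    (hf : ∀ g x y, Θ.T g x y → Reads Φ.T (x.map φ) (f g) (y.map φ))
    (hR : ∀ v v', Θ.R v v' →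
      (∃ g h k, v = [(0, g), (Θ.tgt g + k, h)] ∧ v' = [(Θ.src g + k, h), (0, g)]) ∨
        Preserved Θ Φ src tgt f φ v v')
    {a b : List A} {w w' : Word G} (h : Θ.Eqv a b w w') :
    Φ.Eqv (a.map φ) (b.map φ) (expand f w) (expand f w') := by
  have hu : ∀ g x x' y y', Θ.T g x y → Θ.T g x' y' → x = x' ∧ y = y' := fun g x x' y y' h h' =>
    ⟨(hT _ _ _ h).1.trans (hT _ _ _ h').1.symm, (hT _ _ _ h).2.trans (hT _ _ _ h').2.symm⟩
  refine lift _ (fun w w' hs r1 r2 => ?_) h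
  obtain ⟨p, q, n, v, v', h⟩ := hs
  simp only [reads_append] at r1 r2
  obtain ⟨m2, ⟨m1, hp, hv⟩, hq⟩ := r1
  obtain ⟨m2', ⟨m1', hp', hv'⟩, hq'⟩ := r2
  obtain rfl := hp.unique hu hp'
  suffices m2 = m2' ∧ Φ.Eqv (m1.map φ) (m2.map φ) (shift n (Word.expand f v))
      (shift n (Word.expand f v')) by
    simpa using this.2.context (hp.expand hf) (hq.expand hf)
  obtain ⟨g, h, k, rfl, rfl⟩ | ⟨c, d, hne, hd, r1, r2, e⟩ := hR _ _ h
  · obtain ⟨l, x, y, r, h1, h2, rfl, l', x', y', r', h1', h2', e, rfl⟩ := hv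
    simp only [Nat.add_zero] at h1
    subst h1
    have e1 : x.length = Θ.src g ∧ y.length = Θ.tgt g := Θ.length_of_T h2
    obtain ⟨m, rfl⟩ : ∃ m, l' = l ++ y ++ m := by
      refine ⟨l'.drop (l ++ y).length, ?_⟩
      have := congrArg (List.take (l ++ y).length) e
      rw [List.append_assoc l', List.take_append_of_le_length le_rfl, List.take_length,
        List.take_append_of_le_length (by simp; omega)] at this
      conv_lhs => rw [← List.take_append_drop (l ++ y).length l', ← this]
    obtain rfl : k = m.length := by simp at h1'; omega
    obtain rfl : r = m ++ x' ++ r' := by simpa [List.append_assoc] using e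
    have r3 := (Reads.piece h2' (l ++ x ++ m) r').append
      (by simpa using Reads.piece h2 l (m ++ y' ++ r'))
    refine ⟨r3.unique hu (by simpa [Nat.add_assoc, e1] using hv') |>.symm ▸ by simp, ?_⟩
    have := swap_word_word (Θ := Φ) (m.map φ) (r'.map φ) (hf _ _ _ h2') (hf _ _ _ h2)
    have := this.whisker (l.map φ) []
    simpa [Nat.add_assoc, ← e1.1, ← e1.2] using this
  · obtain ⟨l, a', b', rfl, rfl, rfl, r3⟩ := hv.of_shift (hv.le_length hne)
    obtain ⟨l', a'', b'', e1, e2, rfl, r4⟩ := hv'.of_shift (n := l.length) (by simp)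
    obtain ⟨rfl, rfl⟩ := List.append_inj e2 e1.symm
    obtain ⟨r, rfl⟩ := r3.of_demand hT hd
    have r5 := r1.whisker [] r
    have r6 := r2.whisker [] r
    simp only [List.length_nil, shift_zero, List.nil_append] at r5 r6
    obtain rfl := r3.unique hu r5
    obtain rfl := r4.unique hu r6
    exact ⟨rfl, by simpa using e.whisker (l.map φ) (r.map φ)⟩

end Theory

end GrapheneLink

/-! ### Diagrams of unmatched strands and vertical matched edges -/

namespace GrapheneLink

open Word

/-- Elementary pieces of pictures that consist of unmatched strands, classical and virtual crossings
and boxes. A box stands for a vertical matched edge with solid vertices, of sign `s` and with its dot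
at the upper end iff `d = true`; a classical crossing stands for its replacement by a matched edge. -/
inductive BoxGen : Type
  | link (g : VGen)
  | box (s d : Bool)
  deriving DecidableEq

namespace BoxGen

/-- A minimum. -/
abbrev cup : BoxGen := link .cup

/-- A maximum. -/
abbrev cap : BoxGen := link .cap

/-- An intersection. -/
abbrev virtual : BoxGen := link (.cross .virtual)

/-- A classical crossing. -/
abbrev classical (b : Bool) : BoxGen := link (.cross (.classical b))

/-- Number of strands below a piece. -/
def src : BoxGen → ℕ
  | link g => g.src
  | box _ _ => 2

/-- Number of strands above a piece. -/
def tgt : BoxGen → ℕ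
  | link g => g.tgt
  | box _ _ => 2

end BoxGen

open BoxGen

/-- The local moves of pictures with boxes. -/
inductive BoxRule : Type
  | zigzagLeft
  | zigzagRight
  | capSlide
  | cupSlide
  | V1
  | V2
  | V3
  /-- A strand moves past a box. -/
  | natural (s d : Bool)
  /-- A box is rotated by a half turn. -/
  | turn (s d : Bool)
  /-- Both vertices of a box become hollow. -/
  | twist (s d : Bool)
  /-- A box of sign `+` with one hollow vertex is a box of sign `-`. -/
  | negate (d : Bool)
  /-- A classical crossing is replaced by a box. -/
  | crossing (b : Bool)
  | G1 (s d : Bool)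
  | G2 (s : Bool)
  | G3 (s d : Bool)

/-- Two vertical strands, joined by a horizontal matched edge. -/
def boxRung (s d : Bool) : Word BoxGen := [(0, cup), (1, box s d), (2, cap)]

/-- Three vertical strands, the outer two of which are joined by a horizontal matched edge that lies
to the left of the middle strand, which makes a detour. -/
def boxLongRung (s d : Bool) : Word BoxGen :=
  [(0, cup), (1, box s d), (2, virtual), (1, virtual), (3, cap)]

/-- The two sides of a move. -/
def BoxRule.sides : BoxRule → Word BoxGen × Word BoxGen
  | zigzagLeft => ([(0, cup), (1, cap)], [])
  | zigzagRight => ([(1, cup), (0, cap)], [])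
  | capSlide => ([(0, virtual), (1, cap)], [(1, virtual), (0, cap)])
  | cupSlide => ([(0, cup), (1, virtual)], [(1, cup), (0, virtual)])
  | V1 => ([(1, cup), (0, virtual), (1, cap)], [])
  | V2 => ([(0, virtual), (0, virtual)], [])
  | V3 => ([(0, virtual), (1, virtual), (0, virtual)], [(1, virtual), (0, virtual), (1, virtual)])
  | natural s d => ([(0, virtual), (1, virtual), (0, box s d)],
      [(1, box s d), (0, virtual), (1, virtual)])
  | turn s d => ([(0, box s d)], [(2, cup), (3, cup), (2, box s (!d)), (1, cap), (0, cap)])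
  | twist s d => ([(0, box s d)], [(0, virtual), (0, box s d), (0, virtual)])
  | negate d => ([(0, virtual), (0, box true d)], [(0, box false (!d))])
  | crossing false => ([(0, classical false)],
      [(1, cup), (0, box true true), (2, virtual), (1, cap)])
  | crossing true => ([(0, classical true)], [(2, cup), (1, classical false), (0, cap)])
  | G1 s d => (boxRung s d ++ [(0, cap)], [(0, cap)])
  | G2 s => (boxRung s (!s) ++ boxRung (!s) s, [])
  | G3 s d => (boxRung s d ++ boxLongRung s d ++ (boxRung s d).shift 1,
      (boxRung s d).shift 1 ++ boxLongRung s d ++ boxRung s d)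

/-- Pictures with boxes. -/
def boxTheory : Theory BoxGen Unit where
  src := src
  tgt := tgt
  T g x y := x = units g.src ∧ y = units g.tgt
  R v v' := (∃ g h k, v = [(0, g), (tgt g + k, h)] ∧ v' = [(src g + k, h), (0, g)]) ∨
    ∃ c : BoxRule, c.sides = (v, v')
  length_of_T := by rintro g x y ⟨rfl, rfl⟩; simp
  interchange g h k := .inl ⟨g, h, k, rfl, rfl⟩

/-- An equivalence between two pictures with given numbers of strands. -/
structure BoxLemma : Type where
  /-- number of strands at the bottom -/
  bottom : ℕ
  /-- number of strands at the top -/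
  top : ℕ
  /-- left-hand side -/
  lhs : Word BoxGen
  /-- right-hand side -/
  rhs : Word BoxGen
  eqv : boxTheory.Eqv (units bottom) (units top) lhs rhs

/-- The number of strands at the top of a piece. -/
def boxTy : BoxGen → List Unit → Option (List Unit)
  | link g, c => linkTy g c
  | box _ _, _ :: _ :: c => some (() :: () :: c)
  | _, _ => none

/-- The checker for pictures with boxes. -/
def boxChecker : Checker boxTheory Unit BoxRule BoxLemma where
  mark := id
  ty := boxTy
  prim := BoxRule.sides
  known x := ((units x.bottom, units x.top), x.lhs, x.rhs)
  ty_sound := by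
    rintro ((_ | _ | c) | ⟨s, d⟩) (_ | ⟨x, _ | ⟨y, l⟩⟩) c' h <;> cases h
    · exact ⟨[], [(), ()], [], rfl, rfl, rfl, rfl⟩
    · exact ⟨[], [(), ()], [x], rfl, rfl, rfl, rfl⟩
    · exact ⟨[], [(), ()], x :: y :: l, rfl, rfl, rfl, rfl⟩
    · exact ⟨[(), ()], [], l, rfl, rfl, rfl, rfl⟩
    · exact ⟨[(), ()], [(), ()], l, rfl, rfl, rfl, rfl⟩
    · exact ⟨[(), ()], [(), ()], l, rfl, rfl, rfl, rfl⟩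
  prim_sound c := .inr ⟨c, rfl⟩
  known_sound x := by simpa using x.eqv

theorem box_eqv (m n : ℕ) (os : List (Op BoxRule BoxLemma)) {w w' : Word BoxGen}
    (h : boxChecker.check (units m) (units n) os w w' = true) :
    boxTheory.Eqv (units m) (units n) w w' := by
  simpa [boxChecker] using Checker.eqv h

/-- An equivalence that is verified by computation. -/
def boxLemma (m n : ℕ) (w w' : Word BoxGen) (os : List (Op BoxRule BoxLemma))
    (h : boxChecker.check (units m) (units n) os w w' = true) : BoxLemma :=
  ⟨m, n, w, w', box_eqv m n os h⟩

namespace BoxLemma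

/-- A virtual crossing is absorbed by a maximum. -/
def capTwist : BoxLemma :=
  boxLemma 2 0 [(0, virtual), (0, cap)]
    [(0, cap)]
    [.bwd .zigzagRight 1 1, .swapR 0, .fwd .capSlide 1 0, .swapR 2, .fwd .V1 0 1]
    (by decide +kernel)

/-- A minimum moves past a strand. -/
def cupPass : BoxLemma :=
  boxLemma 1 3 [(1, cup), (0, virtual), (1, virtual)]
    [(0, cup)]
    [.bwd .cupSlide 0 0, .fwd .V2 1 1]
    (by decide +kernel)

/-- The mirror image of `cupPass`. -/
def cupPass' : BoxLemma :=
  boxLemma 1 3 [(0, cup), (1, virtual), (0, virtual)]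
    [(1, cup)]
    [.fwd .cupSlide 0 0, .fwd .V2 1 0]
    (by decide +kernel)

/-- A maximum moves past a strand. -/
def capPass : BoxLemma :=
  boxLemma 3 1 [(1, virtual), (0, virtual), (1, cap)]
    [(0, cap)]
    [.fwd .capSlide 1 0, .fwd .V2 0 1]
    (by decide +kernel)

/-- The mirror image of `capPass`. -/
def capPass' : BoxLemma :=
  boxLemma 3 1 [(0, virtual), (1, virtual), (0, cap)]
    [(1, cap)]
    [.bwd .capSlide 1 0, .fwd .V2 0 0]
    (by decide +kernel)

/-- A matched edge moves past a strand from the left to the right. -/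
def boxPass (s d : Bool) : BoxLemma :=
  boxLemma 3 3 [(1, virtual), (0, virtual), (1, box s d)]
    [(0, box s d), (1, virtual), (0, virtual)]
    [.bwd .V2 3 0, .bwd .V2 4 1, .bwd (.natural s d) 2 0, .fwd .V2 1 0, .fwd .V2 0 1]
    (by revert s d; decide +kernel)

/-- A strand moves past the replacement of a classical crossing. -/
def detourFalse : BoxLemma :=
  boxLemma 3 3 [(0, virtual), (1, virtual), (0, classical false)]
    [(1, classical false), (0, virtual), (1, virtual)]
    [.fwd (.crossing false) 2 0, .swapL 1, .swapL 2, .bwd .V2 2 2, .swapL 3, .fwd .cupSlide 1 1,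
     .swapR 0, .fwd (.natural true true) 1 0, .fwd .V3 4 2, .swapL 6, .bwd .capSlide 5 1, .swapL 4,
     .fwd .V2 3 1, .swapR 2, .swapR 3, .bwd (.crossing false) 0 1]
    (by decide +kernel)

/-- The replacement of a classical crossing does not change under a half turn of the plane. The half
turn reverses the direction of the box. Both sides are brought to the same picture, in which a box of
the reversed direction has one twist below and one above on its right; on the left-hand side, this
uses that a box may be twisted at both ends. -/
def turnFalse : BoxLemma :=
  boxLemma 2 2 [(0, classical false)]
    [(2, cup), (3, cup), (2, classical false), (1, cap), (0, cap)]
    [.fwd (.crossing false) 0 0, .swapR 1, .unuse capTwist 3 1, .unuse capPass' 4 0,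
     .unuse (boxPass true true) 2 0, .use cupPass' 0 1, .swapL 0, .unuse cupPass' 1 1,
     .bwd (.twist true true) 3 1, .bwd .zigzagLeft 3 2, .swapL 4, .swapL 5, .swapL 2, .swapL 3,
     .swapL 4, .bwd .zigzagLeft 5 0, .swapL 4, .swapL 3, .swapL 2, .swapL 1,
     .bwd (.turn true false) 2 1, .swapL 0, .bwd .V2 1 1, .fwd (.natural true false) 2 1,
     .fwd .V2 4 2, .fwd .cupSlide 0 0, .swapR 1, .bwd .zigzagRight 4 2, .swapR 3,
     .fwd .capSlide 4 1, .swapR 5, .fwd .V1 3 2, .fwd (.turn true false) 1 2, .swapR 0, .swapR 1,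
     .fwd .capSlide 6 0, .swapR 2, .swapR 3, .fwd .zigzagLeft 4 1, .swapR 3, .bwd .zigzagRight 4 4,
     .swapR 3, .fwd .capSlide 4 3, .swapR 2, .swapR 1, .bwd (.crossing false) 2 2]
    (by decide +kernel)

/-- A box is the replacement of its clasp: the case of a positive box with its dot on top. -/
def clasp₁ : BoxLemma :=
  boxLemma 2 2 [(1, cup), (0, classical false), (2, virtual), (1, cap)]
    [(0, box true true)]
    [.fwd (.crossing false) 1 0, .swapL 0, .swapL 1, .bwd .capSlide 3 1, .swapL 2,
     .fwd .zigzagRight 3 2, .bwd .capSlide 3 1, .fwd .V2 2 1, .swapR 1, .fwd .zigzagLeft 0 1]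
    (by decide +kernel)

/-- The replacements of the two kinds of classical crossings are quarter turns of each other, in
either sense. -/
def capSlideFalse : BoxLemma :=
  boxLemma 3 1 [(0, classical false), (1, cap)]
    [(1, classical true), (0, cap)]
    [.use turnFalse 0 0, .swapR 4, .bwd (.crossing true) 1 1, .swapR 1, .fwd .zigzagLeft 0 2]
    (by decide +kernel)

def capSlideTrue : BoxLemma :=
  boxLemma 3 1 [(0, classical true), (1, cap)]
    [(1, classical false), (0, cap)]
    [.fwd (.crossing true) 0 0, .swapR 2, .swapR 1, .fwd .zigzagLeft 0 2]
    (by decide +kernel)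

def cupSlideFalse : BoxLemma :=
  boxLemma 1 3 [(0, cup), (1, classical false)]
    [(1, cup), (0, classical true)]
    [.bwd .zigzagRight 2 2, .swapR 1, .swapR 0, .use capSlideFalse 2 1, .swapR 1,
     .fwd .zigzagLeft 2 0]
    (by decide +kernel)

def cupSlideTrue : BoxLemma :=
  boxLemma 1 3 [(0, cup), (1, classical true)]
    [(1, cup), (0, classical false)]
    [.fwd (.crossing true) 1 1, .swapR 0, .swapR 1, .fwd .zigzagLeft 2 0]
    (by decide +kernel)

def detourTrue : BoxLemma :=
  boxLemma 3 3 [(0, virtual), (1, virtual), (0, classical true)]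
    [(1, classical true), (0, virtual), (1, virtual)]
    [.fwd (.crossing true) 2 0, .unuse cupPass 2 2, .swapR 1, .swapL 4, .use detourFalse 2 1,
     .swapL 5, .swapL 4, .swapR 0, .swapR 1, .use capPass' 2 0, .bwd (.crossing true) 0 1]
    (by decide +kernel)

/-- The case of a positive box with its dot at the bottom, which is the first case rotated by a half
turn. -/
def clasp₂ : BoxLemma :=
  boxLemma 2 2 [(1, cup), (0, virtual), (2, classical false), (1, cap)]
    [(0, box true false)]
    [.swapR 1, .use turnFalse 1 2, .swapR 0, .swapR 1, .swapR 2, .swapR 3, .fwd .zigzagLeft 4 1,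
     .fwd .capSlide 4 0, .swapR 3, .bwd .zigzagRight 4 4, .swapR 3, .fwd .capSlide 4 3, .swapR 2,
     .swapR 1, .use clasp₁ 2 2, .bwd (.turn true false) 0 0]
    (by decide +kernel)

/-- The case of a negative box with its dot at the bottom, which is a positive box with a twist. -/
def clasp₃ : BoxLemma :=
  boxLemma 2 2 [(1, cup), (0, virtual), (2, classical true), (1, cap)]
    [(0, box false false)]
    [.swapR 1, .fwd (.crossing true) 1 2, .swapR 0, .swapR 1, .fwd .zigzagLeft 2 1,
     .unuse capTwist 3 1, .unuse detourFalse 1 0, .swapL 0, .bwd .cupSlide 1 1, .swapL 2,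
     .use clasp₁ 1 0, .fwd (.negate true) 0 0]
    (by decide +kernel)

/-- The case of a negative box with its dot on top, which is the third case rotated by a half turn. -/
def clasp₄ : BoxLemma :=
  boxLemma 2 2 [(1, cup), (0, classical true), (2, virtual), (1, cap)]
    [(0, box false true)]
    [.swapR 1, .use capSlideTrue 2 0, .use turnFalse 2 1, .bwd (.crossing true) 3 2,
     .fwd .cupSlide 0 1, .swapR 1, .bwd .zigzagRight 3 2, .swapR 2, .fwd .capSlide 3 1, .swapR 4,
     .swapR 5, .use clasp₃ 2 2, .bwd (.negate true) 2 2, .unuse capPass 4 1,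
     .bwd (.twist true true) 2 2, .swapL 4, .bwd .capSlide 3 0, .swapL 2, .swapL 1, .swapL 0,
     .bwd (.turn true false) 1 0, .fwd (.negate false) 0 0]
    (by decide +kernel)

end BoxLemma

end GrapheneLink

/-! ### From virtual link diagrams to pictures with boxes -/

namespace GrapheneLink

open Word BoxGen

/-- The replacement of a matched edge by a clasp and of the clasp by matched edges. -/
def BoxLemma.clasp : Bool → Bool → BoxLemma
  | true, true => clasp₁
  | true, false => clasp₂
  | false, false => clasp₃
  | false, true => clasp₄

/-- A picture without boxes. -/
def boxWord (w : Word VGen) : Word BoxGen := expand (fun g => [(0, link g)]) w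

open BoxLemma Strand MGen in
theorem boxWord_G1 (s d : Bool) : boxTheory.Eqv (units 2) (units 0)
    (boxWord (linkWord [unmatched, unmatched] (rung s d ++ [(0, .cap unmatched)])))
    (boxWord (linkWord [unmatched, unmatched] [(0, .cap unmatched)])) :=
  box_eqv 2 0 [.use (clasp s d) 1 1, .fwd (.G1 s d) 0 0] (by revert s d; decide +kernel)

open BoxLemma Strand MGen in
theorem boxWord_G2 (s : Bool) : boxTheory.Eqv (units 2) (units 2)
    (boxWord (linkWord [unmatched, unmatched] (rung s (!s) ++ rung (!s) s))) [] :=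
  box_eqv 2 2 [.use (clasp s (!s)) 1 1, .use (clasp (!s) s) 4 1, .fwd (.G2 s) 0 0]
    (by revert s; decide +kernel)

open BoxLemma Strand MGen in
theorem boxWord_G3 (s d : Bool) : boxTheory.Eqv (units 3) (units 3)
    (boxWord (linkWord [unmatched, unmatched, unmatched]
      (rung s d ++ longRung s d ++ (rung s d).shift 1)))
    (boxWord (linkWord [unmatched, unmatched, unmatched]
      ((rung s d).shift 1 ++ longRung s d ++ rung s d))) := by
  cases d
  · exact box_eqv 3 3
      [.use (clasp s false) 1 1, .use (clasp s false) 4 1, .use (clasp s false) 9 2,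
       .fwd (.G3 s false) 0 0,
       .unuse (clasp s false) 9 1, .unuse (clasp s false) 4 1, .unuse (clasp s false) 1 2]
      (by revert s; decide +kernel)
  · exact box_eqv 3 3
      [.use (clasp s true) 1 1, .use (clasp s true) 6 2, .use (boxPass s true) 4 1,
       .use (clasp s true) 9 2, .fwd (.G3 s true) 0 0, .unuse (clasp s true) 9 1,
       .unuse (boxPass s true) 4 1, .unuse (clasp s true) 6 2, .unuse (clasp s true) 1 2]
      (by revert s; decide +kernel)

/-- A local move of virtual link diagrams is preserved, if it is verified by computation. -/
theorem preserved_boxWord {E : Word VGen → Word VGen → Prop} (m n : ℕ) {v v' : Word VGen}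
    (h : boxTheory.Eqv (units m) (units n) (boxWord v) (boxWord v')) (hv : v ≠ [])
    (hd : demand (fun g => units g.src) (fun g => units g.tgt) v = (units m).map some)
    (h1 : detourChecker.out (units m) v = some (units n))
    (h2 : detourChecker.out (units m) v' = some (units n)) :
    Theory.Preserved (linkTheory E) boxTheory (fun g => units g.src) (fun g => units g.tgt)
      (fun g => [(0, link g)]) id v v' :=
  ⟨units m, units n, hv, hd, reads_of_detourChecker h1, reads_of_detourChecker h2, by simpa [boxWord] using h⟩

theorem LinkRule.preserved_boxWord {E : Word VGen → Word VGen → Prop} (c : LinkRule) :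
    Theory.Preserved (linkTheory E) boxTheory (fun g => units g.src) (fun g => units g.tgt)
      (fun g => [(0, link g)]) id c.sides.1 c.sides.2 := by
  rcases c with _ | _ | ((_ | _) | _) | ((_ | _) | _) | _ | _ | _ | (_ | _)
  · exact GrapheneLink.preserved_boxWord 1 1 (box_eqv 1 1 [.fwd .zigzagLeft 0 0] (by decide +kernel))
      (by simp [LinkRule.sides]) rfl rfl rfl
  · exact GrapheneLink.preserved_boxWord 1 1 (box_eqv 1 1 [.fwd .zigzagRight 0 0] (by decide +kernel))
      (by simp [LinkRule.sides]) rfl rfl rfl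
  · exact GrapheneLink.preserved_boxWord 3 1 BoxLemma.capSlideFalse.eqv
      (by simp [LinkRule.sides]) rfl rfl rfl
  · exact GrapheneLink.preserved_boxWord 3 1 BoxLemma.capSlideTrue.eqv
      (by simp [LinkRule.sides]) rfl rfl rfl
  · exact GrapheneLink.preserved_boxWord 3 1 (box_eqv 3 1 [.fwd .capSlide 0 0] (by decide +kernel))
      (by simp [LinkRule.sides]) rfl rfl rfl
  · exact GrapheneLink.preserved_boxWord 1 3 BoxLemma.cupSlideFalse.eqv
      (by simp [LinkRule.sides]) rfl rfl rfl
  · exact GrapheneLink.preserved_boxWord 1 3 BoxLemma.cupSlideTrue.eqv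
      (by simp [LinkRule.sides]) rfl rfl rfl
  · exact GrapheneLink.preserved_boxWord 1 3 (box_eqv 1 3 [.fwd .cupSlide 0 0] (by decide +kernel))
      (by simp [LinkRule.sides]) rfl rfl rfl
  · exact GrapheneLink.preserved_boxWord 1 1 (box_eqv 1 1 [.fwd .V1 0 0] (by decide +kernel))
      (by simp [LinkRule.sides]) rfl rfl rfl
  · exact GrapheneLink.preserved_boxWord 2 2 (box_eqv 2 2 [.fwd .V2 0 0] (by decide +kernel))
      (by simp [LinkRule.sides]) rfl rfl rfl
  · exact GrapheneLink.preserved_boxWord 3 3 (box_eqv 3 3 [.fwd .V3 0 0] (by decide +kernel))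
      (by simp [LinkRule.sides]) rfl rfl rfl
  · exact GrapheneLink.preserved_boxWord 3 3 BoxLemma.detourFalse.eqv
      (by simp [LinkRule.sides]) rfl rfl rfl
  · exact GrapheneLink.preserved_boxWord 3 3 BoxLemma.detourTrue.eqv
      (by simp [LinkRule.sides]) rfl rfl rfl

theorem ImageMove.preserved_boxWord {E : Word VGen → Word VGen → Prop} {v v' : Word VGen} (h : ImageMove v v') :
    Theory.Preserved (linkTheory E) boxTheory (fun g => units g.src) (fun g => units g.tgt)
      (fun g => [(0, link g)]) id v v' := by
  rcases h with ⟨s, d⟩ | s | ⟨s, d⟩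
  · refine GrapheneLink.preserved_boxWord 2 0 (boxWord_G1 s d) ?_ ?_ ?_ ?_ <;>
      (cases s <;> cases d <;> first | rfl | exact List.cons_ne_nil _ _)
  · refine GrapheneLink.preserved_boxWord 2 2 (boxWord_G2 s) ?_ ?_ ?_ ?_ <;>
      (cases s <;> first | rfl | exact List.cons_ne_nil _ _)
  · refine GrapheneLink.preserved_boxWord 3 3 (boxWord_G3 s d) ?_ ?_ ?_ ?_ <;>
      (cases s <;> cases d <;> first | rfl | exact List.cons_ne_nil _ _)

theorem virtualIsotopy_cases {v v' : Word VGen} (h : VirtualIsotopy v v') :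
    (∃ g h k, v = [(0, g), (VGen.tgt g + k, h)] ∧ v' = [(VGen.src g + k, h), (0, g)]) ∨
      ∃ c : LinkRule, c.sides = (v, v') := by
  cases h with
  | interchange g h k => exact .inl ⟨g, h, k, rfl, rfl⟩
  | zigzagLeft => exact .inr ⟨.zigzagLeft, rfl⟩
  | zigzagRight => exact .inr ⟨.zigzagRight, rfl⟩
  | capSlide c => exact .inr ⟨.capSlide c, rfl⟩
  | cupSlide c => exact .inr ⟨.cupSlide c, rfl⟩

theorem Theory.Eqv.boxWord {E : Word VGen → Word VGen → Prop}
    (hE : ∀ v v', E v v' → Theory.Preserved (linkTheory E) boxTheory (fun g => units g.src)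
      (fun g => units g.tgt) (fun g => [(0, link g)]) id v v')
    {a b : List Unit} {w w' : Word VGen} (h : (linkTheory E).Eqv a b w w') :
    boxTheory.Eqv a b (boxWord w) (boxWord w') := by
  have := Theory.Eqv.expand (Φ := boxTheory) (src := fun g => units g.src)
    (tgt := fun g => units g.tgt) (f := fun g => [(0, link g)]) (φ := id) (fun g x y h => h) ?_ ?_ h
  · simpa [GrapheneLink.boxWord] using this
  · rintro g x y ⟨rfl, rfl⟩
    rw [List.map_id, List.map_id]
    exact ⟨[], _, _, [], rfl, ⟨rfl, rfl⟩, (List.append_nil _).symm, List.append_nil _⟩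
  · rintro v v' (h | ⟨c, h⟩ | h)
    · obtain h | ⟨c, h⟩ := virtualIsotopy_cases h
      · exact .inl h
      · have := c.preserved_boxWord (E := E)
        rw [h] at this
        exact .inr this
    · have := c.preserved_boxWord (E := E)
      rw [h] at this
      exact .inr this
    · exact .inr (hE _ _ h)

theorem VirtualReidemeister.preserved_boxWord {E : Word VGen → Word VGen → Prop} {v v' : Word VGen}
    (h : VirtualReidemeister v v') :
    Theory.Preserved (linkTheory E) boxTheory (fun g => units g.src) (fun g => units g.tgt)
      (fun g => [(0, link g)]) id v v' := by
  cases h with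
  | R1 b =>
    exact GrapheneLink.preserved_boxWord 1 1
      ((R1_of_image b).boxWord fun _ _ => ImageMove.preserved_boxWord) (List.cons_ne_nil _ _)
      rfl rfl rfl
  | R2 b =>
    exact GrapheneLink.preserved_boxWord 2 2
      ((R2_of_image b).boxWord fun _ _ => ImageMove.preserved_boxWord) (List.cons_ne_nil _ _)
      rfl rfl rfl
  | R3 b =>
    exact GrapheneLink.preserved_boxWord 3 3
      ((R3_of_image b).boxWord fun _ _ => ImageMove.preserved_boxWord) (List.cons_ne_nil _ _)
      rfl rfl rfl
  | V1 => exact LinkRule.V1.preserved_boxWord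
  | V2 => exact LinkRule.V2.preserved_boxWord
  | V3 => exact LinkRule.V3.preserved_boxWord
  | VM b => exact (LinkRule.VM b).preserved_boxWord

/-- Virtual Reidemeister moves become equivalences of pictures with boxes. -/
theorem Theory.Eqv.boxWord_of_reidemeister {a b : List Unit} {w w' : Word VGen}
    (h : reidemeisterTheory.Eqv a b w w') :
    boxTheory.Eqv a b (GrapheneLink.boxWord w) (GrapheneLink.boxWord w') :=
  h.boxWord fun _ _ => VirtualReidemeister.preserved_boxWord

end GrapheneLink

/-! ### Numbered matched diagrams -/

namespace GrapheneLink

open Word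

/-- A numerical code of the kinds of strands. -/
def Strand.code : Strand → ℕ
  | unmatched => 0
  | matched false false => 1
  | matched false true => 2
  | matched true false => 3
  | matched true true => 4

theorem Strand.code_injective : Function.Injective Strand.code := by
  rintro (_ | ⟨_ | _, _ | _⟩) (_ | ⟨_ | _, _ | _⟩) h <;> first | rfl | simp [Strand.code] at h

instance : DecidableEq Strand := fun a b => decidable_of_iff (a.code = b.code)
  Strand.code_injective.eq_iff

/-- A code of the pieces of matched diagrams. -/
def MGen.code : MGen → ℕ × Strand × Strand × Bool
  | cup a => (0, a, a, true)
  | cap a => (1, a, a, true)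
  | cross a b => (2, a, b, true)
  | merge c s d => (3, .matched s d, .matched s d, c)
  | split c s d => (4, .matched s d, .matched s d, c)

theorem MGen.code_injective : Function.Injective MGen.code := by
  rintro (_ | _ | _ | _ | _) (_ | _ | _ | _ | _) h <;> simp_all [MGen.code]

instance : DecidableEq MGen := fun a b => decidable_of_iff (a.code = b.code)
  MGen.code_injective.eq_iff

/-- The kind of a strand together with a number, if it is part of a matched edge. -/
inductive Mark : Type
  | unmatched
  | matched (s d : Bool) (z : ℤ)

/-- The kind of a strand. -/
def Mark.strand : Mark → Strand
  | unmatched => .unmatched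
  | matched s d _ => .matched s d

/-- The number grows in the direction of the dot, from the leg with number `x` to the leg with
number `y` of a maximum if `d = true`, and in the other direction if `d = false`. -/
def Grows (d : Bool) (x y : ℤ) : Prop := if d then x < y else y < x

/-- The marks at a piece: kinds of strands, and numbers that grow at every minimum and maximum of a
matched edge in the direction of the dot. -/
inductive MarkRule : MGen → List Mark → List Mark → Prop
  | cupUnmatched : MarkRule (.cup .unmatched) [] [.unmatched, .unmatched]
  | capUnmatched : MarkRule (.cap .unmatched) [.unmatched, .unmatched] []
  | cupMatched (s d : Bool) (x y : ℤ) (h : Grows d y x) :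
      MarkRule (.cup (.matched s d)) [] [.matched s d x, .matched s (!d) y]
  | capMatched (s d : Bool) (x y : ℤ) (h : Grows d x y) :
      MarkRule (.cap (.matched s d)) [.matched s d x, .matched s (!d) y] []
  | cross (x y : Mark) : MarkRule (.cross x.strand y.strand) [x, y] [y, x]
  | merge (c s d : Bool) (z : ℤ) :
      MarkRule (.merge c s d) [.unmatched, .unmatched] [.matched s d z]
  | split (c s d : Bool) (z : ℤ) :
      MarkRule (.split c s d) [.matched s d z] [.unmatched, .unmatched]

theorem MarkRule.rule {g : MGen} {x y : List Mark} (h : MarkRule g x y) :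
    MGen.Rule g (x.map Mark.strand) (y.map Mark.strand) := by
  cases h <;> exact ⟨rfl, rfl⟩

/-- Numbered matched diagrams with planar isotopies and further moves `E`. -/
def matchedTheory (E : Word MGen → Word MGen → Prop) : Theory MGen Mark where
  src g := g.src.length
  tgt g := g.tgt.length
  T := MarkRule
  R v v' := MatchedIsotopy v v' ∨ E v v'
  length_of_T h := by
    obtain ⟨h1, h2⟩ := MarkRule.rule h
    exact ⟨by rw [← h1, List.length_map], by rw [← h2, List.length_map]⟩
  interchange g h k := .inl (.interchange g h k)

/-- Numbered matched diagrams up to ribbon moves. -/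
def ribbonTheory : Theory MGen Mark := matchedTheory RibbonMove

/-- A planar isotopy, other than an exchange of heights, or a ribbon move. -/
inductive RibbonRule : Type
  | zigzagLeft (a : Strand)
  | zigzagRight (a : Strand)
  | capSlide (a x : Strand)
  | cupSlide (a x : Strand)
  | turnLeft (c s d : Bool)
  | turnRight (c s d : Bool)
  | M1 (a : Strand)
  | M2 (a b : Strand)
  | M3 (a b c : Strand)
  | M4 (a : Strand) (c s d : Bool)
  | M5 (s d : Bool)

open MGen Strand in
/-- The two sides of a move. -/
def RibbonRule.sides : RibbonRule → Word MGen × Word MGen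
  | zigzagLeft a => ([(0, cup a), (1, cap a.dual)], [])
  | zigzagRight a => ([(1, cup a.dual), (0, cap a)], [])
  | capSlide a x => ([(0, cross a x), (1, cap a)], [(1, cross x a.dual), (0, cap a)])
  | cupSlide a x => ([(0, cup a), (1, cross a.dual x)], [(1, cup a), (0, cross x a)])
  | turnLeft c s d => ([(0, merge c s d)],
      [(0, cup (matched s d)), (1, split c s (!d)), (2, cap unmatched), (1, cap unmatched)])
  | turnRight c s d => ([(0, merge c s d)],
      [(2, cup (matched s (!d))), (2, split c s (!d)), (1, cap unmatched), (0, cap unmatched)])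
  | M1 a => ([(1, cup a), (0, cross a a), (1, cap a)], [])
  | M2 a b => ([(0, cross a b), (0, cross b a)], [])
  | M3 a b c => ([(0, cross a b), (1, cross a c), (0, cross b c)],
      [(1, cross b c), (0, cross a c), (1, cross a b)])
  | M4 a c s d => ([(0, split c s d), (1, cross unmatched a), (0, cross unmatched a)],
      [(0, cross (matched s d) a), (1, split c s d)])
  | M5 s d => ([(0, split false s d)], [(0, split true s d), (0, cross unmatched unmatched)])

theorem RibbonRule.sound (c : RibbonRule) :
    MatchedIsotopy c.sides.1 c.sides.2 ∨ RibbonMove c.sides.1 c.sides.2 := by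
  cases c
  exacts [.inl (.zigzagLeft _), .inl (.zigzagRight _), .inl (.capSlide _ _), .inl (.cupSlide _ _),
    .inl (.turnLeft _ _ _), .inl (.turnRight _ _ _), .inr (.M1 _), .inr (.M2 _ _), .inr (.M3 _ _ _),
    .inr (.M4 _ _ _ _), .inr (.M5 _ _)]

/-- Tags for the verification of moves with numbers. The number of an inner strand is relative to
a number `z`, and lies between the numbers of the two kinds of outer strands, which are only used
at the legs of maxima. Foreign strands have an arbitrary mark; they only take part in crossings. -/
inductive Tag : Type
  | plain
  | inner (s d : Bool)
  | outer (s d : Bool)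
  | foreign (a : Strand)
  deriving DecidableEq

namespace Tag

/-- The kind of a strand. -/
def strand : Tag → Strand
  | plain => .unmatched
  | inner s d => .matched s d
  | outer s d => .matched s d
  | foreign a => a

/-- The mark of a strand: inner and outer strands are numbered relative to `z`, foreign strands by
`z'`. -/
def mark (z z' : ℤ) : Tag → Mark
  | plain => .unmatched
  | inner s d => .matched s d (z + if d then 2 else 1)
  | outer s d => .matched s d (z + if d then 0 else 3)
  | foreign .unmatched => .unmatched
  | foreign (.matched s d) => .matched s d z'

theorem strand_mark (z z' : ℤ) (t : Tag) : (t.mark z z').strand = t.strand := by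
  rcases t with _ | _ | _ | (_ | _) <;> rfl

end Tag

open Tag

/-- The tags at the top of a piece. -/
def ribbonTy : MGen → List Tag → Option (List Tag)
  | .cup .unmatched, c => some (plain :: plain :: c)
  | .cup (.matched s d), c => some (inner s d :: inner s (!d) :: c)
  | .cap .unmatched, plain :: plain :: c => some c
  | .cap (.matched s d), x :: y :: c =>
      if (x = inner s d ∧ y = outer s (!d)) ∨ (x = outer s d ∧ y = inner s (!d)) then some c else none
  | .cross a b, x :: y :: c => if x.strand = a ∧ y.strand = b then some (y :: x :: c) else none
  | .merge _ s d, plain :: plain :: c => some (inner s d :: c)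
  | .split _ s d, x :: c =>
      if x = inner s d ∨ x = outer s d then some (plain :: plain :: c) else none
  | _, _ => none

theorem ribbonTy_sound (z z' : ℤ) {g : MGen} {c c' : List Tag} (h : ribbonTy g c = some c') :
    ∃ x y r, c = x ++ r ∧ c' = y ++ r ∧ MarkRule g (x.map (mark z z')) (y.map (mark z z')) := by
  unfold ribbonTy at h
  split at h
  · cases h
    exact ⟨[], [plain, plain], c, rfl, rfl, .cupUnmatched⟩
  · rename_i s d
    cases h
    refine ⟨[], [inner s d, inner s (!d)], c, rfl, rfl, .cupMatched _ _ _ _ ?_⟩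
    cases d <;> simp [Grows]
  · cases h
    exact ⟨[plain, plain], [], _, rfl, rfl, .capUnmatched⟩
  · rename_i s d x y c
    rw [Option.ite_none_right_eq_some] at h
    obtain ⟨⟨rfl, rfl⟩ | ⟨rfl, rfl⟩, h⟩ := h <;> cases h
    · refine ⟨[inner s d, outer s (!d)], [], _, rfl, rfl, .capMatched _ _ _ _ ?_⟩
      cases d <;> simp [Grows]
    · refine ⟨[outer s d, inner s (!d)], [], _, rfl, rfl, .capMatched _ _ _ _ ?_⟩
      cases d <;> simp [Grows]
  · rename_i a b x y c
    rw [Option.ite_none_right_eq_some] at h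
    obtain ⟨⟨rfl, rfl⟩, h⟩ := h
    cases h
    refine ⟨[x, y], [y, x], c, rfl, rfl, ?_⟩
    rw [← strand_mark z z' x, ← strand_mark z z' y]
    exact .cross _ _
  · cases h
    exact ⟨[plain, plain], [_], _, rfl, rfl, .merge _ _ _ _⟩
  · rename_i x c
    rw [Option.ite_none_right_eq_some] at h
    obtain ⟨h1, h⟩ := h
    cases h
    refine ⟨[x], [plain, plain], c, rfl, rfl, ?_⟩
    obtain rfl | rfl := h1
    · exact .split _ _ _ _
    · exact .split _ _ _ _
  · cases h

/-- An equivalence between two pictures with given tags. -/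
structure RibbonLemma : Type where
  /-- tags at the bottom -/
  bottom : List Tag
  /-- tags at the top -/
  top : List Tag
  /-- left-hand side -/
  lhs : Word MGen
  /-- right-hand side -/
  rhs : Word MGen
  eqv (z z' : ℤ) : ribbonTheory.Eqv (bottom.map (mark z z')) (top.map (mark z z')) lhs rhs

/-- The checker for numbered matched diagrams up to ribbon moves. -/
def ribbonChecker (z z' : ℤ) : Checker ribbonTheory Tag RibbonRule RibbonLemma where
  mark := mark z z'
  ty := ribbonTy
  prim := RibbonRule.sides
  known x := ((x.bottom, x.top), x.lhs, x.rhs)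
  ty_sound := ribbonTy_sound z z'
  prim_sound c := c.sound
  known_sound x := x.eqv z z'

/-- The computation of a checker does not depend on the marks for which the tags stand. -/
theorem Checker.check_congr {G A B C X : Type} {Θ : Theory G A} [DecidableEq G] [DecidableEq B]
    {K K' : Checker Θ B C X} (h1 : K.ty = K'.ty) (h2 : K.prim = K'.prim) (h3 : K.known = K'.known)
    (a b : List B) (os : List (Op C X)) (w w' : Word G) :
    K.check a b os w w' = K'.check a b os w w' := by
  have e1 : ∀ (w : Word G) (a : List B), K.out a w = K'.out a w := by
    intro w
    induction w with
    | nil => exact fun _ => rfl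
    | cons s w ih => intro a; simp only [out, h1, ih]
  have e2 : ∀ (o : Op C X) (w : Word G), K.step a o w = K'.step a o w := by
    rintro (k | k | k | k | k | k) w
    · rfl
    · rfl
    all_goals simp only [step, room, e1, h2, h3] <;> rfl
  have e3 : ∀ (os : List (Op C X)) (w : Word G), K.run a b os w w' = K'.run a b os w w' := by
    intro os
    induction os with
    | nil => exact fun _ => rfl
    | cons o os ih => intro w; simp only [run, e1, e2, ih]
  simp only [check, e1, e3]

theorem ribbon_eqv {a b : List Tag} {os : List (Op RibbonRule RibbonLemma)} {w w' : Word MGen}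
    (h : (ribbonChecker 0 0).check a b os w w' = true) (z z' : ℤ) :
    ribbonTheory.Eqv (a.map (mark z z')) (b.map (mark z z')) w w' := by
  rw [Checker.check_congr (K := ribbonChecker 0 0) (K' := ribbonChecker z z') rfl rfl rfl] at h
  exact Checker.eqv h

/-- An equivalence that is verified by computation. -/
def ribbonLemma (a b : List Tag) (w w' : Word MGen) (os : List (Op RibbonRule RibbonLemma))
    (h : (ribbonChecker 0 0).check a b os w w' = true) : RibbonLemma :=
  ⟨a, b, w, w', ribbon_eqv h⟩

namespace RibbonLemma

open MGen Strand

/-- A strand moves past an upper vertex from the left. -/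
def crossSplit (s d : Bool) (a : Strand) : RibbonLemma :=
  ribbonLemma [foreign a, inner s d] [plain, plain, foreign a]
    [(0, .cross a (matched s d)), (0, .split true s d)]
    [(1, .split true s d), (0, .cross a unmatched), (1, .cross a unmatched)]
    [.bwd (.M2 unmatched a) 2 1, .bwd (.M2 unmatched a) 3 0, .fwd (.M4 a true s d) 1 0,
     .fwd (.M2 a (matched s d)) 0 0]
    (by revert s d; rcases a with _ | ⟨s, d⟩ <;> [skip; revert s d] <;> decide +kernel)

/-- A strand moves past an upper vertex from the right. -/
def crossSplit' (s d : Bool) (a : Strand) : RibbonLemma :=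
  ribbonLemma [inner s d, foreign a] [foreign a, plain, plain]
    [(0, .cross (matched s d) a), (1, .split true s d)]
    [(0, .split true s d), (1, .cross unmatched a), (0, .cross unmatched a)]
    [.bwd (.M4 a true s d) 0 0]
    (by revert s d; rcases a with _ | ⟨s, d⟩ <;> [skip; revert s d] <;> decide +kernel)

/-- A strand moves past a lower vertex from the right. -/
def mergeCross (s d : Bool) (a : Strand) : RibbonLemma :=
  ribbonLemma [plain, plain, foreign a] [foreign a, inner s d]
    [(0, .merge true s d), (0, .cross (matched s d) a)]
    [(1, .cross unmatched a), (0, .cross unmatched a), (1, .merge true s d)]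
    [.fwd (.turnRight true s d) 0 0, .swapR 3, .swapR 2, .swapR 1,
     .fwd (.cupSlide (matched s (!d)) a) 0 2, .use (crossSplit s (!d) a) 1 2, .swapL 3,
     .bwd (.capSlide unmatched a) 4 0, .bwd (.capSlide unmatched a) 2 1, .swapL 3, .swapL 1,
     .swapL 2, .swapL 0, .swapL 1, .bwd (.turnRight true s d) 2 1]
    (by revert s d; rcases a with _ | ⟨s, d⟩ <;> [skip; revert s d] <;> decide +kernel)

/-- A strand moves past a lower vertex from the left. -/
def mergeCross' (s d : Bool) (a : Strand) : RibbonLemma :=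
  ribbonLemma [foreign a, plain, plain] [inner s d, foreign a]
    [(1, .merge true s d), (0, .cross a (matched s d))]
    [(0, .cross a unmatched), (1, .cross a unmatched), (0, .merge true s d)]
    [.fwd (.turnLeft true s d) 0 1, .swapL 3, .swapL 2, .swapL 1,
     .bwd (.cupSlide (matched s d) a) 0 0, .bwd (.M4 a true s (!d)) 1 1, .swapR 3,
     .fwd (.capSlide unmatched a) 4 1, .fwd (.capSlide unmatched a) 2 2, .swapR 3, .swapR 1,
     .swapR 2, .swapR 0, .swapR 1, .bwd (.turnLeft true s d) 2 0]
    (by revert s d; rcases a with _ | ⟨s, d⟩ <;> [skip; revert s d] <;> decide +kernel)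

/-- A lower vertex moves through a maximum. -/
def mergeCapLeft (s d : Bool) : RibbonLemma :=
  ribbonLemma [plain, plain, outer s (!d)] []
    [(0, .merge true s d), (0, .cap (matched s d))]
    [(2, .split true s (!d)), (1, .cap unmatched), (0, .cap unmatched)]
    [.fwd (.turnRight true s d) 0 0, .swapR 3, .swapR 2, .swapR 1,
     .fwd (.zigzagLeft (matched s (!d))) 0 2]
    (by revert s d; decide +kernel)

def mergeCapRight (s d : Bool) : RibbonLemma :=
  ribbonLemma [outer s (!d), plain, plain] []
    [(1, .merge true s d), (0, .cap (matched s (!d)))]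
    [(0, .split true s (!d)), (1, .cap unmatched), (0, .cap unmatched)]
    [.fwd (.turnLeft true s d) 0 1, .swapL 3, .swapL 2, .swapL 1,
     .fwd (.zigzagRight (matched s (!d))) 0 0]
    (by revert s d; decide +kernel)

/-- An upper vertex moves through a minimum. -/
def cupSplitLeft (s d : Bool) : RibbonLemma :=
  ribbonLemma [] [plain, plain, inner s (!d)]
    [(0, .cup (matched s d)), (0, .split true s d)]
    [(0, .cup unmatched), (1, .cup unmatched), (2, .merge true s (!d))]
    [.bwd (.zigzagLeft unmatched) 2 0, .swapL 1, .bwd (.zigzagLeft unmatched) 4 1, .swapL 3,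
     .swapL 2, .swapL 0, .swapL 1, .bwd (.turnRight true s (!d)) 2 2]
    (by revert s d; decide +kernel)

def cupSplitRight (s d : Bool) : RibbonLemma :=
  ribbonLemma [] [inner s d, plain, plain]
    [(0, .cup (matched s d)), (1, .split true s (!d))]
    [(0, .cup unmatched), (1, .cup unmatched), (0, .merge true s d)]
    [.bwd (.zigzagRight unmatched) 2 2, .swapR 1, .bwd (.zigzagRight unmatched) 4 1, .swapR 3,
     .swapR 2, .swapR 0, .swapR 1, .bwd (.turnLeft true s d) 2 0]
    (by revert s d; decide +kernel)

/-- A hollow lower vertex is a solid one with a twist. -/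
def mergeHollow (s d : Bool) : RibbonLemma :=
  ribbonLemma [plain, plain] [inner s d]
    [(0, .merge false s d)]
    [(0, .cross unmatched unmatched), (0, .merge true s d)]
    [.fwd (.turnLeft false s d) 0 0, .fwd (.M5 s (!d)) 1 1,
     .fwd (.capSlide unmatched unmatched) 2 1, .swapR 3, .fwd (.capSlide unmatched unmatched) 2 2,
     .swapR 1, .swapR 0, .bwd (.turnLeft true s d) 1 0]
    (by revert s d; decide +kernel)

/-- A strand moves past a matched edge. -/
def barCross (s d : Bool) : RibbonLemma :=
  ribbonLemma [plain, plain, plain] [plain, plain, plain]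
    [(0, .cross unmatched unmatched), (1, .cross unmatched unmatched), (0, .merge true s d), (0, .split true s d)]
    [(1, .merge true s d), (1, .split true s d), (0, .cross unmatched unmatched), (1, .cross unmatched unmatched)]
    [.fwd (.turnLeft true s d) 2 0, .swapL 1, .swapL 0, .swapL 2, .swapL 1, .swapL 3,
     .bwd (.capSlide unmatched unmatched) 2 2, .bwd (.capSlide unmatched unmatched) 4 1, .swapL 3,
     .fwd (.M4 unmatched true s (!d)) 1 1, .fwd (.cupSlide (matched s d) unmatched) 0 0, .swapR 1,
     .swapR 2, .swapR 3, .bwd (.turnLeft true s d) 0 1, .bwd (.M2 unmatched unmatched) 3 1,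
     .bwd (.M2 unmatched unmatched) 4 0, .fwd (.M4 unmatched true s d) 2 0,
     .fwd (.M2 unmatched (matched s d)) 1 0]
    (by revert s d; decide +kernel)

/-- A matched edge is rotated by a half turn. -/
def barTurn (s d : Bool) : RibbonLemma :=
  ribbonLemma [plain, plain] [plain, plain]
    [(0, .merge true s d), (0, .split true s d)]
    [(2, .cup unmatched), (3, .cup unmatched), (2, .merge true s (!d)), (2, .split true s (!d)), (1, .cap unmatched), (0, .cap unmatched)]
    [.fwd (.turnRight true s d) 0 0, .swapR 3, .swapR 2, .swapR 1, .use (cupSplitRight s (!d)) 0 2]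
    (by revert s d; decide +kernel)

end RibbonLemma

end GrapheneLink

/-! ### From pictures with boxes to matched diagrams -/

namespace GrapheneLink

open Word BoxGen

/-- Numbered matched diagrams up to graphene moves. -/
def grapheneTheory : Theory MGen Mark := matchedTheory fun v v' => RibbonMove v v' ∨ NonRibbonMove v v'

theorem Theory.Eqv.of_ribbon {a b : List Mark} {w w' : Word MGen} (h : ribbonTheory.Eqv a b w w') :
    grapheneTheory.Eqv a b w w' :=
  Theory.Eqv.mono (Θ := ribbonTheory) (Θ' := grapheneTheory) rfl (fun _ _ => Or.imp_right .inl) h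

/-- The matched word for which a piece stands. -/
def boxPiece : BoxGen → Word MGen
  | link g => matchedPiece g
  | box s d => bar true true s d

/-- `n` unmatched strands. -/
abbrev plainMarks (n : ℕ) : List Mark := List.replicate n .unmatched

theorem reads_boxPiece (g : BoxGen) :
    Reads MarkRule (plainMarks g.src) (boxPiece g) (plainMarks g.tgt) := by
  rcases g with g | ⟨s, d⟩
  · exact reads_crossingReplacement Mark.unmatched (.matched true true 0) .cupUnmatched .capUnmatched
      (.cross .unmatched .unmatched) (.merge _ _ _ _) (.split _ _ _ _) g
  · exact ⟨[], _, _, [], rfl, .merge _ _ _ 0, rfl, [], _, _, [], rfl, .split _ _ _ _, rfl, rfl⟩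

/-- An equivalence of words between unmatched strands, verified by computation. -/
theorem plain_eqv (m n : ℕ) (os : List (Op RibbonRule RibbonLemma)) {w w' : Word MGen}
    (h : (ribbonChecker 0 0).check (List.replicate m .plain) (List.replicate n .plain) os w w' = true) :
    grapheneTheory.Eqv (plainMarks m) (plainMarks n) w w' := by
  simpa [Tag.mark] using (ribbon_eqv h 0 0).of_ribbon

theorem nonRibbon_eqv (m n : ℕ) {w w' : Word MGen} (h : NonRibbonMove w w')
    (h1 : (ribbonChecker 0 0).out (List.replicate m .plain) w = some (List.replicate n .plain))
    (h2 : (ribbonChecker 0 0).out (List.replicate m .plain) w' = some (List.replicate n .plain)) :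
    grapheneTheory.Eqv (plainMarks m) (plainMarks n) w w' := by
  have r1 := Checker.reads_of_out h1
  have r2 := Checker.reads_of_out h2
  simp only [List.map_replicate, ribbonChecker, Tag.mark] at r1 r2
  exact .of_rule (.inr (.inr h)) r1 r2

theorem boxPiece_twist (s d : Bool) : grapheneTheory.Eqv (plainMarks 2) (plainMarks 2)
    (expand boxPiece (BoxRule.twist s d).sides.1) (expand boxPiece (BoxRule.twist s d).sides.2) :=
  (nonRibbon_eqv 2 2 (.G4 true true s d) (by revert s d; decide +kernel)
      (by revert s d; decide +kernel)).trans
    (plain_eqv 2 2 [.use (.mergeHollow s d) 0 0, .fwd (.M5 s d) 2 0] (by revert s d; decide +kernel))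

theorem boxPiece_negate (d : Bool) : grapheneTheory.Eqv (plainMarks 2) (plainMarks 2)
    (expand boxPiece (BoxRule.negate d).sides.1) (expand boxPiece (BoxRule.negate d).sides.2) :=
  (plain_eqv 2 2 [.unuse (.mergeHollow true d) 0 0] (by revert d; decide +kernel)).trans
    (nonRibbon_eqv 2 2 (.G5 d) (by revert d; decide +kernel) (by revert d; decide +kernel))

theorem boxPiece_G3 (s d : Bool) : grapheneTheory.Eqv (plainMarks 3) (plainMarks 3)
    (expand boxPiece (BoxRule.G3 s d).sides.1) (expand boxPiece (BoxRule.G3 s d).sides.2) :=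
  -- the middle strand is moved past the upper vertex of the long matched edge
  (plain_eqv 3 3 [.fwd (.M4 .unmatched true s d) 6 1] (by revert s d; decide +kernel)).trans
    ((nonRibbon_eqv 3 3 (.G3 s d) (by revert s d; decide +kernel)
      (by revert s d; decide +kernel)).trans
    (plain_eqv 3 3 [.bwd (.M4 .unmatched true s d) 6 1] (by revert s d; decide +kernel)))

/-- The numbers of strands at the bottom and the top of a move. -/
def BoxRule.arity : BoxRule → ℕ × ℕ
  | zigzagLeft => (1, 1)
  | zigzagRight => (1, 1)
  | capSlide => (3, 1)
  | cupSlide => (1, 3)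
  | V1 => (1, 1)
  | V2 => (2, 2)
  | V3 => (3, 3)
  | natural _ _ => (3, 3)
  | turn _ _ => (2, 2)
  | twist _ _ => (2, 2)
  | negate _ => (2, 2)
  | crossing _ => (2, 2)
  | G1 _ _ => (2, 0)
  | G2 _ => (2, 2)
  | G3 _ _ => (3, 3)

theorem BoxRule.eqv_boxPiece (c : BoxRule) :
    grapheneTheory.Eqv (plainMarks c.arity.1) (plainMarks c.arity.2)
      (expand boxPiece c.sides.1) (expand boxPiece c.sides.2) := by
  cases c with
  | zigzagLeft => exact plain_eqv 1 1 [.fwd (.zigzagLeft .unmatched) 0 0] (by decide +kernel)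
  | zigzagRight => exact plain_eqv 1 1 [.fwd (.zigzagRight .unmatched) 0 0] (by decide +kernel)
  | capSlide => exact plain_eqv 3 1 [.fwd (.capSlide .unmatched .unmatched) 0 0] (by decide +kernel)
  | cupSlide => exact plain_eqv 1 3 [.fwd (.cupSlide .unmatched .unmatched) 0 0] (by decide +kernel)
  | V1 => exact plain_eqv 1 1 [.fwd (.M1 .unmatched) 0 0] (by decide +kernel)
  | V2 => exact plain_eqv 2 2 [.fwd (.M2 .unmatched .unmatched) 0 0] (by decide +kernel)
  | V3 =>
    exact plain_eqv 3 3 [.fwd (.M3 .unmatched .unmatched .unmatched) 0 0] (by decide +kernel)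
  | natural s d => exact plain_eqv 3 3 [.use (.barCross s d) 0 0] (by revert s d; decide +kernel)
  | turn s d => exact plain_eqv 2 2 [.use (.barTurn s d) 0 0] (by revert s d; decide +kernel)
  | twist s d => exact boxPiece_twist s d
  | negate d => exact boxPiece_negate d
  | crossing b => cases b <;> exact .refl _
  | G1 s d =>
    exact nonRibbon_eqv 2 0 (.G1 s d) (by revert s d; decide +kernel) (by revert s d; decide +kernel)
  | G2 s => exact nonRibbon_eqv 2 2 (.G2 s) (by revert s; decide +kernel) (by revert s; decide +kernel)
  | G3 s d => exact boxPiece_G3 s d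

theorem reads_of_boxChecker {m n : ℕ} {w : Word BoxGen}
    (h : boxChecker.out (units m) w = some (units n)) :
    Reads boxTheory.T (units m) w (units n) := by
  have := Checker.reads_of_out h
  simpa [boxChecker] using this

theorem BoxRule.preserved (c : BoxRule) :
    Theory.Preserved boxTheory grapheneTheory (fun g => units g.src) (fun g => units g.tgt)
      boxPiece (fun _ => .unmatched) c.sides.1 c.sides.2 := by
  refine ⟨units c.arity.1, units c.arity.2, ?_, ?_, ?_, ?_, by simpa using c.eqv_boxPiece⟩
  · cases c <;> first | exact List.cons_ne_nil _ _ | (rename_i b; cases b <;> exact List.cons_ne_nil _ _)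
  · cases c <;> decide +revert +kernel
  · refine reads_of_boxChecker ?_
    cases c <;> decide +revert +kernel
  · refine reads_of_boxChecker ?_
    cases c <;> decide +revert +kernel

/-- Equivalent pictures with boxes stand for equivalent matched words. -/
theorem Theory.Eqv.expand_boxPiece {a b : List Unit} {w w' : Word BoxGen}
    (h : boxTheory.Eqv a b w w') :
    grapheneTheory.Eqv (a.map fun _ => .unmatched) (b.map fun _ => .unmatched)
      (Word.expand boxPiece w) (Word.expand boxPiece w') := by
  refine Theory.Eqv.expand (src := fun g => units g.src) (tgt := fun g => units g.tgt)
    (fun g x y h => h) ?_ ?_ h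
  · rintro g x y ⟨rfl, rfl⟩
    have := reads_boxPiece g
    simp only [List.map_replicate]
    exact this
  · rintro v v' (h | ⟨c, h⟩)
    · exact .inl h
    · have := c.preserved
      rw [h] at this
      exact .inr this

theorem expand_boxPiece_boxWord (w : Word VGen) : expand boxPiece (boxWord w) = matchedWord w := by
  induction w with
  | nil => rfl
  | cons s w ih =>
    have : matchedWord (s :: w) = shift s.1 (matchedPiece s.2) ++ matchedWord w := rfl
    rw [this, ← ih]
    simp [boxWord, boxPiece]

/-- Virtual Reidemeister moves become graphene moves. -/
theorem Theory.Eqv.matchedWord {a b : List Unit} {w w' : Word VGen}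
    (h : reidemeisterTheory.Eqv a b w w') :
    grapheneTheory.Eqv (a.map fun _ => .unmatched) (b.map fun _ => .unmatched)
      (GrapheneLink.matchedWord w) (GrapheneLink.matchedWord w') := by
  simpa only [expand_boxPiece_boxWord] using h.boxWord_of_reidemeister.expand_boxPiece

end GrapheneLink

/-! ### Numbered words and matched diagrams -/

namespace GrapheneLink

open Word

/-- The mark of a strand with a number. -/
def Strand.toMark : Strand → ℕ → Mark
  | unmatched, _ => .unmatched
  | matched s d, n => .matched s d n

/-- The number of a strand, increased by `k`. -/
def Mark.number (k : ℤ) : Mark → ℕ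
  | unmatched => 0
  | matched _ _ z => (z + k).toNat

theorem numberingRule_length {g : MGen} {x y : List ℕ} (h : MGen.NumberingRule g x y) :
    x.length = g.src.length ∧ y.length = g.tgt.length := by
  cases h <;> exact ⟨rfl, rfl⟩

theorem markRule_toMark {g : MGen} {x y : List ℕ} (h : MGen.NumberingRule g x y) :
    MarkRule g (List.zipWith Strand.toMark g.src x) (List.zipWith Strand.toMark g.tgt y) := by
  cases h with
  | cupUnmatched => exact .cupUnmatched
  | capUnmatched => exact .capUnmatched
  | cupTrue s x y h => exact .cupMatched s true x y (by simpa [Grows] using h)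
  | cupFalse s x y h => exact .cupMatched s false x y (by simpa [Grows] using h)
  | capTrue s x y h => exact .capMatched s true x y (by simpa [Grows] using h)
  | capFalse s x y h => exact .capMatched s false x y (by simpa [Grows] using h)
  | cross a b x y =>
    have h : ∀ (a : Strand) (x : ℕ), (a.toMark x).strand = a := by
      rintro (_ | _) x <;> rfl
    have := MarkRule.cross (a.toMark x) (b.toMark y)
    rwa [h, h] at this
  | merge c s d x y z => exact .merge c s d z
  | split c s d x y z => exact .split c s d z

theorem reads_toMark {w : Word MGen} : ∀ {a b : List Strand} {n m : List ℕ}, a.length = n.length →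
    Reads MGen.Rule a w b → Reads MGen.NumberingRule n w m →
      Reads MarkRule (List.zipWith Strand.toMark a n) w (List.zipWith Strand.toMark b m) := by
  induction w with
  | nil => rintro a b n m - rfl rfl; rfl
  | cons s w ih =>
    obtain ⟨i, g⟩ := s
    rintro a b n m hl ⟨l, x, y, r, h1, ⟨rfl, rfl⟩, rfl, h4⟩ ⟨l', x', y', r', h1', h2', rfl, h4'⟩
    have e := numberingRule_length h2'
    have e' : l.length = l'.length := h1.trans h1'.symm
    have e'' : r.length = r'.length := by simp at hl; omega
    refine ⟨List.zipWith Strand.toMark l l', _, _, List.zipWith Strand.toMark r r', ?_,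
      markRule_toMark h2', ?_, ?_⟩
    · simp; omega
    · rw [List.zipWith_append (by simp; omega), List.zipWith_append e']
    · rw [← List.zipWith_append e', ← List.zipWith_append (by simp; omega)]
      exact ih (by simp; omega) h4 h4'

/-- Every matched diagram can be numbered. -/
theorem MatchedDiagram.reads_markRule (D : MatchedDiagram) : Reads MarkRule [] D.word [] :=
  reads_toMark rfl D.closed D.noMatchedLoop

theorem numberingRule_number {g : MGen} {x y : List Mark} (h : MarkRule g x y) :
    ∃ K : ℤ, ∀ k ≥ K,
      MGen.NumberingRule g (x.map (Mark.number k)) (y.map (Mark.number k)) := by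
  cases h with
  | cupUnmatched => exact ⟨0, fun _ _ => .cupUnmatched _ _⟩
  | capUnmatched => exact ⟨0, fun _ _ => .capUnmatched _ _⟩
  | cupMatched s d x y h =>
    refine ⟨max (1 - x) (1 - y), fun k hk => ?_⟩
    cases d
    · exact .cupFalse s _ _ (by simp [Grows, Mark.number] at h hk ⊢; omega)
    · exact .cupTrue s _ _ (by simp [Grows, Mark.number] at h hk ⊢; omega)
  | capMatched s d x y h =>
    refine ⟨max (1 - x) (1 - y), fun k hk => ?_⟩
    cases d
    · exact .capFalse s _ _ (by simp [Grows, Mark.number] at h hk ⊢; omega)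
    · exact .capTrue s _ _ (by simp [Grows, Mark.number] at h hk ⊢; omega)
  | cross x y => exact ⟨0, fun _ _ => .cross _ _ _ _⟩
  | merge c s d z => exact ⟨0, fun _ _ => .merge _ _ _ _ _ _⟩
  | split c s d z => exact ⟨0, fun _ _ => .split _ _ _ _ _ _⟩

theorem reads_number {w : Word MGen} : ∀ {a b : List Mark}, Reads MarkRule a w b →
    ∃ K : ℤ, ∀ k ≥ K,
      Reads MGen.NumberingRule (a.map (Mark.number k)) w (b.map (Mark.number k)) := by
  induction w with
  | nil => rintro a b rfl; exact ⟨0, fun _ _ => rfl⟩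
  | cons s w ih =>
    obtain ⟨i, g⟩ := s
    rintro a b ⟨l, x, y, r, h1, h2, rfl, h4⟩
    obtain ⟨K, hK⟩ := ih h4
    obtain ⟨K', hK'⟩ := numberingRule_number h2
    refine ⟨max K K', fun k hk => ?_⟩
    exact ⟨l.map (Mark.number k), _, _, r.map (Mark.number k), by simpa using h1,
      hK' k ((le_max_right _ _).trans hk), by simp,
      by simpa using hK k ((le_max_left _ _).trans hk)⟩

/-- The matched diagram of a closed numbered word. -/
def MatchedDiagram.ofReads (w : Word MGen) (h : Reads MarkRule [] w []) : MatchedDiagram where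
  word := w
  closed := by simpa using h.map Mark.strand fun _ _ _ h => MarkRule.rule h
  noMatchedLoop := by
    obtain ⟨K, hK⟩ := reads_number h
    simpa using hK K le_rfl

theorem MatchedDiagram.eqvGen_of_eqv {E : Word MGen → Word MGen → Prop} {w w' : Word MGen}
    (h : (matchedTheory E).Eqv [] [] w w') :
    ∀ D D' : MatchedDiagram, D.word = w → D'.word = w' →
      Relation.EqvGen (fun D D' : MatchedDiagram =>
        Step (fun v v' => MatchedIsotopy v v' ∨ E v v') D.word D'.word) D D' := by
  induction h with
  | rel w w' h =>
    rintro D D' rfl rfl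
    exact Relation.EqvGen.rel _ _ h.1
  | refl w =>
    rintro ⟨w, h1, h2⟩ ⟨w', h1', h2'⟩ rfl rfl
    exact Relation.EqvGen.refl _
  | symm w w' _ ih => exact fun D D' h h' => Relation.EqvGen.symm _ _ (ih D' D h' h)
  | trans w w' w'' h h' ih ih' =>
    rintro D D' rfl rfl
    let M := MatchedDiagram.ofReads w'
      (Theory.Eqv.reads (Θ := matchedTheory E) h D.reads_markRule)
    exact Relation.EqvGen.trans _ _ _ (ih D M rfl rfl) (ih' M D' rfl rfl)

theorem MatchedDiagram.equivalent_of_eqv {D D' : MatchedDiagram}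
    (h : grapheneTheory.Eqv [] [] D.word D'.word) : D.Equivalent D' :=
  MatchedDiagram.eqvGen_of_eqv h D D' rfl rfl

theorem MatchedDiagram.ribbonEquivalent_of_eqv {D D' : MatchedDiagram}
    (h : ribbonTheory.Eqv [] [] D.word D'.word) : D.RibbonEquivalent D' :=
  MatchedDiagram.eqvGen_of_eqv h D D' rfl rfl

theorem VirtualDiagram.Move.eqv {L L' : VirtualDiagram} (h : L.Move L') :
    reidemeisterTheory.Eqv [] [] L.word L'.word := by
  refine .of_step (h.mono ?_) L.closed L'.closed
  rintro v v' (h | h)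
  · exact .inl h
  · exact .inr (.inr h)

/-- Equivalent virtual link diagrams have equivalent matched diagrams. -/
theorem VirtualDiagram.Equivalent.toMatched {L L' : VirtualDiagram} (h : L.Equivalent L') :
    L.toMatched.Equivalent L'.toMatched := by
  induction h with
  | rel L L' h => exact MatchedDiagram.equivalent_of_eqv h.eqv.matchedWord
  | refl => exact Relation.EqvGen.refl _
  | symm _ _ _ ih => exact Relation.EqvGen.symm _ _ ih
  | trans _ _ _ _ _ ih ih' => exact Relation.EqvGen.trans _ _ _ ih ih'

end GrapheneLink

/-! ### Contracting matched edges -/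

namespace GrapheneLink

open Word

/-- Elementary pieces of matched diagrams with solid vertices, in which some matched edges have been
contracted to vertical boxes without further pieces at their height. -/
inductive EdgeGen : Type
  | cup (a : Strand)
  | cap (a : Strand)
  | cross (a b : Strand)
  | merge (s d : Bool)
  | split (s d : Bool)
  | box (s d : Bool)

/-- The matched word for which a piece stands. -/
def edgePiece : EdgeGen → Word MGen
  | .cup a => [(0, .cup a)]
  | .cap a => [(0, .cap a)]
  | .cross a b => [(0, .cross a b)]
  | .merge s d => [(0, .merge true s d)]
  | .split s d => [(0, .split true s d)]
  | .box s d => bar true true s d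

/-- The marks at a piece. -/
inductive EdgeRule : EdgeGen → List Mark → List Mark → Prop
  | cupUnmatched : EdgeRule (.cup .unmatched) [] [.unmatched, .unmatched]
  | capUnmatched : EdgeRule (.cap .unmatched) [.unmatched, .unmatched] []
  | cupMatched (s d : Bool) (x y : ℤ) (h : Grows d y x) :
      EdgeRule (.cup (.matched s d)) [] [.matched s d x, .matched s (!d) y]
  | capMatched (s d : Bool) (x y : ℤ) (h : Grows d x y) :
      EdgeRule (.cap (.matched s d)) [.matched s d x, .matched s (!d) y] []
  | cross (x y : Mark) : EdgeRule (.cross x.strand y.strand) [x, y] [y, x]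
  | merge (s d : Bool) (z : ℤ) : EdgeRule (.merge s d) [.unmatched, .unmatched] [.matched s d z]
  | split (s d : Bool) (z : ℤ) : EdgeRule (.split s d) [.matched s d z] [.unmatched, .unmatched]
  | box (s d : Bool) : EdgeRule (.box s d) [.unmatched, .unmatched] [.unmatched, .unmatched]

theorem reads_of_markRule {g : MGen} {x y : List Mark} (h : MarkRule g x y) :
    Reads MarkRule x [(0, g)] y :=
  ⟨[], x, y, [], rfl, h, (List.append_nil x).symm, List.append_nil y⟩

theorem EdgeRule.reads {g : EdgeGen} {x y : List Mark} (h : EdgeRule g x y) :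
    Reads MarkRule x (edgePiece g) y := by
  cases h with
  | cupUnmatched => exact reads_of_markRule .cupUnmatched
  | capUnmatched => exact reads_of_markRule .capUnmatched
  | cupMatched s d x y h => exact reads_of_markRule (.cupMatched s d x y h)
  | capMatched s d x y h => exact reads_of_markRule (.capMatched s d x y h)
  | cross x y => exact reads_of_markRule (.cross x y)
  | merge s d z => exact reads_of_markRule (.merge true s d z)
  | split s d z => exact reads_of_markRule (.split true s d z)
  | box s d => exact (reads_boxPiece (.box s d))

theorem reads_edgeWord {w : Word EdgeGen} {a b : List Mark} (h : Reads EdgeRule a w b) :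
    Reads MarkRule a (expand edgePiece w) b := by
  simpa using h.expand (φ := id) (T' := MarkRule) (f := edgePiece)
    (fun g x y h => by simpa using h.reads)

/-- The matched words for which two pictures stand are related by ribbon moves. -/
def EdgeEqv (a b : List Mark) (w w' : Word EdgeGen) : Prop :=
  ribbonTheory.Eqv a b (expand edgePiece w) (expand edgePiece w')

namespace EdgeEqv

variable {a b c : List Mark} {w w' w'' v : Word EdgeGen}

theorem trans (h : EdgeEqv a b w w') (h' : EdgeEqv a b w' w'') : EdgeEqv a b w w'' :=
  Theory.Eqv.trans h h'

theorem symm (h : EdgeEqv a b w w') : EdgeEqv a b w' w := Theory.Eqv.symm h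

theorem append_left (hv : Reads EdgeRule c v a) (h : EdgeEqv a b w w') :
    EdgeEqv c b (v ++ w) (v ++ w') := by
  simpa [EdgeEqv] using Theory.Eqv.append_left (Θ := ribbonTheory) (reads_edgeWord hv) h

theorem append_right (hv : Reads EdgeRule b v c) (h : EdgeEqv a b w w') :
    EdgeEqv a c (w ++ v) (w' ++ v) := by
  simpa [EdgeEqv] using Theory.Eqv.append_right (Θ := ribbonTheory) (reads_edgeWord hv) h

theorem whisker (l r : List Mark) (h : EdgeEqv a b w w') :
    EdgeEqv (l ++ a ++ r) (l ++ b ++ r) (shift l.length w) (shift l.length w') := by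
  simpa [EdgeEqv] using Theory.Eqv.whisker (Θ := ribbonTheory) l r h

theorem swap {g h : EdgeGen} {x y x' y' : List Mark} (hg : EdgeRule g x y) (hh : EdgeRule h x' y')
    (l m r : List Mark) : EdgeEqv (l ++ x ++ m ++ x' ++ r) (l ++ y ++ m ++ y' ++ r)
      [(l.length, g), (l.length + y.length + m.length, h)]
      [(l.length + x.length + m.length, h), (l.length, g)] := by
  have := Theory.Eqv.swap_word_word (Θ := ribbonTheory) m r hh.reads hg.reads
  simpa [EdgeEqv, Nat.add_assoc] using this.whisker l []

end EdgeEqv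

/-- A weight that bounds the number of steps in which the remaining vertices can be moved along their
matched edges. -/
def EdgeGen.weight : EdgeGen → ℕ
  | cup .unmatched => 0
  | cup (.matched _ _) => 1
  | cap .unmatched => 0
  | cap (.matched _ _) => 1
  | cross .unmatched .unmatched => 0
  | cross (.matched _ _) (.matched _ _) => 3
  | cross _ _ => 1
  | merge _ _ => 1
  | split _ _ => 1
  | box _ _ => 0

/-- The sum of the weights of the pieces. -/
def edgeWeight (w : Word EdgeGen) : ℕ := (w.map fun p => p.2.weight).sum

@[simp] theorem edgeWeight_nil : edgeWeight [] = 0 := rfl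

@[simp] theorem edgeWeight_cons (i : ℕ) (g : EdgeGen) (w : Word EdgeGen) :
    edgeWeight ((i, g) :: w) = g.weight + edgeWeight w := by
  simp [edgeWeight]

@[simp] theorem edgeWeight_append (v w : Word EdgeGen) :
    edgeWeight (v ++ w) = edgeWeight v + edgeWeight w := by
  simp [edgeWeight]

@[simp] theorem edgeWeight_shift (n : ℕ) (w : Word EdgeGen) :
    edgeWeight (shift n w) = edgeWeight w := by
  induction w with
  | nil => rfl
  | cons s w ih => obtain ⟨i, g⟩ := s; simp [ih]

/-- A distinguished entry of a list lies to the right of a given segment, to its left, or in it. -/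
theorem segment_cases {A : Type} {l r l' x r' : List A} {m : A}
    (h : l ++ [m] ++ r = l' ++ x ++ r') :
    (∃ t, l = l' ++ x ++ t ∧ r' = t ++ [m] ++ r) ∨
      (∃ t, l' = l ++ [m] ++ t ∧ r = t ++ x ++ r') ∨
        ∃ x₁ x₂, x = x₁ ++ [m] ++ x₂ ∧ l = l' ++ x₁ ∧ r = x₂ ++ r' := by
  induction l' generalizing l with
  | nil =>
    obtain ⟨t, h1, h2⟩ | ⟨t, h1, h2⟩ := List.append_eq_append_iff.1 h
    · exact .inr (.inr ⟨l, t, h1, rfl, h2⟩)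
    · obtain rfl | ⟨t, n, rfl⟩ := List.eq_nil_or_concat t
      · exact .inr (.inr ⟨l, [], by simpa using h1.symm, rfl, by simpa using h2.symm⟩)
      · rw [List.concat_eq_append, ← List.append_assoc] at h1
        obtain ⟨rfl, h1⟩ := List.append_inj' h1 rfl
        obtain rfl : m = n := by simpa using h1
        exact .inl ⟨t, rfl, by simpa using h2⟩
  | cons k l' ih =>
    obtain _ | ⟨n, l⟩ := l
    · simp only [List.nil_append, List.cons_append, List.cons.injEq] at h
      obtain ⟨rfl, rfl⟩ := h
      exact .inr (.inl ⟨l', rfl, rfl⟩)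
    · simp only [List.cons_append, List.cons.injEq] at h
      obtain ⟨rfl, h⟩ := h
      obtain ⟨t, rfl, e⟩ | ⟨t, rfl, e⟩ | ⟨x₁, x₂, h1, rfl, e⟩ := ih h
      · exact .inl ⟨t, rfl, e⟩
      · exact .inr (.inl ⟨t, rfl, e⟩)
      · exact .inr (.inr ⟨x₁, x₂, h1, rfl, e⟩)

/-- The mark of a foreign strand is arbitrary. -/
theorem Tag.exists_mark_foreign (x : Mark) : ∃ z', ∀ z, mark z z' (foreign x.strand) = x := by
  obtain _ | ⟨s, d, z'⟩ := x
  · exact ⟨0, fun _ => rfl⟩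
  · exact ⟨z', fun _ => rfl⟩

/-- The mark of an inner strand is arbitrary. -/
theorem Tag.exists_mark_inner (s d : Bool) (x : ℤ) :
    ∃ z, ∀ z', mark z z' (inner s d) = .matched s d x :=
  ⟨x - if d then 2 else 1, fun z' => by simp [mark]⟩

/-- The mark of an outer strand is arbitrary. -/
theorem Tag.exists_mark_outer (s d : Bool) (x : ℤ) :
    ∃ z, ∀ z', mark z z' (outer s d) = .matched s d x :=
  ⟨x - if d then 0 else 3, fun z' => by simp [mark]⟩

/-- One step of the contraction of a matched edge from below: the word `v`, which contains a lower
vertex and the next piece at the matched edge, is replaced by a word of smaller weight. -/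
theorem exists_of_merge_step (s d : Bool) (z : ℤ) {h : EdgeGen} {x₁ x₂ y : List Mark}
    (hh : EdgeRule h (x₁ ++ [.matched s d z] ++ x₂) y) :
    ∃ v, Reads EdgeRule (x₁ ++ [.unmatched, .unmatched] ++ x₂) v y ∧
      EdgeEqv (x₁ ++ [.unmatched, .unmatched] ++ x₂) y [(x₁.length, .merge s d), (0, h)] v ∧
      edgeWeight v < h.weight + 1 := by
  generalize hx : x₁ ++ [Mark.matched s d z] ++ x₂ = x at hh
  cases hh with
  | cupUnmatched => simp at hx
  | cupMatched => simp at hx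
  | capUnmatched => 
    obtain _ | ⟨_, _ | ⟨_, _ | _⟩⟩ := x₁ <;> simp at hx
  | merge => 
    obtain _ | ⟨_, _ | ⟨_, _ | _⟩⟩ := x₁ <;> simp at hx
  | box => 
    obtain _ | ⟨_, _ | ⟨_, _ | _⟩⟩ := x₁ <;> simp at hx
  | split s' d' z' => 
    obtain _ | ⟨_, _ | _⟩ := x₁ <;> simp at hx
    obtain ⟨⟨rfl, rfl, rfl⟩, rfl⟩ := hx
    exact ⟨[(0, .box s d)], ⟨[], _, _, [], rfl, .box s d, rfl, rfl⟩, .refl _, by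
      simp [EdgeGen.weight]⟩
  | capMatched s' d' x y hxy =>
    obtain _ | ⟨_, _ | ⟨_, _ | _⟩⟩ := x₁ <;> simp at hx
    · obtain ⟨⟨rfl, rfl, rfl⟩, rfl⟩ := hx
      obtain ⟨z', e⟩ := Tag.exists_mark_outer s (!d) y
      have := (RibbonLemma.mergeCapLeft s d).eqv z' 0
      refine ⟨[(2, .split s (!d)), (1, .cap .unmatched), (0, .cap .unmatched)], ?_, ?_, ?_⟩
      · exact ⟨[_, _], _, _, [], rfl, .split _ _ _, rfl, [_], _, _, [_], rfl, .capUnmatched, rfl,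
          [], _, _, [], rfl, .capUnmatched, rfl, rfl⟩
      · rw [← e 0]
        exact this
      · simp [EdgeGen.weight]
    · obtain ⟨rfl, ⟨rfl, rfl, rfl⟩, rfl⟩ := hx
      obtain ⟨z', e⟩ := Tag.exists_mark_outer s d' x
      have := (RibbonLemma.mergeCapRight s (!d')).eqv z' 0
      simp only [RibbonLemma.mergeCapRight, ribbonLemma, Bool.not_not] at this
      refine ⟨[(0, .split s d'), (1, .cap .unmatched), (0, .cap .unmatched)], ?_, ?_, ?_⟩
      · exact ⟨[], _, _, [_, _], rfl, .split _ _ _, rfl, [_], _, _, [_], rfl, .capUnmatched, rfl,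
          [], _, _, [], rfl, .capUnmatched, rfl, rfl⟩
      · rw [← e 0]
        exact this
      · simp [EdgeGen.weight]
  | cross x y =>
    obtain _ | ⟨n, _ | ⟨_, _ | _⟩⟩ := x₁ <;> simp at hx
    · obtain ⟨rfl, rfl⟩ := hx
      obtain ⟨z₁, e₁⟩ := Tag.exists_mark_inner s d z
      obtain ⟨z₂, e₂⟩ := Tag.exists_mark_foreign y
      have := (RibbonLemma.mergeCross s d y.strand).eqv z₁ z₂
      refine ⟨[(1, .cross .unmatched y.strand), (0, .cross .unmatched y.strand), (1, .merge s d)],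
        ?_, ?_, ?_⟩
      · exact ⟨[_], _, _, [], rfl, .cross .unmatched y, rfl, [], _, _, [_], rfl,
          .cross .unmatched y, rfl, [_], _, _, [], rfl, .merge _ _ _, rfl, rfl⟩
      · simp only [RibbonLemma.mergeCross, ribbonLemma, List.map_cons, e₁, e₂] at this
        exact this
      · obtain _ | _ := y <;> simp [EdgeGen.weight, Mark.strand]
    · obtain ⟨rfl, rfl, rfl⟩ := hx
      obtain ⟨z₁, e₁⟩ := Tag.exists_mark_inner s d z
      obtain ⟨z₂, e₂⟩ := Tag.exists_mark_foreign n
      have := (RibbonLemma.mergeCross' s d n.strand).eqv z₁ z₂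
      refine ⟨[(0, .cross n.strand .unmatched), (1, .cross n.strand .unmatched), (0, .merge s d)],
        ?_, ?_, ?_⟩
      · exact ⟨[], _, _, [_], rfl, .cross n .unmatched, rfl, [_], _, _, [], rfl,
          .cross n .unmatched, rfl, [], _, _, [_], rfl, .merge _ _ _, rfl, rfl⟩
      · simp only [RibbonLemma.mergeCross', ribbonLemma, List.map_cons, e₁, e₂] at this
        exact this
      · obtain _ | _ := n <;> simp [EdgeGen.weight, Mark.strand]

/-- One step of the contraction of a matched edge from above. -/
theorem exists_of_split_step (s d : Bool) (z : ℤ) {h : EdgeGen} {x y₁ y₂ : List Mark}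
    (hh : EdgeRule h x (y₁ ++ [.matched s d z] ++ y₂)) :
    ∃ v, Reads EdgeRule x v (y₁ ++ [.unmatched, .unmatched] ++ y₂) ∧
      EdgeEqv x (y₁ ++ [.unmatched, .unmatched] ++ y₂) [(0, h), (y₁.length, .split s d)] v ∧
      edgeWeight v < h.weight + 1 := by
  generalize hy : y₁ ++ [Mark.matched s d z] ++ y₂ = y at hh
  cases hh with
  | capUnmatched => simp at hy
  | capMatched => simp at hy
  | cupUnmatched => 
    obtain _ | ⟨_, _ | ⟨_, _ | _⟩⟩ := y₁ <;> simp at hy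
  | split => 
    obtain _ | ⟨_, _ | ⟨_, _ | _⟩⟩ := y₁ <;> simp at hy
  | box => 
    obtain _ | ⟨_, _ | ⟨_, _ | _⟩⟩ := y₁ <;> simp at hy
  | merge s' d' z' => 
    obtain _ | ⟨_, _ | _⟩ := y₁ <;> simp at hy
    obtain ⟨⟨rfl, rfl, rfl⟩, rfl⟩ := hy
    exact ⟨[(0, .box s d)], ⟨[], _, _, [], rfl, .box s d, rfl, rfl⟩, .refl _, by
      simp [EdgeGen.weight]⟩
  | cupMatched s' d' x y hxy =>
    obtain _ | ⟨_, _ | ⟨_, _ | _⟩⟩ := y₁ <;> simp at hy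
    · obtain ⟨⟨rfl, rfl, rfl⟩, rfl⟩ := hy
      obtain ⟨z', e⟩ := Tag.exists_mark_inner s (!d) y
      have := (RibbonLemma.cupSplitLeft s d).eqv z' 0
      refine ⟨[(0, .cup .unmatched), (1, .cup .unmatched), (2, .merge s (!d))], ?_, ?_, ?_⟩
      · exact ⟨[], _, _, [], rfl, .cupUnmatched, rfl, [_], _, _, [_], rfl, .cupUnmatched, rfl,
          [_, _], _, _, [], rfl, .merge _ _ y, rfl, rfl⟩
      · rw [← e 0]
        exact this
      · simp [EdgeGen.weight]
    · obtain ⟨rfl, ⟨rfl, rfl, rfl⟩, rfl⟩ := hy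
      obtain ⟨z', e⟩ := Tag.exists_mark_inner s d' x
      have := (RibbonLemma.cupSplitRight s d').eqv z' 0
      refine ⟨[(0, .cup .unmatched), (1, .cup .unmatched), (0, .merge s d')], ?_, ?_, ?_⟩
      · exact ⟨[], _, _, [], rfl, .cupUnmatched, rfl, [_], _, _, [_], rfl, .cupUnmatched, rfl,
          [], _, _, [_, _], rfl, .merge _ _ x, rfl, rfl⟩
      · rw [← e 0]
        exact this
      · simp [EdgeGen.weight]
  | cross x y =>
    obtain _ | ⟨n, _ | ⟨_, _ | _⟩⟩ := y₁ <;> simp at hy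
    · obtain ⟨rfl, rfl⟩ := hy
      obtain ⟨z₁, e₁⟩ := Tag.exists_mark_inner s d z
      obtain ⟨z₂, e₂⟩ := Tag.exists_mark_foreign x
      have := (RibbonLemma.crossSplit s d x.strand).eqv z₁ z₂
      refine ⟨[(1, .split s d), (0, .cross x.strand .unmatched), (1, .cross x.strand .unmatched)],
        ?_, ?_, ?_⟩
      · exact ⟨[_], _, _, [], rfl, .split _ _ _, rfl, [], _, _, [_], rfl, .cross x .unmatched, rfl,
          [_], _, _, [], rfl, .cross x .unmatched, rfl, rfl⟩
      · simp only [RibbonLemma.crossSplit, ribbonLemma, List.map_cons, e₁, e₂] at this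
        exact this
      · obtain _ | _ := x <;> simp [EdgeGen.weight, Mark.strand]
    · obtain ⟨rfl, rfl, rfl⟩ := hy
      obtain ⟨z₁, e₁⟩ := Tag.exists_mark_inner s d z
      obtain ⟨z₂, e₂⟩ := Tag.exists_mark_foreign n
      have := (RibbonLemma.crossSplit' s d n.strand).eqv z₁ z₂
      refine ⟨[(0, .split s d), (1, .cross .unmatched n.strand), (0, .cross .unmatched n.strand)],
        ?_, ?_, ?_⟩
      · exact ⟨[], _, _, [_], rfl, .split _ _ _, rfl, [_], _, _, [], rfl, .cross .unmatched n, rfl,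
          [], _, _, [_], rfl, .cross .unmatched n, rfl, rfl⟩
      · simp only [RibbonLemma.crossSplit', ribbonLemma, List.map_cons, e₁, e₂] at this
        exact this
      · obtain _ | _ := n <;> simp [EdgeGen.weight, Mark.strand]

end GrapheneLink

/-! ### Every matched diagram consists of boxes -/

namespace GrapheneLink

open Word

/-- A lower vertex moves up along its matched edge until the edge is a box or the weight of the word
drops. -/
theorem exists_of_merge (s d : Bool) {q : Word EdgeGen} : ∀ {l r : List Mark} {z : ℤ},
    Reads EdgeRule (l ++ [.matched s d z] ++ r) q [] →
      ∃ w, Reads EdgeRule (l ++ [.unmatched, .unmatched] ++ r) w [] ∧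
        EdgeEqv (l ++ [.unmatched, .unmatched] ++ r) [] ((l.length, .merge s d) :: q) w ∧
        edgeWeight w < edgeWeight q + 1 := by
  induction q with
  | nil => intro l r z h; simp [Reads] at h
  | cons p q ih =>
    obtain ⟨j, h⟩ := p
    rintro l r z ⟨l', x, y, r', rfl, hh, e, hq⟩
    obtain ⟨t, rfl, rfl⟩ | ⟨t, rfl, rfl⟩ | ⟨x₁, x₂, rfl, rfl, rfl⟩ := segment_cases e
    · obtain ⟨w, h1, h2, h3⟩ := ih (l := l' ++ y ++ t) (r := r) (z := z) (by simpa using hq)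
      have h4 := EdgeEqv.swap hh (.merge s d z) l' t r
      refine ⟨(l'.length, h) :: w, ⟨l', x, y, t ++ [.unmatched, .unmatched] ++ r, rfl, hh,
        by simp, by simpa using h1⟩, ?_, by simp; omega⟩
      have h5 := h4.symm.append_right (v := q) (c := []) (by simpa using hq)
      have h6 := h2.append_left (v := [(l'.length, h)])
        (c := l' ++ x ++ t ++ [.unmatched, .unmatched] ++ r)
        ⟨l', x, y, t ++ [.unmatched, .unmatched] ++ r, rfl, hh, by simp, by simp [Reads]⟩
      refine EdgeEqv.trans ?_ h6
      simpa [Nat.add_assoc] using h5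
    · obtain ⟨w, h1, h2, h3⟩ := ih (l := l) (r := t ++ y ++ r') (z := z) (by simpa using hq)
      have h4 := EdgeEqv.swap (.merge s d z) hh l t r'
      refine ⟨((l ++ [Mark.unmatched, .unmatched] ++ t).length, h) :: w,
        ⟨l ++ [.unmatched, .unmatched] ++ t, x, y, r', rfl, hh,
        by simp, by simpa using h1⟩, ?_, by simp; omega⟩
      have h5 := h4.append_right (v := q) (c := []) (by simpa using hq)
      have h6 := h2.append_left (v := [((l ++ [Mark.unmatched, .unmatched] ++ t).length, h)])
        (c := l ++ [Mark.unmatched, .unmatched] ++ (t ++ x ++ r'))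
        ⟨l ++ [.unmatched, .unmatched] ++ t, x, y, r', rfl, hh, by simp, by simp [Reads]⟩
      refine EdgeEqv.trans ?_ h6
      simpa [Nat.add_assoc, Nat.add_comm 1, Nat.add_comm 2] using h5
    · obtain ⟨v, h1, h2, h3⟩ := exists_of_merge_step s d z hh
      refine ⟨shift l'.length v ++ q, ?_, ?_, by simp; omega⟩
      · have := (h1.whisker l' r').append hq
        simpa using this
      · have := (h2.whisker l' r').append_right hq
        simpa using this

/-- An upper vertex moves down along its matched edge until the edge is a box or the weight of the
word drops. -/
theorem exists_of_split (s d : Bool) (p : Word EdgeGen) : ∀ {l r : List Mark} {z : ℤ},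
    Reads EdgeRule [] p (l ++ [.matched s d z] ++ r) →
      ∃ w, Reads EdgeRule [] w (l ++ [.unmatched, .unmatched] ++ r) ∧
        EdgeEqv [] (l ++ [.unmatched, .unmatched] ++ r) (p ++ [(l.length, .split s d)]) w ∧
        edgeWeight w < edgeWeight p + 1 := by
  induction p using List.reverseRecOn with
  | nil => intro l r z h; simp [Reads] at h
  | append_singleton p g ih =>
    obtain ⟨j, h⟩ := g
    intro l r z hr
    obtain ⟨m, hp, hr⟩ := reads_append.1 hr
    obtain ⟨l', x, y, r', rfl, hh, rfl, e⟩ := reads_piece.1 hr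
    obtain ⟨t, rfl, rfl⟩ | ⟨t, rfl, rfl⟩ | ⟨x₁, x₂, rfl, rfl, rfl⟩ := segment_cases e
    · obtain ⟨w, h1, h2, h3⟩ := ih (l := l' ++ x ++ t) (r := r) (z := z) (by simpa using hp)
      have h4 := EdgeEqv.swap hh (.split s d z) l' t r
      refine ⟨w ++ [(l'.length, h)], h1.append ?_, ?_, by simp; omega⟩
      · exact ⟨l', x, y, t ++ [.unmatched, .unmatched] ++ r, rfl, hh, by simp, by simp [Reads]⟩
      have h5 := h4.append_left (v := p) (c := []) (by simpa using hp)
      have h6 := h2.append_right (v := [(l'.length, h)])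
        (c := l' ++ y ++ t ++ [.unmatched, .unmatched] ++ r)
        ⟨l', x, y, t ++ [.unmatched, .unmatched] ++ r, rfl, hh, by simp, by simp [Reads]⟩
      refine EdgeEqv.trans ?_ h6
      simpa [Nat.add_assoc] using h5
    · obtain ⟨w, h1, h2, h3⟩ := ih (l := l) (r := t ++ x ++ r') (z := z) (by simpa using hp)
      have h4 := EdgeEqv.swap (.split s d z) hh l t r'
      refine ⟨w ++ [((l ++ [Mark.unmatched, .unmatched] ++ t).length, h)], h1.append ?_, ?_,
        by simp; omega⟩
      · exact ⟨l ++ [.unmatched, .unmatched] ++ t, x, y, r', rfl, hh, by simp, by simp [Reads]⟩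
      have h5 := h4.symm.append_left (v := p) (c := []) (by simpa using hp)
      have h6 := h2.append_right (v := [((l ++ [Mark.unmatched, .unmatched] ++ t).length, h)])
        (c := l ++ [Mark.unmatched, .unmatched] ++ (t ++ y ++ r'))
        ⟨l ++ [.unmatched, .unmatched] ++ t, x, y, r', rfl, hh, by simp, by simp [Reads]⟩
      refine EdgeEqv.trans ?_ h6
      simpa [Nat.add_assoc, Nat.add_comm 1, Nat.add_comm 2] using h5
    · obtain ⟨v, h1, h2, h3⟩ := exists_of_split_step s d z hh
      refine ⟨p ++ shift l'.length v, ?_, ?_, by simp; omega⟩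
      · have := hp.append (h1.whisker l' r')
        simpa using this
      · have := (h2.whisker l' r').append_left hp
        simpa using this

/-- The piece is no vertex outside the boxes. -/
def EdgeGen.NoVertex : EdgeGen → Prop
  | merge _ _ => False
  | split _ _ => False
  | _ => True

/-- All matched edges can be contracted to boxes. -/
theorem exists_noVertex (w : Word EdgeGen) (h : Reads EdgeRule [] w []) :
    ∃ w', Reads EdgeRule [] w' [] ∧ EdgeEqv [] [] w w' ∧ ∀ p ∈ w', p.2.NoVertex := by
  induction hn : edgeWeight w using Nat.strong_induction_on generalizing w with
  | _ n ih =>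
  subst hn
  by_cases hw : ∀ p ∈ w, p.2.NoVertex
  · exact ⟨w, h, .refl _, hw⟩
  · push Not at hw
    obtain ⟨⟨i, g⟩, hg, hv⟩ := hw
    obtain ⟨p, q, rfl⟩ := List.append_of_mem hg
    obtain ⟨m, hp, l, x, y, r, rfl, hh, rfl, hq⟩ := reads_append.1 h
    suffices ∃ w', Reads EdgeRule [] w' [] ∧ EdgeEqv [] [] (p ++ (l.length, g) :: q) w' ∧
        edgeWeight w' < edgeWeight (p ++ (l.length, g) :: q) by
      obtain ⟨w', h1, h2, h3⟩ := this
      obtain ⟨w'', h4, h5, h6⟩ := ih _ h3 w' h1 rfl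
      exact ⟨w'', h4, h2.trans h5, h6⟩
    cases hh with
    | merge s d z =>
      obtain ⟨v, h1, h2, h3⟩ := exists_of_merge s d hq
      exact ⟨p ++ v, hp.append h1, h2.append_left hp, by simp [EdgeGen.weight]; omega⟩
    | split s d z =>
      obtain ⟨v, h1, h2, h3⟩ := exists_of_split s d p hp
      refine ⟨v ++ q, h1.append hq, ?_, by simp [EdgeGen.weight]; omega⟩
      simpa using h2.append_right hq
    | cupUnmatched => exact absurd trivial hv
    | capUnmatched => exact absurd trivial hv
    | cupMatched => exact absurd trivial hv
    | capMatched => exact absurd trivial hv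
    | cross => exact absurd trivial hv
    | box => exact absurd trivial hv

/-- The number on a strand, if any, has the property `P`. -/
def Mark.Satisfies (P : Bool → ℤ → Prop) : Mark → Prop
  | unmatched => True
  | matched _ d z => P d z

/-- The rule for pieces without vertices whose strands have only numbers between `N` and `B`. -/
def BoundedRule (N B : ℤ) (g : EdgeGen) (x y : List Mark) : Prop :=
  EdgeRule g x y ∧ g.NoVertex ∧
    ∀ m ∈ x ++ y, m.Satisfies fun _ z => N ≤ z ∧ z ≤ B

/-- In a word without vertices, the numbers of strands running upwards to the dot grow from bottom to
top, those of the other matched strands from top to bottom. Hence all numbers exceed their lower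
bound. -/
theorem Word.Reads.boundedRule_succ {N B : ℤ} {w : Word EdgeGen} : ∀ {a b : List Mark},
    Reads (BoundedRule N B) a w b → (∀ m ∈ a, m.Satisfies fun d z => d = true → N + 1 ≤ z) →
      (∀ m ∈ b, m.Satisfies fun d z => d = false → N + 1 ≤ z) →
        Reads (BoundedRule (N + 1) B) a w b ∧ ∀ m ∈ a, m.Satisfies fun d z => d = false → N + 1 ≤ z := by
  induction w with
  | nil => rintro a b rfl h1 h2; exact ⟨rfl, h2⟩
  | cons s w ih =>
    obtain ⟨i, g⟩ := s
    rintro a b ⟨l, x, y, r, rfl, ⟨hh, hv, hN⟩, rfl, h4⟩ ha hb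
    simp only [List.mem_append, or_imp, forall_and] at ha hN
    have up : ∀ m ∈ y, m.Satisfies fun d z => d = true → N + 1 ≤ z := by
      cases hh with
      | merge => exact hv.elim
      | split => exact hv.elim
      | cupMatched s d x y h =>
        cases d <;> simp_all [Mark.Satisfies, Grows] <;> omega
      | _ => simp_all [Mark.Satisfies]
    obtain ⟨h5, h6⟩ := ih h4 (by simp only [List.mem_append, or_imp, forall_and]
                                 exact ⟨⟨ha.1.1, up⟩, ha.2⟩) hb
    simp only [List.mem_append, or_imp, forall_and] at h6
    have down : ∀ m ∈ x, m.Satisfies fun d z => d = false → N + 1 ≤ z := by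
      cases hh with
      | merge => exact hv.elim
      | split => exact hv.elim
      | capMatched s d x y h =>
        cases d <;> simp_all [Mark.Satisfies, Grows] <;> omega
      | _ => simp_all [Mark.Satisfies]
    have both : ∀ m : Mark, (m.Satisfies fun d z => d = true → N + 1 ≤ z) →
        (m.Satisfies fun d z => d = false → N + 1 ≤ z) → m.Satisfies fun _ z => N + 1 ≤ z := by
      rintro (_ | ⟨s, _ | _, z⟩) <;> simp [Mark.Satisfies]
    have bound : ∀ m : Mark, (m.Satisfies fun _ z => N + 1 ≤ z) →
        (m.Satisfies fun _ z => N ≤ z ∧ z ≤ B) → m.Satisfies fun _ z => N + 1 ≤ z ∧ z ≤ B := by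
      rintro (_ | ⟨s, d, z⟩) <;> simp +contextual [Mark.Satisfies]
    refine ⟨⟨l, x, y, r, rfl, ⟨hh, hv, ?_⟩, rfl, h5⟩, ?_⟩
    · simp only [List.mem_append, or_imp, forall_and]
      exact ⟨fun m hm => bound m (both m (ha.1.2 m hm) (down m hm)) (hN.1 m hm),
        fun m hm => bound m (both m (up m hm) (h6.1.2 m hm)) (hN.2 m hm)⟩
    · simp only [List.mem_append, or_imp, forall_and]
      exact ⟨⟨h6.1.1, down⟩, h6.2⟩

/-- The numbers of a word without vertices are bounded. -/
theorem Word.Reads.exists_boundedRule {w : Word EdgeGen} : ∀ {a b : List Mark}, Reads EdgeRule a w b →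
    (∀ p ∈ w, p.2.NoVertex) → ∃ K : ℤ, ∀ L ≥ K, Reads (BoundedRule (-L) L) a w b := by
  have key : ∀ x : List Mark,
      ∃ K : ℤ, ∀ L ≥ K, ∀ m ∈ x, m.Satisfies fun _ z => -L ≤ z ∧ z ≤ L := by
    intro x
    induction x with
    | nil => exact ⟨0, by simp⟩
    | cons m x ih =>
      obtain ⟨K, hK⟩ := ih
      obtain _ | ⟨s, d, z⟩ := m
      · exact ⟨K, fun M h => by simpa [Mark.Satisfies] using hK M h⟩
      · refine ⟨max K |z|, fun L h => ?_⟩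
        simp only [List.mem_cons, forall_eq_or_imp]
        exact ⟨abs_le.1 ((le_max_right _ _).trans h), hK L ((le_max_left _ _).trans h)⟩
  induction w with
  | nil => rintro a b rfl -; exact ⟨0, fun _ _ => rfl⟩
  | cons s w ih =>
    obtain ⟨i, g⟩ := s
    rintro a b ⟨l, x, y, r, rfl, hh, rfl, h4⟩ hw
    obtain ⟨K, hK⟩ := ih h4 fun p hp => hw p (List.mem_cons_of_mem _ hp)
    obtain ⟨K', hK'⟩ := key (x ++ y)
    exact ⟨max K K', fun L h => ⟨l, x, y, r, rfl, ⟨hh, hw (l.length, g) List.mem_cons_self,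
      hK' L ((le_max_right _ _).trans h)⟩, rfl, hK L ((le_max_left _ _).trans h)⟩⟩

/-- The piece has no matched strands. -/
def FreeRule (g : EdgeGen) (x y : List Mark) : Prop :=
  EdgeRule g x y ∧ g.NoVertex ∧ ∀ m ∈ x ++ y, m = .unmatched

/-- A closed word without vertices has no matched strands. -/
theorem Word.Reads.freeRule {w : Word EdgeGen} (h : Reads EdgeRule [] w [])
    (hw : ∀ p ∈ w, p.2.NoVertex) : Reads FreeRule [] w [] := by
  obtain ⟨K, hK⟩ := h.exists_boundedRule hw
  have key : ∀ n : ℕ, Reads (BoundedRule (-K + n) K) [] w [] := by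
    intro n
    induction n with
    | zero => simpa using hK K le_rfl
    | succ n ih =>
      have := (ih.boundedRule_succ (by simp) (by simp)).1
      simpa [add_assoc] using this
  -- the bounds are contradictory for large `n`
  refine (key (K + K + 1).toNat).mono ?_
  rintro g x y ⟨h1, h2, h3⟩
  refine ⟨h1, h2, fun m hm => ?_⟩
  have := h3 m hm
  obtain _ | ⟨s, d, z⟩ := m
  · rfl
  · simp only [Mark.Satisfies] at this
    omega

end GrapheneLink

/-! ### The isomorphism of categories -/

namespace GrapheneLink

open Word

/-- Hollow vertices are replaced by solid ones. -/
def solidPiece : MGen → Word EdgeGen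
  | .cup a => [(0, .cup a)]
  | .cap a => [(0, .cap a)]
  | .cross a b => [(0, .cross a b)]
  | .merge true s d => [(0, .merge s d)]
  | .merge false s d => [(0, .cross .unmatched .unmatched), (0, .merge s d)]
  | .split true s d => [(0, .split s d)]
  | .split false s d => [(0, .split s d), (0, .cross .unmatched .unmatched)]

theorem reads_of_edgeRule {g : EdgeGen} {x y : List Mark} (h : EdgeRule g x y) :
    Reads EdgeRule x [(0, g)] y :=
  ⟨[], x, y, [], rfl, h, (List.append_nil x).symm, List.append_nil y⟩

theorem MarkRule.solid {g : MGen} {x y : List Mark} (h : MarkRule g x y) :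
    Reads EdgeRule x (solidPiece g) y ∧
      ribbonTheory.Eqv x y [(0, g)] (expand edgePiece (solidPiece g)) := by
  cases h with
  | cupUnmatched => exact ⟨reads_of_edgeRule .cupUnmatched, .refl _⟩
  | capUnmatched => exact ⟨reads_of_edgeRule .capUnmatched, .refl _⟩
  | cupMatched s d x y h => exact ⟨reads_of_edgeRule (.cupMatched s d x y h), .refl _⟩
  | capMatched s d x y h => exact ⟨reads_of_edgeRule (.capMatched s d x y h), .refl _⟩
  | cross x y => exact ⟨reads_of_edgeRule (.cross x y), .refl _⟩
  | merge c s d z =>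
    cases c
    · refine ⟨(reads_of_edgeRule (.cross .unmatched .unmatched)).append
        (reads_of_edgeRule (.merge s d z)), ?_⟩
      obtain ⟨z', e⟩ := Tag.exists_mark_inner s d z
      rw [← e 0]
      exact (RibbonLemma.mergeHollow s d).eqv z' 0
    · exact ⟨reads_of_edgeRule (.merge s d z), .refl _⟩
  | split c s d z =>
    cases c
    · have h := (reads_of_edgeRule (.split s d z)).append
        (reads_of_edgeRule (.cross .unmatched .unmatched))
      exact ⟨h, .of_rule (.inr (.M5 s d)) (reads_of_markRule (.split false s d z))
        (reads_edgeWord h)⟩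
    · exact ⟨reads_of_edgeRule (.split s d z), .refl _⟩

theorem Word.Reads.solid {w : Word MGen} : ∀ {a b : List Mark}, Reads MarkRule a w b →
    Reads EdgeRule a (Word.expand solidPiece w) b ∧
      ribbonTheory.Eqv a b w (Word.expand edgePiece (Word.expand solidPiece w)) := by
  induction w with
  | nil => rintro a b rfl; exact ⟨rfl, .refl _⟩
  | cons s w ih =>
    obtain ⟨i, g⟩ := s
    rintro a b ⟨l, x, y, r, rfl, h2, rfl, h4⟩
    obtain ⟨h5, h6⟩ := ih h4
    obtain ⟨h7, h8⟩ := h2.solid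
    refine ⟨?_, ?_⟩
    · rw [Word.expand_cons]
      exact (h7.whisker l r).append h5
    · have := (h8.whisker l r).append h6 ((reads_of_markRule h2).whisker l r) h4
      simpa using this

/-- A piece without matched strands as a piece of a picture with boxes. -/
def EdgeGen.toBox : EdgeGen → BoxGen
  | cup _ => .cup
  | cap _ => .cap
  | box s d => .box s d
  | _ => .virtual

theorem FreeRule.toBox {g : EdgeGen} {x y : List Mark} (h : FreeRule g x y) :
    boxTheory.T g.toBox (x.map fun _ => ()) (y.map fun _ => ()) ∧
      boxPiece g.toBox = edgePiece g := by
  obtain ⟨h1, h2, h3⟩ := h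
  cases h1 with
  | cupUnmatched => exact ⟨⟨rfl, rfl⟩, rfl⟩
  | capUnmatched => exact ⟨⟨rfl, rfl⟩, rfl⟩
  | box s d => exact ⟨⟨rfl, rfl⟩, rfl⟩
  | cross x y =>
    obtain rfl : x = .unmatched := h3 x (by simp)
    obtain rfl : y = .unmatched := h3 y (by simp)
    exact ⟨⟨rfl, rfl⟩, rfl⟩
  | cupMatched s d x y => simp at h3
  | capMatched s d x y => simp at h3
  | merge => exact h2.elim
  | split => exact h2.elim

theorem Word.Reads.toBox {w : Word EdgeGen} : ∀ {a b : List Mark}, Reads FreeRule a w b →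
    ∃ v : Word BoxGen, Reads boxTheory.T (a.map fun _ => ()) v (b.map fun _ => ()) ∧
      Word.expand boxPiece v = Word.expand edgePiece w := by
  induction w with
  | nil => rintro a b rfl; exact ⟨[], rfl, rfl⟩
  | cons s w ih =>
    obtain ⟨i, g⟩ := s
    rintro a b ⟨l, x, y, r, rfl, h2, rfl, h4⟩
    obtain ⟨v, h5, h6⟩ := ih h4
    obtain ⟨h7, h8⟩ := h2.toBox
    exact ⟨(l.length, g.toBox) :: v, ⟨l.map fun _ => (), _, _, r.map fun _ => (), by simp, h7,
      by simp only [List.map_append], by simpa only [List.map_append] using h5⟩, by simp [h6, h8]⟩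

/-- By ribbon moves, every matched edge becomes a box. -/
theorem MatchedDiagram.exists_boxes (D : MatchedDiagram) : ∃ v : Word BoxGen,
    Reads boxTheory.T [] v [] ∧ ribbonTheory.Eqv [] [] D.word (expand boxPiece v) := by
  obtain ⟨h1, h2⟩ := D.reads_markRule.solid
  obtain ⟨w, h3, h4, h5⟩ := exists_noVertex _ h1
  obtain ⟨v, h6, h7⟩ := (h3.freeRule h5).toBox
  exact ⟨v, h6, by rw [h7]; exact h2.trans h4⟩

theorem isSimple_boxPiece (g : BoxGen) : ∀ p ∈ boxPiece g, p.2.IsSimple := by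
  rcases g with (_ | _ | (_ | _) | _) | ⟨s, d⟩ <;>
    simp [boxPiece, matchedPiece, crossingReplacement, bar, MGen.IsSimple]

theorem isSimple_expand_boxPiece (v : Word BoxGen) :
    ∀ p ∈ expand boxPiece v, p.2.IsSimple := by
  intro p hp
  simp only [expand, List.mem_flatMap, shift, List.mem_map] at hp
  obtain ⟨s, -, q, hq, rfl⟩ := hp
  exact isSimple_boxPiece s.2 q hq

/-- Every matched diagram is related to a simple one by ribbon moves. -/
theorem MatchedDiagram.exists_isSimple (D : MatchedDiagram) :
    ∃ D' : MatchedDiagram, D'.IsSimple ∧ D.RibbonEquivalent D' := by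
  obtain ⟨v, -, h⟩ := D.exists_boxes
  refine ⟨.ofReads (expand boxPiece v) (h.reads D.reads_markRule), isSimple_expand_boxPiece v,
    MatchedDiagram.ribbonEquivalent_of_eqv h⟩

theorem reads_boxPiece_rule (g : BoxGen) : Reads MGen.Rule (List.replicate g.src .unmatched)
    (boxPiece g) (List.replicate g.tgt .unmatched) := by
  simpa [Mark.strand] using (reads_boxPiece g).map Mark.strand fun _ _ _ h => MarkRule.rule h

theorem boxWord_linkWord_boxPiece (g : BoxGen) : boxTheory.Eqv (units g.src) (units g.tgt)
    (boxWord (linkWord (List.replicate g.src .unmatched) (boxPiece g))) [(0, g)] := by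
  rcases g with g | ⟨s, d⟩
  · exact (linkWord_matchedPiece' g).boxWord fun _ _ h => h.elim
  · cases s <;> cases d
    exacts [BoxLemma.clasp₃.eqv, BoxLemma.clasp₄.eqv, BoxLemma.clasp₂.eqv, BoxLemma.clasp₁.eqv]

theorem boxWord_append (v w : Word VGen) : boxWord (v ++ w) = boxWord v ++ boxWord w :=
  expand_append _ v w

theorem boxWord_shift (n : ℕ) (w : Word VGen) : boxWord (shift n w) = shift n (boxWord w) :=
  expand_shift _ n w

theorem reads_boxWord {w : Word VGen} {a b : List Unit} (h : Reads VGen.Rule a w b) :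
    Reads boxTheory.T a (boxWord w) b := by
  have := h.expand (f := fun g => [(0, BoxGen.link g)]) (φ := id) (T' := boxTheory.T) ?_
  · simpa [boxWord] using this
  · rintro g x y ⟨rfl, rfl⟩
    rw [List.map_id, List.map_id]
    exact ⟨[], _, _, [], rfl, ⟨rfl, rfl⟩, (List.append_nil _).symm, List.append_nil _⟩

/-- Replacing boxes by clasps, and these by matched edges, yields an equivalent picture. -/
theorem boxWord_linkWord {w : Word BoxGen} : ∀ {a b : List Unit}, Reads boxTheory.T a w b →
    boxTheory.Eqv a b (boxWord (linkWord (a.map fun _ => .unmatched) (expand boxPiece w))) w := by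
  induction w with
  | nil => exact fun _ => .refl _
  | cons s w ih =>
    obtain ⟨i, g⟩ := s
    rintro a b ⟨l, x, y, r, rfl, ⟨rfl, rfl⟩, rfl, h4⟩
    have h1 := reads_boxPiece_rule g
    have h2 := h1.whisker (l.map fun _ => Strand.unmatched) (r.map fun _ => Strand.unmatched)
    have h3 := linkWord_append (w := expand boxPiece w) h2
    rw [linkWord_shift _ _ h1, flatMap_linkStrand_unmatched] at h3
    have h5 := (boxWord_linkWord_boxPiece g).whisker l r
    have h6 := h5.append (ih h4) ?_ ?_
    · simp only [shift_cons, Nat.add_zero, shift_nil, List.singleton_append] at h6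
      convert h6 using 1
      simp only [List.length_map, List.map_append, List.map_replicate, expand_cons] at h3 ⊢
      rw [h3, boxWord_append, boxWord_shift]
    · have := (reads_boxWord (reads_linkWord h1)).whisker l r
      simpa [linkStrand, List.flatMap_replicate] using this
    · have h7 := h4.expand (f := boxPiece) (φ := fun _ => Strand.unmatched) (T' := MGen.Rule) ?_
      · have := reads_boxWord (reads_linkWord h7)
        simpa only [flatMap_linkStrand_unmatched] using this
      · rintro g x y ⟨rfl, rfl⟩
        simpa using reads_boxPiece_rule g

/-- Replacing matched edges by clasps, and classical crossings by matched edges, yields an equivalent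
matched diagram. -/
theorem MatchedDiagram.toMatched_toVirtual (D : MatchedDiagram) :
    D.toVirtual.toMatched.Equivalent D := by
  obtain ⟨v, hv, h⟩ := D.exists_boxes
  let D' := MatchedDiagram.ofReads (expand boxPiece v) (h.reads D.reads_markRule)
  have h1 : D.Equivalent D' := MatchedDiagram.equivalent_of_eqv h.of_ribbon
  have h2 : D'.toVirtual.toMatched.Equivalent D' := by
    refine MatchedDiagram.equivalent_of_eqv ?_
    have := (boxWord_linkWord hv).expand_boxPiece
    rwa [expand_boxPiece_boxWord] at this
  exact Relation.EqvGen.trans _ _ _ h1.toVirtual.toMatched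
    (Relation.EqvGen.trans _ _ _ h2 (Relation.EqvGen.symm _ _ h1))

/-- Maps of diagrams that respect equivalence induce maps of their classes. -/
def Graphene.toLink : Graphene → VirtualLink :=
  Quot.lift (fun D => D.toVirtual.toLink) fun D D' h => Quot.eqvGen_sound
    (MatchedDiagram.Equivalent.toVirtual (Relation.EqvGen.rel D D' h))

/-- The graphene of a virtual link. -/
def VirtualLink.toGraphene : VirtualLink → Graphene :=
  Quot.lift (fun L => L.toMatched.toGraphene) fun L L' h => Quot.eqvGen_sound
    (VirtualDiagram.Equivalent.toMatched (Relation.EqvGen.rel L L' h))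

theorem Graphene.toGraphene_toLink (G : Graphene) : G.toLink.toGraphene = G := by
  obtain ⟨D⟩ := G
  exact Quot.eqvGen_sound D.toMatched_toVirtual

theorem VirtualLink.toLink_toGraphene (L : VirtualLink) : L.toGraphene.toLink = L := by
  obtain ⟨L⟩ := L
  exact Quot.eqvGen_sound L.toVirtual_toMatched

end GrapheneLink

open GrapheneLink CategoryTheory in
theorem mainTheorem1 :
    -- every matched diagram has a simple representative up to ribbon moves
    (∀ D : MatchedDiagram, ∃ D' : MatchedDiagram, D'.IsSimple ∧ D.RibbonEquivalent D') ∧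
    -- the two replacements respect the moves
    (∀ D D' : MatchedDiagram, D.Equivalent D' → D.toVirtual.Equivalent D'.toVirtual) ∧
    (∀ L L' : VirtualDiagram, L.Equivalent L' → L.toMatched.Equivalent L'.toMatched) ∧
    -- they are inverse to each other on equivalence classes
    (∀ D : MatchedDiagram, D.toVirtual.toMatched.Equivalent D) ∧
    (∀ L : VirtualDiagram, L.toMatched.toVirtual.Equivalent L) ∧
    -- they induce an isomorphism of categories
    ∃ (K : Discrete Graphene ⥤ Discrete VirtualLink) (K' : Discrete VirtualLink ⥤ Discrete Graphene),
      (∀ D : MatchedDiagram, K.obj ⟨D.toGraphene⟩ = ⟨D.toVirtual.toLink⟩) ∧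
      (∀ L : VirtualDiagram, K'.obj ⟨L.toLink⟩ = ⟨L.toMatched.toGraphene⟩) ∧
      K ⋙ K' = 𝟭 (Discrete Graphene) ∧ K' ⋙ K = 𝟭 (Discrete VirtualLink) := by
  refine ⟨MatchedDiagram.exists_isSimple, fun _ _ h => h.toVirtual, fun _ _ h => h.toMatched,
    MatchedDiagram.toMatched_toVirtual, VirtualDiagram.toVirtual_toMatched,
    Discrete.functor fun G => ⟨G.toLink⟩, Discrete.functor fun L => ⟨L.toGraphene⟩,
    fun _ => rfl, fun _ => rfl, ?_, ?_⟩
  · exact CategoryTheory.Functor.ext (fun ⟨G⟩ => congrArg Discrete.mk G.toGraphene_toLink)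
      fun _ _ _ => Subsingleton.elim _ _
  · exact CategoryTheory.Functor.ext (fun ⟨L⟩ => congrArg Discrete.mk L.toLink_toGraphene)
      fun _ _ _ => Subsingleton.elim _ _
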